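/- **Setting.** Let $\gamma\ge 0$, $c_0\ge 0$, $\alpha,c_1,c_2,c_3>0$ and consider, for $\varepsilon>0$, the general Degasperis–Procesi equation $$\partial_t\{u-\alpha^2\varepsilon^2u_{xx}\}+\partial_x\{c_0u+c_1u^2-c_2\varepsilon^2u_x^2+\varepsilon^2(\gamma-c_3u)u_{xx}\}=0 .\tag{1}$$ Put $\beta=\sqrt{c_1/c_3}$, $r=c_3/(c_2+c_3)$, $q(V)=\frac{c_3(V-c_0)}{c_1(\gamma+\alpha^2V)}$ and $F_V(g)=g^2-2\frac{2-q}{2-r}g^{2-r}+\frac{1-q}{1-r}g^{2-2r}-C$ with $q=q(V)$ and $C$ such that $F_V(1)=0$. Let $0<A_1<A_2$ and, for $i=1,2$, let $V_i\in\mathbb R$, $g_i\in(0,1)$ satisfy $F_{V_i}(g_i)=0$, $V_i=\alpha^{-2}\big(\frac{c_3}{1-g_i^r}A_i-\gamma\big)$ and $c_3-A_i^{-1}(\gamma+c_0\alpha^2)(1-g_i^r)<c_1r\alpha^2$. Let $\omega_i$ be the soliton profile of amplitude $A_i$: a smooth even function with $\omega_i(0)=1$, $\omega_i(\pm\infty)=0$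 and $$\Big\{1-\tfrac{c_3A_i}{\gamma+\alpha^2V_i}\omega_i\Big\}\omega_i''=\tfrac{c_2A_i}{\gamma+\alpha^2V_i}(\omega_i')^2+\tfrac{(V_i-c_0)\omega_i-c_1A_i\omega_i^2}{\beta^2(\gamma+\alpha^2V_i)} .$$ Let $x_1^0>x_2^0$, let $\varphi_{i0}(t)=V_it+x_i^0$, and let the two trajectories meet at a point $x^*$ at an instant $t^*>0$. For functions $S_i(\tau)$, $\varphi_{i1}(\tau)$ on $\mathbb R$ put $$u(t,x,\varepsilon)=\sum_{i=1}^2G_i\,\omega_i\big(\beta(x-\varphi_i)/\varepsilon\big),\quad G_i=A_i+S_i(\tau),\quad \varphi_i=\varphi_{i0}(t)+\varepsilon\varphi_{i1}(\tau),\quad \tau=\beta\big(\varphi_{20}(t)-\varphi_{10}(t)\big)/\varepsilon .\tag{2}$$ **The system for the corrections.** Put $\dot\psi_0=\beta(V_2-V_1)$, $\chi_i=V_i\tau/\dot\psi_0+\varphi_{i1}$, $\sigma=\beta(\chi_1-\chi_2)$, $\dot\varphi_i=V_i+\dot\psi_0\varphi_{i1}'(\tau)$, $\eta_{12}=\eta-\sigma$,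 $\eta_{22}=\eta$, $a_{1,i}=\int\omega_i\,d\eta$, $a_{2,i}'=\int(\omega_i')^2d\eta$. For $H=H(u,w)$ put $a_{H,i}=\int H(A_i\omega_i,\beta A_i\omega_i')\,d\eta$ and $$R_H^{(n)}(\tau)=\int\eta^n\Big\{H\Big(\sum_iG_i\omega_i(\eta_{i2}),\beta\sum_jG_j\omega_j'(\eta_{j2})\Big)-\sum_iH\big(A_i\omega_i(\eta_{i2}),\beta A_i\omega_i'(\eta_{i2})\big)\Big\}d\eta .$$ With $w=\varepsilon u_x$ let $P_1=c_0u+c_1u^2-(c_2-c_3)w^2$, $Q_2=u^2+\alpha^2w^2$, $\mathbb P_2=c_0u^2+\frac43c_1u^3-(3\gamma+(2c_2-5c_3)u)w^2$, $K_2=(2c_2-c_3)w^3$, and put $$L=\beta\sum_ia_{2,i}'\big(G_i^2\dot\varphi_i-A_i^2V_i\big)-\dot\psi_0\big(G_1S_2'-G_2S_1'\big)\int\omega_1'(\eta-\sigma)\omega_2(\eta)\,d\eta+\beta G_1G_2(\dot\varphi_1+\dot\varphi_2)\int\omega_1'(\eta-\sigma)\omega_2'(\eta)\,d\eta .$$ The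 system is $$\sum_ia_{1,i}S_i=0,\qquad \dot\psi_0\tfrac{d}{d\tau}R_{Q_2}^{(0)}+R_{K_2}^{(0)}=0,\qquad \dot\psi_0\tfrac{d}{d\tau}\sum_ia_{1,i}\{A_i\varphi_{i1}+\chi_iS_i\}=R_{P_1}^{(0)},$$ $$\dot\psi_0\tfrac{d}{d\tau}\Big\{\sum_ia_{Q_2,i}\varphi_{i1}+\chi_2R_{Q_2}^{(0)}+\beta^{-1}R_{Q_2}^{(1)}\Big\}=R_{\mathbb P_2}^{(0)}-2\alpha^2\beta L-\chi_2R_{K_2}^{(0)}-\beta^{-1}R_{K_2}^{(1)} .\tag{3}$$ **Weak asymptotic solutions.** Let $T>0$. A family $v(t,x,\varepsilon)$ is $O_{\mathcal D'}(\varepsilon^\varkappa)$ if for each real $\psi\in C_c^\infty(\mathbb R)$ the function $\int v\psi\,dx$ is $C^\infty$ in $t\in(0,T)$ for each $\varepsilon>0$, is $O(\varepsilon^\varkappa)$ as $\varepsilon\to0$ uniformly in $t\in(0,T)$, and is piecewise continuous in $t$ uniformly in small $\varepsilon$. A family $u$ is a weak asymptotic mod $O_{\mathcal D'}(\varepsilon^2)$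 solution of (1) if it is $C^\infty$ on $(0,T)\times\mathbb R$ for each $\varepsilon>0$, belongs to $C(0,T;\mathcal D'(\mathbb R))$ uniformly in $\varepsilon\ge0$, and $$\partial_tu+\partial_xP_1=O_{\mathcal D'}(\varepsilon^2),\qquad \partial_tQ_2+\partial_x\{\mathbb P_2+2\alpha^2\varepsilon^2u_xu_t\}+\varepsilon^{-1}K_2=O_{\mathcal D'}(\varepsilon^2).$$ **Theorem.** Assume that the system (3) has a smooth solution $S_i,\varphi_{i1}$ on $\mathbb R$ with $S_i\to0$ as $\tau\to\pm\infty$, $\varphi_{i1}\to0$ as $\tau\to-\infty$, $\varphi_{i1}\to\varphi_{i1}^\infty=\mathrm{const}$ as $\tau\to+\infty$, the limits being attained rapidly ($S_i'$ and $\varphi_{i1}'$ decay faster than every power of $|\tau|$). Then, for every $T>0$, the function (2) is a weak asymptotic mod $O_{\mathcal D'}(\varepsilon^2)$ solution of (1) on $(0,T)$, and it has the initial data $\sum_iA_i\omega_i(\beta(x-x_i^0)/\varepsilon)$ up to $O(\varepsilon^2)$, uniformly in $x$ (hence also in the sense of $O_{\mathcal D'}(\varepsilon^2)$). The collision is elastic: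 for each $\delta>0$, up to $O(\varepsilon^2)$ uniformly in $x$ and $t$, the function (2) equals $\sum_iA_i\omega_i(\beta(x-\varphi_{i0}(t))/\varepsilon)$ for $0\le t\le t^*-\delta$, $t\le T$, and $\sum_iA_i\omega_i(\beta(x-\varphi_{i0}(t)-\varepsilon\varphi_{i1}^\infty)/\varepsilon)$ for $t^*+\delta\le t\le T$. -/

import Mathlib

open Set Filter Topology MeasureTheory
open scoped ContDiff

noncomputable section

namespace DP

/-! ### The model and its solitary waves -/

/-- The real coefficients of the general Degasperis-Procesi equation
`∂ₜ(u - α²ε²uₓₓ) + ∂ₓ(c₀u + c₁u² - c₂ε²uₓ² + ε²(γ - c₃u)uₓₓ) = 0`. -/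
structure Params where
  α : ℝ
  γ : ℝ
  c0 : ℝ
  c1 : ℝ
  c2 : ℝ
  c3 : ℝ

/-- Sign conditions on the coefficients. -/
def Params.Admissible (P : Params) : Prop :=
  0 ≤ P.γ ∧ 0 ≤ P.c0 ∧ 0 < P.α ∧ 0 < P.c1 ∧ 0 < P.c2 ∧ 0 < P.c3

/-- `β = √(c₁ / c₃)`. -/
def Params.β (P : Params) : ℝ := Real.sqrt (P.c1 / P.c3)

/-- `r = c₃ / (c₂ + c₃)`. -/
def Params.r (P : Params) : ℝ := P.c3 / (P.c2 + P.c3)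

/-- `q = c₃ (V - c₀) / (c₁ (γ + α² V))`. -/
def Params.q (P : Params) (V : ℝ) : ℝ := P.c3 * (V - P.c0) / (P.c1 * (P.γ + P.α ^ 2 * V))

/-- The potential
`F(g) = g² - 2 (2-q)/(2-r) g^(2-r) + (1-q)/(1-r) g^(2-2r) - C`, with `C` such that `F(1) = 0`. -/
def Params.potential (P : Params) (V g : ℝ) : ℝ :=
  g ^ 2 - 2 * ((2 - P.q V) / (2 - P.r)) * g ^ (2 - P.r)
    + (1 - P.q V) / (1 - P.r) * g ^ (2 - 2 * P.r)
    - (1 - 2 * ((2 - P.q V) / (2 - P.r)) + (1 - P.q V) / (1 - P.r))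

/-- The relation between the amplitude `A`, the velocity `V` and the root `g ∈ (0,1)` of the
potential: `F(g) = 0` and `V = (c₃ A / (1 - g^r) - γ) / α²`. -/
def Params.IsVelocity (P : Params) (A V g : ℝ) : Prop :=
  g ∈ Ioo (0 : ℝ) 1 ∧ P.potential V g = 0 ∧
    V = 1 / P.α ^ 2 * (P.c3 / (1 - g ^ P.r) * A - P.γ)

/-- The criterion of existence of a smooth solitary wave of amplitude `A`. -/
def Params.SolitonCriterion (P : Params) (A g : ℝ) : Prop :=
  P.c3 - A⁻¹ * (P.γ + P.c0 * P.α ^ 2) * (1 - g ^ P.r) < P.c1 * P.r * P.α ^ 2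

/-- `w` is the profile of the soliton `A w(β (x - V t) / ε)` of amplitude `A` and velocity `V`:
smooth, even, vanishing at infinity, `w(0) = 1`, and a solution of the profile equation. -/
structure Params.IsProfile (P : Params) (A V : ℝ) (w : ℝ → ℝ) : Prop where
  smooth : ContDiff ℝ ∞ w
  even : ∀ η, w (-η) = w η
  top : Tendsto w atTop (𝓝 0)
  bot : Tendsto w atBot (𝓝 0)
  zero : w 0 = 1
  ode : ∀ η, (1 - P.c3 * A / (P.γ + P.α ^ 2 * V) * w η) * deriv (deriv w) η =
    P.c2 * A / (P.γ + P.α ^ 2 * V) * deriv w η ^ 2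
      + 1 / (P.β ^ 2 * (P.γ + P.α ^ 2 * V)) * ((V - P.c0) * w η - P.c1 * A * w η ^ 2)

/-! ### Densities of the conservation law and of the balance law

The arguments of the densities are the values `u` and `w = ε uₓ`. -/

/-- `c₀u + c₁u² - (c₂ - c₃)(εuₓ)²` -/
def Params.p1 (P : Params) (u w : ℝ) : ℝ := P.c0 * u + P.c1 * u ^ 2 - (P.c2 - P.c3) * w ^ 2

/-- `u² + α²(εuₓ)²` -/
def Params.q2 (P : Params) (u w : ℝ) : ℝ := u ^ 2 + P.α ^ 2 * w ^ 2

/-- `c₀u² + (4/3)c₁u³ - (3γ + (2c₂ - 5c₃)u)(εuₓ)²` -/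
def Params.pp2 (P : Params) (u w : ℝ) : ℝ :=
  P.c0 * u ^ 2 + 4 / 3 * P.c1 * u ^ 3 - (3 * P.γ + (2 * P.c2 - 5 * P.c3) * u) * w ^ 2

/-- `(2c₂ - c₃)(εuₓ)³` -/
def Params.k2 (P : Params) (_u w : ℝ) : ℝ := (2 * P.c2 - P.c3) * w ^ 3

/-! ### Weak asymptotic solutions

A family `u ε t x` depends on the small parameter `ε > 0`, on `t ∈ (0,T)` and on `x ∈ ℝ`. -/

/-- Real test functions on the line. -/
def IsTest (ψ : ℝ → ℝ) : Prop := ContDiff ℝ ∞ ψ ∧ HasCompactSupport ψ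

/-- `f ε t` is piecewise continuous in `t ∈ (0,T)`, uniformly in `ε ∈ (0,ε₀]`: away from finitely
many points that do not depend on `ε`, the family is equicontinuous. -/
def PiecewiseContUnif (T ε₀ : ℝ) (f : ℝ → ℝ → ℝ) : Prop :=
  ∃ B : Finset ℝ, ∀ δ > 0, ∃ h > 0, ∀ ε ∈ Ioc 0 ε₀, ∀ t ∈ Ioo 0 T, ∀ t' ∈ Ioo 0 T,
    |t - t'| < h → (∀ b ∈ B, b ∉ uIcc t t') → |f ε t - f ε t'| < δ

/-- `v` is of the value `O_{D'}(ε^κ)`, uniformly in `t ∈ (0,T)`. -/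
def IsOD (T κ : ℝ) (v : ℝ → ℝ → ℝ → ℝ) : Prop :=
  ∀ ψ, IsTest ψ →
    (∀ ε > 0, ContDiffOn ℝ ∞ (fun t => ∫ x, v ε t x * ψ x) (Ioo 0 T)) ∧
    ∃ ε₀ > 0,
      (∃ C, ∀ ε ∈ Ioc 0 ε₀, ∀ t ∈ Ioo 0 T, |∫ x, v ε t x * ψ x| ≤ C * ε ^ κ) ∧
      PiecewiseContUnif T ε₀ (fun ε t => ∫ x, v ε t x * ψ x)

/-- `u` belongs to `C(0,T; D'(ℝ))` uniformly in `ε ≥ 0`: all pairings with test functions are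
continuous in `t` uniformly in `ε`, and converge as `ε → 0`, uniformly in `t`. -/
def ContInDistribUnif (T : ℝ) (u : ℝ → ℝ → ℝ → ℝ) : Prop :=
  ∀ ψ, IsTest ψ → ∃ ε₀ > 0,
    (∀ t ∈ Ioo 0 T, ∀ δ > 0, ∃ h > 0, ∀ ε ∈ Ioc 0 ε₀, ∀ t' ∈ Ioo 0 T,
      |t - t'| < h → |(∫ x, u ε t x * ψ x) - ∫ x, u ε t' x * ψ x| < δ) ∧
    ∃ l : ℝ → ℝ,
      TendstoUniformlyOn (fun ε t => ∫ x, u ε t x * ψ x) l (𝓝[>] 0) (Ioo 0 T)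

/-- `uₓ` for a function `u t x` -/
def dx (u : ℝ → ℝ → ℝ) (t x : ℝ) : ℝ := deriv (fun y => u t y) x

/-- `uₜ` for a function `u t x` -/
def dt (u : ℝ → ℝ → ℝ) (t x : ℝ) : ℝ := deriv (fun s => u s x) t

/-- Left-hand side `∂ₜQ₁ + ∂ₓP₁` of the conservation law, `Q₁ = u`,
`P₁ = c₀u + c₁u² - (c₂ - c₃)(εuₓ)²`. -/
def Params.law1 (P : Params) (ε : ℝ) (u : ℝ → ℝ → ℝ) : ℝ → ℝ → ℝ := fun t x =>
  dt u t x + dx (fun t x => P.p1 (u t x) (ε * dx u t x)) t x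

/-- Left-hand side `∂ₜQ₂ + ∂ₓP₂ + ε⁻¹K₂` of the balance law, `Q₂ = u² + α²(εuₓ)²`,
`P₂ = c₀u² + (4/3)c₁u³ - (3γ + (2c₂ - 5c₃)u)(εuₓ)² + 2α²ε²uₓuₜ`, `K₂ = (2c₂ - c₃)(εuₓ)³`. -/
def Params.law2 (P : Params) (ε : ℝ) (u : ℝ → ℝ → ℝ) : ℝ → ℝ → ℝ := fun t x =>
  dt (fun t x => P.q2 (u t x) (ε * dx u t x)) t x
    + dx (fun t x => P.pp2 (u t x) (ε * dx u t x)
        + 2 * P.α ^ 2 * ε ^ 2 * dx u t x * dt u t x) t x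
    + ε⁻¹ * P.k2 (u t x) (ε * dx u t x)

/-- `u` is a weak asymptotic mod `O_{D'}(ε²)` solution of the model on `(0,T)`. -/
structure Params.IsWeakAsymptoticSolution (P : Params) (T : ℝ) (u : ℝ → ℝ → ℝ → ℝ) : Prop where
  smooth : ∀ ε > 0, ContDiffOn ℝ ∞ (fun z : ℝ × ℝ => u ε z.1 z.2) (Ioo 0 T ×ˢ univ)
  cont : ContInDistribUnif T u
  law1 : IsOD T 2 (fun ε t x => P.law1 ε (u ε) t x)
  law2 : IsOD T 2 (fun ε t x => P.law2 ε (u ε) t x)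

/-! ### The two-soliton ansatz

The index `0` is the first soliton, the index `1` is the second one. -/

/-- Amplitudes, velocities, initial positions and profiles of two solitons. -/
structure Pair where
  A : Fin 2 → ℝ
  V : Fin 2 → ℝ
  x0 : Fin 2 → ℝ
  w : Fin 2 → ℝ → ℝ

/-- The interaction corrections `Sᵢ(τ)` of the amplitudes and `φᵢ₁(τ)` of the phases. -/
structure Corr where
  S : Fin 2 → ℝ → ℝ
  φ : Fin 2 → ℝ → ℝ

/-- Trajectory `φᵢ₀(t) = Vᵢ t + xᵢ⁰` of the noninteracting wave. -/
def Pair.traj (D : Pair) (i : Fin 2) (t : ℝ) : ℝ := D.V i * t + D.x0 i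

/-- Fast time `τ = β (φ₂₀(t) - φ₁₀(t)) / ε`. -/
def Pair.tau (D : Pair) (P : Params) (ε t : ℝ) : ℝ := P.β * (D.traj 1 t - D.traj 0 t) / ε

/-- The sum of two solitons without interaction, with the phases shifted by `ε sᵢ`. -/
def Pair.free (D : Pair) (P : Params) (s : Fin 2 → ℝ) (ε t x : ℝ) : ℝ :=
  ∑ i, D.A i * D.w i (P.β * (x - (D.traj i t + ε * s i)) / ε)

/-- The initial data `∑ Aᵢ wᵢ(β (x - xᵢ⁰) / ε)`. -/
def Pair.initial (D : Pair) (P : Params) (ε x : ℝ) : ℝ :=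
  ∑ i, D.A i * D.w i (P.β * (x - D.x0 i) / ε)

/-- The ansatz `u = ∑ Gᵢ wᵢ(β (x - φᵢ) / ε)`, `Gᵢ = Aᵢ + Sᵢ(τ)`, `φᵢ = φᵢ₀(t) + ε φᵢ₁(τ)`. -/
def Pair.ansatz (D : Pair) (P : Params) (c : Corr) (ε t x : ℝ) : ℝ :=
  ∑ i, (D.A i + c.S i (D.tau P ε t)) *
    D.w i (P.β * (x - (D.traj i t + ε * c.φ i (D.tau P ε t))) / ε)

/-! ### The system for the interaction corrections -/

/-- `ψ̇₀ = β (V₂ - V₁)`, so that `dτ/dt = ψ̇₀ / ε`. -/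
def Pair.psiDot (D : Pair) (P : Params) : ℝ := P.β * (D.V 1 - D.V 0)

/-- `Gᵢ(τ) = Aᵢ + Sᵢ(τ)` -/
def Pair.G (D : Pair) (c : Corr) (i : Fin 2) (τ : ℝ) : ℝ := D.A i + c.S i τ

/-- `χᵢ(τ) = Vᵢ τ / ψ̇₀ + φᵢ₁(τ)`, so that `φᵢ = x* + ε χᵢ`. -/
def Pair.χ (D : Pair) (P : Params) (c : Corr) (i : Fin 2) (τ : ℝ) : ℝ :=
  D.V i * τ / D.psiDot P + c.φ i τ

/-- `σ = β (φ₁ - φ₂) / ε = β (χ₁ - χ₂)` -/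
def Pair.σ (D : Pair) (P : Params) (c : Corr) (τ : ℝ) : ℝ :=
  P.β * (D.χ P c 0 τ - D.χ P c 1 τ)

/-- `φ̇ᵢ = dφᵢ/dt = Vᵢ + ψ̇₀ dφᵢ₁/dτ` -/
def Pair.phiDot (D : Pair) (P : Params) (c : Corr) (i : Fin 2) (τ : ℝ) : ℝ :=
  D.V i + D.psiDot P * deriv (c.φ i) τ

/-- `η₁₂ = η - σ`, `η₂₂ = η` -/
def Pair.arg (D : Pair) (P : Params) (c : Corr) (τ η : ℝ) (i : Fin 2) : ℝ :=
  if i = 0 then η - D.σ P c τ else η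

/-- `a_{1,i} = ∫ wᵢ dη` -/
def Pair.a1 (D : Pair) (i : Fin 2) : ℝ := ∫ η, D.w i η

/-- `a'_{2,i} = ∫ (wᵢ')² dη` -/
def Pair.a2' (D : Pair) (i : Fin 2) : ℝ := ∫ η, deriv (D.w i) η ^ 2

/-- `a_{F,i} = ∫ F(Aᵢ wᵢ, β Aᵢ wᵢ') dη` -/
def Pair.a (D : Pair) (P : Params) (F : ℝ → ℝ → ℝ) (i : Fin 2) : ℝ :=
  ∫ η, F (D.A i * D.w i η) (P.β * (D.A i * deriv (D.w i) η))

/-- `R_F^{(n)}(τ) = ∫ ηⁿ {F(∑ Gᵢwᵢ(ηᵢ₂), β ∑ Gⱼwⱼ'(ηⱼ₂)) - ∑ F(Aᵢwᵢ(ηᵢ₂), β Aᵢwᵢ'(ηᵢ₂))} dη` -/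
def Pair.R (D : Pair) (P : Params) (c : Corr) (F : ℝ → ℝ → ℝ) (n : ℕ) (τ : ℝ) : ℝ :=
  ∫ η, η ^ n *
    (F (∑ i, D.G c i τ * D.w i (D.arg P c τ η i))
        (P.β * ∑ j, D.G c j τ * deriv (D.w j) (D.arg P c τ η j))
      - ∑ i, F (D.A i * D.w i (D.arg P c τ η i))
          (P.β * (D.A i * deriv (D.w i) (D.arg P c τ η i))))

/-- `Λ₁₀(τ) = ∫ w₁'(η - σ) w₂(η) dη` -/
def Pair.Λ10 (D : Pair) (P : Params) (c : Corr) (τ : ℝ) : ℝ :=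
  ∫ η, deriv (D.w 0) (η - D.σ P c τ) * D.w 1 η

/-- `Λ₁₁(τ) = ∫ w₁'(η - σ) w₂'(η) dη` -/
def Pair.Λ11 (D : Pair) (P : Params) (c : Corr) (τ : ℝ) : ℝ :=
  ∫ η, deriv (D.w 0) (η - D.σ P c τ) * deriv (D.w 1) η

/-- The interaction term of `uₓuₜ`, in the weak expansion
`ε² uₓuₜ = -εβ ∑ a'_{2,i} Vᵢ Aᵢ² δ(x - φᵢ) - ε L δ(x - x*)` with an error that is small
in the weak sense. -/
def Pair.L (D : Pair) (P : Params) (c : Corr) (τ : ℝ) : ℝ :=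
  P.β * ∑ i, D.a2' i * (D.G c i τ ^ 2 * D.phiDot P c i τ - D.A i ^ 2 * D.V i)
    - D.psiDot P * (D.G c 0 τ * deriv (c.S 1) τ - D.G c 1 τ * deriv (c.S 0) τ) * D.Λ10 P c τ
    + P.β * D.G c 0 τ * D.G c 1 τ * (D.phiDot P c 0 τ + D.phiDot P c 1 τ) * D.Λ11 P c τ

/-- The system of equations for the interaction corrections. -/
structure Pair.SolvesSystem (D : Pair) (P : Params) (c : Corr) : Prop where
  mass : ∀ τ, ∑ i, D.a1 i * c.S i τ = 0
  energy : ∀ τ, D.psiDot P * deriv (D.R P c P.q2 0) τ + D.R P c P.k2 0 τ = 0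
  phase1 : ∀ τ,
    D.psiDot P * deriv (fun s => ∑ i, D.a1 i * (D.A i * c.φ i s + D.χ P c i s * c.S i s)) τ
      = D.R P c P.p1 0 τ
  phase2 : ∀ τ,
    D.psiDot P * deriv (fun s => (∑ i, D.a P P.q2 i * c.φ i s)
        + D.χ P c 1 s * D.R P c P.q2 0 s + (P.β)⁻¹ * D.R P c P.q2 1 s) τ
      = D.R P c P.pp2 0 τ - 2 * P.α ^ 2 * P.β * D.L P c τ
        - D.χ P c 1 τ * D.R P c P.k2 0 τ - (P.β)⁻¹ * D.R P c P.k2 1 τ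

/-- `f` decays at infinity faster than every power. -/
def RapidDecay (f : ℝ → ℝ) : Prop := ∀ n : ℕ, ∃ C, ∀ τ, |τ| ^ n * |f τ| ≤ C

/-- Smoothness and behaviour at infinity of the corrections: `Sᵢ → 0` as `τ → ±∞`, `φᵢ₁ → 0` as
`τ → -∞`, `φᵢ₁ → φᵢ₁^∞` as `τ → +∞`, the limits being attained rapidly. -/
structure Corr.HasLimits (c : Corr) (φlim : Fin 2 → ℝ) : Prop where
  smooth_S : ∀ i, ContDiff ℝ ∞ (c.S i)
  smooth_φ : ∀ i, ContDiff ℝ ∞ (c.φ i)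
  S_bot : ∀ i, Tendsto (c.S i) atBot (𝓝 0)
  S_top : ∀ i, Tendsto (c.S i) atTop (𝓝 0)
  φ_bot : ∀ i, Tendsto (c.φ i) atBot (𝓝 0)
  φ_top : ∀ i, Tendsto (c.φ i) atTop (𝓝 (φlim i))
  rapid_S : ∀ i, RapidDecay (deriv (c.S i))
  rapid_φ : ∀ i, RapidDecay (deriv (c.φ i))

/-- Elastic scenario on `[0,T]` with the collision at the instant `t*`: outside every neighbourhood
of `t*`, `u` is, up to `O(ε²)` uniformly in `t` and `x`, the sum of the two given solitons, with
unchanged amplitudes, profiles and velocities, before the collision with the given phases and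
after the collision with the phases shifted by the constants `ε φᵢ₁^∞`. -/
def Pair.Elastic (D : Pair) (P : Params) (T tstar : ℝ) (φlim : Fin 2 → ℝ)
    (u : ℝ → ℝ → ℝ → ℝ) : Prop :=
  ∀ δ > 0, ∃ C, ∃ ε₀ > 0, ∀ ε ∈ Ioc 0 ε₀, ∀ t ∈ Icc 0 T, ∀ x,
    (t ≤ tstar - δ → |u ε t x - D.free P 0 ε t x| ≤ C * ε ^ 2) ∧
    (tstar + δ ≤ t → |u ε t x - D.free P φlim ε t x| ≤ C * ε ^ 2)

end DP

end

/-! Centre the variables at the collision and stretch them: τ = ψ̇₀(t − t*)/ε, ζ = β(x − x*)/ε. The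
ansatz becomes a function U(τ, ζ) free of ε, and the left-hand side of each law becomes ε⁻¹ l(τ, ζ),
with l a polynomial in U and its derivatives. Its pairing with ψ is β⁻¹ ∫ l(τ, ζ) ψ(x* + εζ/β) dζ.
If l and ζ l have zero integral over ζ for every τ, the constant and linear Taylor terms of ψ drop
out and a factor ε² remains.

The vanishing of these two moments is the content of the system: for the conservation law it comes
from the differentiated mass equation and `phase1`, for the balance law from `energy` and `phase2`
(`moment_zero_law1`, `moment_zero_law2`). The first moments also contain what the solitons
contribute without any interaction; this cancels by two integral identities of the profile,
`p1_moment` and `p2_moment`.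

The bound has to be uniform in τ, while the waves may be at distance of order |τ| from ζ = 0, so the
second moment of l need not be bounded. Hence the decomposition `Split`: l is the law on each single
soliton, centred at its own trajectory, plus a remainder localized near ζ = 0 uniformly in τ. The
remainder collects products of waves on different trajectories, which separate linearly in τ, and
waves with coefficients that decay in τ. The single-soliton parts have vanishing moments of their
own, so ψ may be expanded at their own centres, and the remainder inherits vanishing moments. This
is `Split.pairing_quadratic`.

All this needs decaying profiles. The potential excludes V ≤ c₀, so the profile equation linearized
at zero is w'' = m w with m > 0, and the profile decays exponentially with two derivatives.

Elasticity is softer: for |t − t*| ≥ δ one has |τ| ≥ ψ̇₀δ/ε, and the rapidly attained limits of the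
corrections turn into powers of ε. -/

noncomputable section

namespace DP

/-! ### Functions of polynomial decay -/

/-- Decay at infinity like `|x|⁻⁸`. -/
def Decays (f : ℝ → ℝ) : Prop := ∃ C, ∀ x, |f x| * (1 + |x|) ^ 8 ≤ C

lemma Decays.add {f g : ℝ → ℝ} (hf : Decays f) (hg : Decays g) : Decays (fun x => f x + g x) := by
  obtain ⟨C, hC⟩ := hf
  obtain ⟨D, hD⟩ := hg
  refine ⟨C + D, fun x => ?_⟩
  have h1 := abs_add_le (f x) (g x)
  have h2 : (0 : ℝ) ≤ (1 + |x|) ^ 8 := by positivity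
  nlinarith [hC x, hD x, mul_le_mul_of_nonneg_right h1 h2]

lemma Decays.bounded {f : ℝ → ℝ} (hf : Decays f) : ∃ C, ∀ x, |f x| ≤ C := by
  obtain ⟨C, hC⟩ := hf
  refine ⟨C, fun x => le_trans ?_ (hC x)⟩
  exact le_mul_of_one_le_right (abs_nonneg _) (one_le_pow₀ (by linarith [abs_nonneg x]))

lemma Decays.bdd_mul {f g : ℝ → ℝ} (hf : ∃ C, ∀ x, |f x| ≤ C) (hg : Decays g) :
    Decays (fun x => f x * g x) := by
  obtain ⟨C, hC⟩ := hf
  obtain ⟨D, hD⟩ := hg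
  refine ⟨C * D, fun x => ?_⟩
  rw [abs_mul, mul_assoc]
  exact mul_le_mul (hC x) (hD x) (by positivity) (le_trans (abs_nonneg _) (hC x))

lemma Decays.mul {f g : ℝ → ℝ} (hf : Decays f) (hg : Decays g) : Decays (fun x => f x * g x) :=
  Decays.bdd_mul hf.bounded hg

lemma Decays.const_mul {f : ℝ → ℝ} (hf : Decays f) (c : ℝ) : Decays (fun x => c * f x) :=
  Decays.bdd_mul ⟨|c|, fun _ => le_rfl⟩ hf

lemma Decays.sub {f g : ℝ → ℝ} (hf : Decays f) (hg : Decays g) : Decays (fun x => f x - g x) := by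
  simpa [sub_eq_add_neg] using hf.add (hg.const_mul (-1))

lemma Decays.pow {f : ℝ → ℝ} (hf : Decays f) (n : ℕ) (hn : n ≠ 0) :
    Decays (fun x => f x ^ n) := by
  induction n with
  | zero => exact absurd rfl hn
  | succ k ih =>
    rcases Nat.eq_zero_or_pos k with rfl | hk
    · simpa using hf
    · simpa [pow_succ] using (ih hk.ne').mul hf

/-- Two of the eight powers are reserved for the integrable majorant (1 + x²)⁻¹, which leaves six
for the moment. -/
lemma Decays.integrable_pow_mul {f : ℝ → ℝ} (hf : Decays f) (hc : Continuous f) {n : ℕ}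
    (hn : n ≤ 6) : Integrable (fun x => x ^ n * f x) := by
  obtain ⟨C, hC⟩ := hf
  refine (integrable_inv_one_add_sq.const_mul C).mono' (by fun_prop) (ae_of_all _ fun x => ?_)
  rw [← div_eq_mul_inv, le_div_iff₀ (by positivity), Real.norm_eq_abs, abs_mul, abs_pow]
  refine le_trans ?_ (hC x)
  have h0 := abs_nonneg x
  have h1 : |x| ^ n ≤ (1 + |x|) ^ 6 :=
    (pow_le_pow_left₀ h0 (by linarith) n).trans (pow_le_pow_right₀ (by linarith) hn)
  have h2 : 1 + x ^ 2 ≤ (1 + |x|) ^ 2 := by rw [← sq_abs]; nlinarith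
  calc |x| ^ n * |f x| * (1 + x ^ 2) ≤ (1 + |x|) ^ 6 * |f x| * (1 + |x|) ^ 2 := by gcongr
    _ = |f x| * (1 + |x|) ^ 8 := by ring

lemma Decays.integrable {f : ℝ → ℝ} (hf : Decays f) (hc : Continuous f) : Integrable f := by
  simpa using hf.integrable_pow_mul hc (n := 0) (by norm_num)

lemma Decays.integrable_mul {f : ℝ → ℝ} (hf : Decays f) (hc : Continuous f) :
    Integrable (fun x => x * f x) := by
  simpa using hf.integrable_pow_mul hc (n := 1) (by norm_num)

lemma pow_mul_exp_neg_le {μ : ℝ} (hμ : 0 < μ) :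
    ∃ K, ∀ x, 0 ≤ x → Real.exp (-μ * x) * (1 + x) ^ 8 ≤ K := by
  -- The constant comes from y⁸/8! ≤ exp y at y = μ(1 + x).
  refine ⟨(Nat.factorial 8 : ℕ) / μ ^ 8 * Real.exp μ, fun x hx => ?_⟩
  have h := Real.pow_div_factorial_le_exp (μ * (1 + x)) (by positivity) 8
  rw [div_le_iff₀ (by positivity), mul_pow] at h
  have h2 : Real.exp (μ * (1 + x)) = Real.exp μ * Real.exp (μ * x) := by
    rw [← Real.exp_add]; ring_nf
  have h3 : Real.exp (-μ * x) * Real.exp (μ * x) = 1 := by rw [← Real.exp_add]; simp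
  rw [h2] at h
  rw [div_mul_eq_mul_div, le_div_iff₀ (by positivity)]
  calc Real.exp (-μ * x) * (1 + x) ^ 8 * μ ^ 8
      = Real.exp (-μ * x) * (μ ^ 8 * (1 + x) ^ 8) := by ring
    _ ≤ Real.exp (-μ * x) * (Real.exp μ * Real.exp (μ * x) * (Nat.factorial 8 : ℕ)) := by gcongr
    _ = (Real.exp (-μ * x) * Real.exp (μ * x)) * ((Nat.factorial 8 : ℕ) * Real.exp μ) := by ring
    _ = _ := by rw [h3, one_mul]

lemma decays_of_tail {f : ℝ → ℝ} (hc : Continuous f) (hsymm : ∀ x, |f (-x)| = |f x|)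
    {C μ N : ℝ} (hμ : 0 < μ) (h : ∀ x ≥ N, |f x| ≤ C * Real.exp (-μ * x)) : Decays f := by
  obtain ⟨K, hK⟩ := pow_mul_exp_neg_le hμ
  obtain ⟨B, hB⟩ := (isCompact_Icc (a := (0 : ℝ)) (b := N)).exists_bound_of_continuousOn
    (f := fun x => f x * (1 + |x|) ^ 8) (by fun_prop)
  have key : ∀ x, 0 ≤ x → |f x| * (1 + |x|) ^ 8 ≤ max B (|C| * K) := by
    intro x hx
    rcases le_total x N with hN | hN
    · have := hB x ⟨hx, hN⟩
      rw [Real.norm_eq_abs, abs_mul, abs_of_nonneg (by positivity : (0 : ℝ) ≤ (1 + |x|) ^ 8)] at this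
      exact this.trans (le_max_left _ _)
    · refine le_trans ?_ (le_max_right _ _)
      have h1 := h x hN
      rw [abs_of_nonneg hx]
      calc |f x| * (1 + x) ^ 8 ≤ |C| * Real.exp (-μ * x) * (1 + x) ^ 8 := by
            gcongr; exact h1.trans (by gcongr; exact le_abs_self C)
        _ = |C| * (Real.exp (-μ * x) * (1 + x) ^ 8) := by ring
        _ ≤ |C| * K := by gcongr; exact hK x hx
  refine ⟨max B (|C| * K), fun x => ?_⟩
  rcases le_total 0 x with hx | hx
  · exact key x hx
  · have := key (-x) (by linarith)
    rwa [hsymm, abs_neg] at this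

/-! ### Exponential decay of the profile -/

lemma monotoneOn_Ici_of_hasDerivAt {f f' : ℝ → ℝ} (h : ∀ x, HasDerivAt f (f' x) x) {N : ℝ}
    (hn : ∀ x ≥ N, 0 ≤ f' x) : MonotoneOn f (Ici N) := by
  refine monotoneOn_of_deriv_nonneg (convex_Ici N) (fun x _ => (h x).continuousAt.continuousWithinAt)
    (fun x _ => (h x).differentiableAt.differentiableWithinAt) fun x hx => ?_
  rw [(h x).deriv]
  exact hn x (interior_subset hx)

/-- A convex function tending to zero has y' ≤ 0. The quantity (y' + m y)e^{-mx} has derivative (y''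
− m²y)e^{-mx} ≥ 0, so a positive value of y' + m y would persist and grow, against y' ≤ 0 and y → 0.
Hence y' + m y ≤ 0, that is, y e^{mx} does not increase. -/
lemma exp_decay_of_convex {y y1 y2 : ℝ → ℝ} {m N : ℝ} (hm : 0 < m)
    (hy : ∀ x, HasDerivAt y (y1 x) x) (hy1 : ∀ x, HasDerivAt y1 (y2 x) x) (hpos : ∀ x, 0 ≤ y x)
    (hode : ∀ x ≥ N, m ^ 2 * y x ≤ y2 x) (hlim : Tendsto y atTop (𝓝 0)) :
    ∀ x ≥ N, y x ≤ y N * Real.exp (m * N) * Real.exp (-m * x) := by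
  have hmono : MonotoneOn y1 (Ici N) := monotoneOn_Ici_of_hasDerivAt hy1 fun x hx =>
    le_trans (by have := hpos x; positivity) (hode x hx)
  have hneg : ∀ a ≥ N, y1 a ≤ 0 := by
    intro a ha
    by_contra! hpa
    have h1 : MonotoneOn (fun x => y x - y1 a * x) (Ici a) := by
      refine monotoneOn_Ici_of_hasDerivAt (f' := fun x => y1 x - y1 a)
        (fun x => ((hy x).sub ((hasDerivAt_id x).const_mul (y1 a))).congr_deriv (by ring))
        fun x hx => ?_
      linarith [hmono (mem_Ici.2 ha) (mem_Ici.2 (le_trans ha hx)) hx]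
    -- To the right of a + 1/y'(a) the tangent line at a lies at least 1 above y(a) ≥ 0, while y
    -- eventually drops below 1.
    obtain ⟨x, hx1, hx2⟩ := ((hlim.eventually (gt_mem_nhds one_pos)).and
      (eventually_ge_atTop (a + 1 / y1 a))).exists
    have hax : a ≤ x := le_trans (by have := one_div_pos.2 hpa; linarith) hx2
    have h2 : y a - y1 a * a ≤ y x - y1 a * x := h1 (mem_Ici.2 le_rfl) (mem_Ici.2 hax) hax
    have h3 : y1 a * (a + 1 / y1 a) ≤ y1 a * x := by gcongr
    have h4 : y1 a * (a + 1 / y1 a) = y1 a * a + 1 := by field_simp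
    linarith [hpos a]
  have hexp : ∀ c x : ℝ, HasDerivAt (fun x => Real.exp (c * x)) (Real.exp (c * x) * c) x :=
    fun c x => by simpa using ((hasDerivAt_id x).const_mul c).exp
  have hz : ∀ a ≥ N, y1 a + m * y a ≤ 0 := by
    intro a ha
    by_contra! hpa
    have h1 : MonotoneOn (fun x => (y1 x + m * y x) * Real.exp (-m * x)) (Ici a) := by
      refine monotoneOn_Ici_of_hasDerivAt
        (fun x => ((hy1 x).add ((hy x).const_mul m)).mul (hexp (-m) x)) fun x hx => ?_
      have h2 := hode x (le_trans ha hx)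
      have : (y2 x + m * y1 x) * Real.exp (-m * x)
          + (y1 x + m * y x) * (Real.exp (-m * x) * -m)
          = (y2 x - m ^ 2 * y x) * Real.exp (-m * x) := by ring
      simp only [Pi.add_apply] at *
      rw [this]
      exact mul_nonneg (by linarith) (Real.exp_pos _).le
    obtain ⟨x, hx1, hx2⟩ := ((hlim.eventually (gt_mem_nhds (div_pos hpa hm))).and
      (eventually_ge_atTop a)).exists
    have h2 : (y1 a + m * y a) * Real.exp (-m * a) ≤ (y1 x + m * y x) * Real.exp (-m * x) :=
      h1 (mem_Ici.2 le_rfl) (mem_Ici.2 hx2) hx2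
    have h3 : Real.exp (-m * x) ≤ Real.exp (-m * a) := Real.exp_le_exp.2 (by nlinarith)
    have h4 : m * y x < y1 a + m * y a := by rwa [lt_div_iff₀ hm, mul_comm] at hx1
    have h5 := hneg x (le_trans ha hx2)
    have hpa' := Real.exp_pos (-m * a)
    have h6 := Real.exp_pos (-m * x)
    have h7 : (y1 x + m * y x) * Real.exp (-m * x) < (y1 a + m * y a) * Real.exp (-m * x) := by
      apply mul_lt_mul_of_pos_right _ h6; linarith
    nlinarith
  intro x hx
  have h1 : MonotoneOn (fun x => -(y x * Real.exp (m * x))) (Ici N) := by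
    refine monotoneOn_Ici_of_hasDerivAt (fun x => ((hy x).mul (hexp m x)).neg) fun x hx => ?_
    have := hz x hx
    have h6 := Real.exp_pos (m * x)
    nlinarith
  have h2 : -(y N * Real.exp (m * N)) ≤ -(y x * Real.exp (m * x)) :=
    h1 (mem_Ici.2 le_rfl) (mem_Ici.2 hx) hx
  have h3 : Real.exp (m * x) * Real.exp (-m * x) = 1 := by rw [← Real.exp_add]; simp
  calc y x = y x * Real.exp (m * x) * Real.exp (-m * x) := by rw [mul_assoc, h3, mul_one]
    _ ≤ _ := mul_le_mul_of_nonneg_right (by linarith) (Real.exp_pos _).le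

/-- A lower bound on w'' makes w' almost nondecreasing on unit intervals. So w'(x) is bounded below
by the mean slope of w on [x − 1, x] and above by that on [x, x + 1], up to exponentially small
errors. An upper bound on w'' is not needed, which matters because the profile equation contains
(w')². -/
lemma le_of_one_sided_bound {w w1 w2 : ℝ → ℝ} {C K μ N : ℝ} (hμ : 0 < μ) (hK : 0 ≤ K) (hC : 0 ≤ C)
    (hw : ∀ x, HasDerivAt w (w1 x) x) (hw1 : ∀ x, HasDerivAt w1 (w2 x) x)
    (hb : ∀ x ≥ N, |w x| ≤ C * Real.exp (-μ * x))
    (hw2 : ∀ x ≥ N, -(K * Real.exp (-μ * x)) ≤ w2 x) :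
    ∀ x ≥ N + 1, |w1 x| ≤ ((2 * C + K) * Real.exp μ) * Real.exp (-μ * x) := by
  have hmv : ∀ a ≥ N, ∀ s ∈ Icc a (a + 1), w1 a - K * Real.exp (-μ * a) ≤ w1 s := by
    intro a ha s hs
    rcases eq_or_lt_of_le hs.1 with rfl | has
    · have := mul_nonneg hK (Real.exp_pos (-μ * a)).le; linarith
    obtain ⟨c, hc, hc'⟩ := exists_hasDerivAt_eq_slope w1 w2 has
      (fun x _ => (hw1 x).continuousAt.continuousWithinAt) (fun x _ => hw1 x)
    rw [eq_div_iff (by linarith)] at hc'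
    have h1 := hw2 c (by linarith [hc.1])
    have h2 : Real.exp (-μ * c) ≤ Real.exp (-μ * a) := Real.exp_le_exp.2 (by nlinarith [hc.1])
    have h3 : K * Real.exp (-μ * c) ≤ K * Real.exp (-μ * a) := by gcongr
    have h4 := mul_nonneg hK (Real.exp_pos (-μ * a)).le
    nlinarith [hs.2]
  intro x hx
  have he1 : Real.exp (-μ * (x + 1)) ≤ Real.exp (-μ * x) := Real.exp_le_exp.2 (by nlinarith)
  have he2 : Real.exp (-μ * (x - 1)) = Real.exp μ * Real.exp (-μ * x) := by
    rw [← Real.exp_add]; ring_nf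
  have he3 : 1 ≤ Real.exp μ := Real.one_le_exp hμ.le
  have hpos := Real.exp_pos (-μ * x)
  have he4 : Real.exp (-μ * x) ≤ Real.exp μ * Real.exp (-μ * x) := by nlinarith
  have b0 := abs_le.1 (hb x (by linarith))
  have b1 := abs_le.1 (hb (x + 1) (by linarith))
  have b2 := abs_le.1 (hb (x - 1) (by linarith))
  have e1 : C * Real.exp (-μ * (x + 1)) ≤ C * (Real.exp μ * Real.exp (-μ * x)) := by
    gcongr; linarith
  have e0 : C * Real.exp (-μ * x) ≤ C * (Real.exp μ * Real.exp (-μ * x)) := by gcongr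
  have eK : K * Real.exp (-μ * x) ≤ K * (Real.exp μ * Real.exp (-μ * x)) := by gcongr
  rw [he2] at b2
  rw [abs_le]
  constructor
  · obtain ⟨c, hc, hc'⟩ := exists_hasDerivAt_eq_slope w w1 (show x - 1 < x by linarith)
      (fun x _ => (hw x).continuousAt.continuousWithinAt) (fun x _ => hw x)
    rw [eq_div_iff (by linarith)] at hc'
    have h1 := hmv c (by linarith [hc.1]) x ⟨hc.2.le, by linarith [hc.1]⟩
    have h2 : Real.exp (-μ * c) ≤ Real.exp μ * Real.exp (-μ * x) := by
      rw [← he2]; exact Real.exp_le_exp.2 (by nlinarith [hc.1])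
    have h3 : K * Real.exp (-μ * c) ≤ K * (Real.exp μ * Real.exp (-μ * x)) := by gcongr
    nlinarith
  · obtain ⟨c, hc, hc'⟩ := exists_hasDerivAt_eq_slope w w1 (show x < x + 1 by linarith)
      (fun x _ => (hw x).continuousAt.continuousWithinAt) (fun x _ => hw x)
    rw [eq_div_iff (by linarith)] at hc'
    have h1 := hmv x (by linarith) c ⟨hc.1.le, hc.2.le⟩
    nlinarith

lemma hasDerivAt_of_smooth {w : ℝ → ℝ} (hw : ContDiff ℝ ∞ w) (x : ℝ) :
    HasDerivAt w (deriv w x) x :=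
  (hw.differentiable (by simp) x).hasDerivAt

lemma contDiff_deriv {w : ℝ → ℝ} (hw : ContDiff ℝ ∞ w) : ContDiff ℝ ∞ (deriv w) :=
  ((contDiff_infty_iff_deriv (𝕜 := ℝ)).1 hw).2

/-- The convexity argument is applied to w², so the sign of w plays no role: near infinity w w'' ≥
−(w')² + (m/4)w², and therefore (w²)'' ≥ (m/2)w². The bound on w' follows from the one-sided bound
on w'', and the equation then gives w'' itself. -/
lemma exp_decay_of_profile_ode {w : ℝ → ℝ} {k a m n : ℝ} (ha : 0 ≤ a) (hm : 0 < m)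
    (hw : ContDiff ℝ ∞ w) (hlim : Tendsto w atTop (𝓝 0))
    (ode : ∀ η, (1 - k * w η) * deriv (deriv w) η = a * deriv w η ^ 2 + w η * (m - n * w η)) :
    ∃ C μ N, 0 < μ ∧ ∀ x ≥ N, |w x| ≤ C * Real.exp (-μ * x) ∧
      |deriv w x| ≤ C * Real.exp (-μ * x) ∧ |deriv (deriv w) x| ≤ C * Real.exp (-μ * x) := by
  have d0 := hasDerivAt_of_smooth hw
  have d1 := hasDerivAt_of_smooth (contDiff_deriv hw)
  have t1 : Tendsto (fun x => k * w x) atTop (𝓝 0) := by simpa using hlim.const_mul k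
  have t2 : Tendsto (fun x => a * w x) atTop (𝓝 0) := by simpa using hlim.const_mul a
  have t3 : Tendsto (fun x => n * w x) atTop (𝓝 0) := by simpa using hlim.const_mul n
  have habs : ∀ {f : ℝ → ℝ} {δ : ℝ}, 0 < δ → Tendsto f atTop (𝓝 0) →
      ∀ᶠ x in atTop, |f x| < δ := fun hδ hf => by
    have := hf.abs
    rw [abs_zero] at this
    exact this.eventually (gt_mem_nhds hδ)
  -- These thresholds keep 1 − kw between 1/2 and 2, make 1 − kw + aw nonnegative, and leave m − nw
  -- ≥ m/2.
  obtain ⟨N₀, hN₀⟩ := eventually_atTop.1 ((habs (by norm_num : (0 : ℝ) < 1 / 2) t1).and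
    ((habs (by norm_num : (0 : ℝ) < 1 / 2) t2).and (habs (half_pos hm) t3)))
  set N := max N₀ 0
  have hN : ∀ x ≥ N, |k * w x| < 1 / 2 ∧ |a * w x| < 1 / 2 ∧ |n * w x| < m / 2 :=
    fun x hx => hN₀ x ((le_max_left _ _).trans hx)
  set μ := Real.sqrt (m / 2)
  have hμ : 0 < μ := Real.sqrt_pos.2 (half_pos hm)
  have hμ2 : μ ^ 2 = m / 2 := Real.sq_sqrt (half_pos hm).le
  have hsq := exp_decay_of_convex (y := fun x => w x ^ 2) (y1 := fun x => 2 * w x * deriv w x)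
    (y2 := fun x => 2 * deriv w x ^ 2 + 2 * (w x * deriv (deriv w) x)) (N := N) hμ
    (fun x => ((d0 x).pow 2).congr_deriv (by simp))
    (fun x => (((d0 x).const_mul 2).mul (d1 x)).congr_deriv (by ring))
    (fun x => sq_nonneg _)
    (fun x hx => by
      obtain ⟨h1, h2, h3⟩ := hN x hx
      rw [abs_lt] at h1 h2 h3
      set z := 1 - k * w x with hz
      have hz1 : 1 / 2 < z := by linarith
      have hz2 : z < 2 := by linarith
      have h4 : z * (w x * deriv (deriv w) x)
          = a * w x * deriv w x ^ 2 + w x ^ 2 * (m - n * w x) := by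
        linear_combination w x * ode x
      have h5 : z * (-deriv w x ^ 2 + m / 4 * w x ^ 2) ≤ z * (w x * deriv (deriv w) x) := by
        rw [h4]
        nlinarith [sq_nonneg (deriv w x), sq_nonneg (w x),
          mul_nonneg (by linarith : 0 ≤ z + a * w x) (sq_nonneg (deriv w x)),
          mul_nonneg (by nlinarith : 0 ≤ m - n * w x - z * (m / 4)) (sq_nonneg (w x))]
      have h6 := le_of_mul_le_mul_left h5 (by linarith)
      rw [hμ2]
      linarith)
    (by simpa using hlim.pow 2)
  -- Passing from w² to |w| halves the exponent.
  set B := Real.sqrt (w N ^ 2 * Real.exp (μ * N))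
  have hw0 : ∀ x ≥ N, |w x| ≤ B * Real.exp (-(μ / 2) * x) := by
    intro x hx
    rw [← Real.sqrt_sq_eq_abs]
    have : Real.exp (-(μ / 2) * x) = Real.sqrt (Real.exp (-μ * x)) := by
      rw [eq_comm, Real.sqrt_eq_iff_mul_self_eq (Real.exp_pos _).le (Real.exp_pos _).le,
        ← Real.exp_add]
      ring_nf
    rw [this, ← Real.sqrt_mul (by positivity)]
    exact Real.sqrt_le_sqrt (hsq x hx)
  have hB : 0 ≤ B := Real.sqrt_nonneg _
  have hlin : ∀ x ≥ N, |w x * (m - n * w x)| ≤ 3 / 2 * m * (B * Real.exp (-(μ / 2) * x)) := by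
    intro x hx
    obtain ⟨h1, h2, h3⟩ := hN x hx
    rw [abs_mul, mul_comm]
    refine mul_le_mul ?_ (hw0 x hx) (abs_nonneg _) (by positivity)
    rw [abs_lt] at h3
    rw [abs_le]; constructor <;> linarith
  -- The term a(w')² has the favourable sign for a lower bound on w''. Division by 1 − kw > 1/2
  -- doubles the constant 3mB/2.
  have hw1 := le_of_one_sided_bound (K := 3 * m * B) (half_pos hμ) (by positivity) hB d0 d1 hw0
    (fun x hx => by
      obtain ⟨h1, h2, h3⟩ := hN x hx
      rw [abs_lt] at h1
      have h4 := (abs_le.1 (hlin x hx)).1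
      have h5 : 0 ≤ B * Real.exp (-(μ / 2) * x) := by positivity
      set e := B * Real.exp (-(μ / 2) * x)
      have h6 : (1 - k * w x) * -(3 * m * e) ≤ (1 - k * w x) * deriv (deriv w) x := by
        rw [ode x]
        have h7 : 0 ≤ a * deriv w x ^ 2 := by positivity
        have h8 : 0 ≤ m * e := by positivity
        nlinarith
      have := le_of_mul_le_mul_left h6 (by linarith)
      linarith)
  set B1 := (2 * B + 3 * m * B) * Real.exp (μ / 2)
  have hB1 : 0 ≤ B1 := by positivity
  refine ⟨B + B1 + (2 * a * B1 ^ 2 + 3 * m * B), μ / 2, N + 1, half_pos hμ, fun x hx => ?_⟩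
  have g0 := hw0 x (by linarith)
  have g1 := hw1 x hx
  have hN0 : 0 ≤ N := le_max_right _ _
  set e := Real.exp (-(μ / 2) * x)
  have he : 0 < e := Real.exp_pos _
  have he1 : e ≤ 1 := Real.exp_le_one_iff.2 (by nlinarith)
  have p1 : 0 ≤ B * e := by positivity
  have p2 : 0 ≤ B1 * e := by positivity
  have p3 : 0 ≤ (2 * a * B1 ^ 2 + 3 * m * B) * e := by positivity
  refine ⟨by linarith, by linarith, ?_⟩
  obtain ⟨h1, h2, h3⟩ := hN x (by linarith)
  rw [abs_lt] at h1
  have g2 : |(1 - k * w x) * deriv (deriv w) x| ≤ a * (B1 * e) ^ 2 + 3 / 2 * m * (B * e) := by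
    rw [ode x]
    refine (abs_add_le _ _).trans (add_le_add ?_ (hlin x (by linarith)))
    rw [abs_mul, abs_of_nonneg ha, abs_pow]
    gcongr
  rw [abs_mul, abs_of_nonneg (by linarith : 0 ≤ 1 - k * w x)] at g2
  have g3 : (B1 * e) ^ 2 ≤ B1 ^ 2 * e := by nlinarith [mul_nonneg (sq_nonneg B1) he.le]
  have g4 : 1 / 2 * |deriv (deriv w) x| ≤ (1 - k * w x) * |deriv (deriv w) x| := by
    gcongr; linarith
  nlinarith [mul_le_mul_of_nonneg_left g3 ha]

/-! ### The velocity exceeds `c₀` -/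

lemma Params.β_pos {P : Params} (hP : P.Admissible) : 0 < P.β :=
  Real.sqrt_pos.2 (div_pos hP.2.2.2.1 hP.2.2.2.2.2)

lemma Params.r_mem {P : Params} (hP : P.Admissible) : P.r ∈ Ioo (0 : ℝ) 1 := by
  obtain ⟨-, -, -, -, h2, h3⟩ := hP
  exact ⟨div_pos h3 (by linarith), (div_lt_one (by linarith)).2 (by linarith)⟩

lemma Params.IsVelocity.one_sub_rpow_mem {P : Params} (hP : P.Admissible) {A V g : ℝ}
    (h : P.IsVelocity A V g) : 1 - g ^ P.r ∈ Ioo (0 : ℝ) 1 := by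
  have h1 := Real.rpow_lt_one h.1.1.le h.1.2 (P.r_mem hP).1
  have h2 := Real.rpow_pos_of_pos h.1.1 P.r
  exact ⟨by linarith, by linarith⟩

lemma Params.IsVelocity.add_eq {P : Params} (hP : P.Admissible) {A V g : ℝ}
    (h : P.IsVelocity A V g) : P.γ + P.α ^ 2 * V = P.c3 * A / (1 - g ^ P.r) := by
  have hα := hP.2.2.1.ne'
  have h1 := (h.one_sub_rpow_mem hP).1.ne'
  rw [h.2.2]
  field_simp
  ring

lemma Params.IsVelocity.add_pos {P : Params} (hP : P.Admissible) {A V g : ℝ} (hA : 0 < A)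
    (h : P.IsVelocity A V g) : 0 < P.γ + P.α ^ 2 * V := by
  rw [h.add_eq hP]
  exact div_pos (mul_pos hP.2.2.2.2.2 hA) (h.one_sub_rpow_mem hP).1

/-- The derivative factors as 2x^{1−2r}(1 − x^r)(1 − q − x^r), which is positive on (0, 1) when q ≤
0; and the potential vanishes at 1. -/
lemma Params.potential_neg {P : Params} (hP : P.Admissible) {V g : ℝ} (hq : P.q V ≤ 0)
    (hg : g ∈ Ioo (0 : ℝ) 1) : P.potential V g < 0 := by
  obtain ⟨hr0, hr1⟩ := P.r_mem hP
  have hd : ∀ x, 0 < x → HasDerivAt (P.potential V)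
      (2 * x ^ (1 - 2 * P.r) * ((1 - x ^ P.r) * (1 - P.q V - x ^ P.r))) x := by
    intro x hx
    have e1 : x ^ (1 - P.r) = x ^ (1 - 2 * P.r) * x ^ P.r := by
      rw [← Real.rpow_add hx]; ring_nf
    have e2 : x = x ^ (1 - 2 * P.r) * x ^ P.r * x ^ P.r := by
      rw [← Real.rpow_add hx, ← Real.rpow_add hx]
      conv_lhs => rw [← Real.rpow_one x]
      ring_nf
    have h1 := (hasDerivAt_id x).pow 2
    have h2 := (Real.hasDerivAt_rpow_const (p := 2 - P.r) (Or.inl hx.ne')).const_mul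
      (2 * ((2 - P.q V) / (2 - P.r)))
    have h3 := (Real.hasDerivAt_rpow_const (p := 2 - 2 * P.r) (Or.inl hx.ne')).const_mul
      ((1 - P.q V) / (1 - P.r))
    refine (((h1.sub h2).add h3).sub_const
      (1 - 2 * ((2 - P.q V) / (2 - P.r)) + (1 - P.q V) / (1 - P.r))).congr_deriv ?_
    have e3 : (2 - P.r - 1) = 1 - P.r := by ring
    have e4 : (2 - 2 * P.r - 1) = 1 - 2 * P.r := by ring
    have n1 : 2 - P.r ≠ 0 := by linarith
    have n2 : 1 - P.r ≠ 0 := by linarith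
    rw [e3, e4, e1]
    have e5 : 2 * ((2 - P.q V) / (2 - P.r)) * ((2 - P.r) * (x ^ (1 - 2 * P.r) * x ^ P.r))
        = 2 * (2 - P.q V) * (x ^ (1 - 2 * P.r) * x ^ P.r) := by field_simp
    have e6 : (1 - P.q V) / (1 - P.r) * ((2 - 2 * P.r) * x ^ (1 - 2 * P.r))
        = 2 * (1 - P.q V) * x ^ (1 - 2 * P.r) := by field_simp
    rw [e5, e6]
    simp only [id, Nat.cast_ofNat, Nat.add_one_sub_one, pow_one, mul_one]
    linear_combination 2 * e2
  have hmono : StrictMonoOn (P.potential V) (Icc g 1) := by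
    refine strictMonoOn_of_deriv_pos (convex_Icc g 1)
      (fun x hx => (hd x (hg.1.trans_le hx.1)).continuousAt.continuousWithinAt) fun x hx => ?_
    rw [interior_Icc] at hx
    have hx0 : 0 < x := hg.1.trans hx.1
    rw [(hd x hx0).deriv]
    have h1 := Real.rpow_lt_one hx0.le hx.2 hr0
    have h2 := Real.rpow_pos_of_pos hx0 (1 - 2 * P.r)
    have h3 : 0 < 1 - x ^ P.r := by linarith
    have h4 : 0 < 1 - P.q V - x ^ P.r := by linarith
    positivity
  have h1 : P.potential V 1 = 0 := by simp [Params.potential]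
  rw [← h1]
  exact hmono (left_mem_Icc.2 hg.2.le) (right_mem_Icc.2 hg.2.le) hg.2

/-- V ≤ c₀ would give q ≤ 0, hence no zero of the potential inside (0, 1). This inequality provides
the positive rate m of the linearized profile equation. -/
lemma Params.IsVelocity.c0_lt {P : Params} (hP : P.Admissible) {A V g : ℝ} (hA : 0 < A)
    (h : P.IsVelocity A V g) : P.c0 < V := by
  by_contra! hV
  refine (P.potential_neg (V := V) hP ?_ h.1).ne h.2.1
  have h1 := h.add_pos hP hA
  have hc1 := hP.2.2.2.1
  exact div_nonpos_of_nonpos_of_nonneg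
    (mul_nonpos_of_nonneg_of_nonpos hP.2.2.2.2.2.le (by linarith)) (by positivity)

/-! ### Integral identities for the profile -/

lemma integral_eq_zero_of_odd {f : ℝ → ℝ} (hf : ∀ x, f (-x) = -f x) : ∫ x, f x = 0 := by
  have h1 := integral_neg_eq_self f volume
  simp only [hf, integral_neg] at h1
  linarith

lemma deriv_odd_of_even {f : ℝ → ℝ} (hf : ∀ x, f (-x) = f x) (x : ℝ) :
    deriv f (-x) = -deriv f x := by
  have h1 := deriv_comp_neg f x
  simp only [hf] at h1
  linarith

lemma deriv_even_of_odd {f : ℝ → ℝ} (hf : ∀ x, f (-x) = -f x) (x : ℝ) :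
    deriv f (-x) = deriv f x := by
  have h1 := deriv_comp_neg f x
  simp only [hf, deriv.fun_neg] at h1
  linarith

/-- The properties of a soliton profile that enter the weak asymptotic expansion: smoothness,
decay, and the first moments of the conservation and the balance laws. -/
structure Params.IsSoliton (P : Params) (A V : ℝ) (w : ℝ → ℝ) : Prop where
  smooth : ContDiff ℝ ∞ w
  even : ∀ η, w (-η) = w η
  decays : Decays w
  decays_deriv : Decays (deriv w)
  decays_deriv2 : Decays (deriv (deriv w))
  p1_moment : ∫ η, P.p1 (A * w η) (P.β * (A * deriv w η)) = V * A * ∫ η, w η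
  p2_moment : V * (∫ η, P.q2 (A * w η) (P.β * (A * deriv w η)))
    - (∫ η, P.pp2 (A * w η) (P.β * (A * deriv w η)))
    + 2 * P.α ^ 2 * P.β ^ 2 * A ^ 2 * V * (∫ η, deriv w η ^ 2)
    + P.β⁻¹ * (∫ η, η * P.k2 (A * w η) (P.β * (A * deriv w η))) = 0

section Densities

variable {f g : ℝ → ℝ} (P : Params)

lemma Decays.p1 (hf : Decays f) (hg : Decays g) : Decays (fun x => P.p1 (f x) (g x)) :=
  ((hf.const_mul _).add ((hf.pow 2 two_ne_zero).const_mul _)).sub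
    ((hg.pow 2 two_ne_zero).const_mul _)

lemma Decays.q2 (hf : Decays f) (hg : Decays g) : Decays (fun x => P.q2 (f x) (g x)) :=
  (hf.pow 2 two_ne_zero).add ((hg.pow 2 two_ne_zero).const_mul _)

lemma Decays.pp2 (hf : Decays f) (hg : Decays g) : Decays (fun x => P.pp2 (f x) (g x)) := by
  have h := ((((hf.pow 2 two_ne_zero).const_mul P.c0).add
    ((hf.pow 3 three_ne_zero).const_mul (4 / 3 * P.c1))).sub
    ((hg.pow 2 two_ne_zero).const_mul (3 * P.γ))).sub
    ((hf.mul (hg.pow 2 two_ne_zero)).const_mul (2 * P.c2 - 5 * P.c3))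
  convert h using 2 with x
  simp only [Params.pp2]; ring

lemma Decays.k2 (hg : Decays g) : Decays (fun x => P.k2 (f x) (g x)) :=
  (hg.pow 3 three_ne_zero).const_mul _

end Densities

lemma Params.continuous_p1 (P : Params) : Continuous (fun z : ℝ × ℝ => P.p1 z.1 z.2) := by
  unfold Params.p1; fun_prop

lemma Params.continuous_q2 (P : Params) : Continuous (fun z : ℝ × ℝ => P.q2 z.1 z.2) := by
  unfold Params.q2; fun_prop

lemma Params.continuous_pp2 (P : Params) : Continuous (fun z : ℝ × ℝ => P.pp2 z.1 z.2) := by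
  unfold Params.pp2; fun_prop

lemma Params.continuous_k2 (P : Params) : Continuous (fun z : ℝ × ℝ => P.k2 z.1 z.2) := by
  unfold Params.k2; fun_prop

lemma Params.IsProfile.isSoliton {P : Params} (hP : P.Admissible) {A V g : ℝ} {w : ℝ → ℝ}
    (hA : 0 < A) (hV : P.IsVelocity A V g) (hw : P.IsProfile A V w) : P.IsSoliton A V w := by
  have hβ := P.β_pos hP
  have hΓ := hV.add_pos hP hA
  have hV0 := hV.c0_lt hP hA
  obtain ⟨-, -, hα, hc1, hc2, hc3⟩ := hP
  set Γ := P.γ + P.α ^ 2 * V with hΓdef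
  obtain ⟨C, μ, N, hμ, htail⟩ := exp_decay_of_profile_ode (w := w) (k := P.c3 * A / Γ)
    (a := P.c2 * A / Γ) (m := 1 / (P.β ^ 2 * Γ) * (V - P.c0)) (n := 1 / (P.β ^ 2 * Γ) * (P.c1 * A))
    (by positivity) (mul_pos (by positivity) (by linarith)) hw.smooth hw.top
    (fun η => by rw [hw.ode η]; ring)
  have ode : ∀ η, (Γ - P.c3 * A * w η) * P.β ^ 2 * deriv (deriv w) η
      = P.c2 * A * P.β ^ 2 * deriv w η ^ 2 + (V - P.c0) * w η - P.c1 * A * w η ^ 2 := by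
    intro η
    have := hw.ode η
    rw [← hΓdef] at this
    field_simp at this
    linarith
  have d0 := hasDerivAt_of_smooth hw.smooth
  have d1 := hasDerivAt_of_smooth (contDiff_deriv hw.smooth)
  have o1 := deriv_odd_of_even hw.even
  have c0 : Continuous w := hw.smooth.continuous
  have c1 : Continuous (deriv w) := (contDiff_deriv hw.smooth).continuous
  have c2 : Continuous (deriv (deriv w)) :=
    (contDiff_deriv (contDiff_deriv hw.smooth)).continuous
  have D0 : Decays w := decays_of_tail c0 (fun x => by rw [hw.even]) hμ fun x hx => (htail x hx).1
  have D1 : Decays (deriv w) := decays_of_tail c1 (fun x => by rw [o1, abs_neg]) hμ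
    fun x hx => (htail x hx).2.1
  have D2 : Decays (deriv (deriv w)) := decays_of_tail c2
    (fun x => by rw [deriv_even_of_odd o1]) hμ fun x hx => (htail x hx).2.2
  have b0 : Decays (fun η => P.β * (A * deriv w η)) := (D1.const_mul A).const_mul P.β
  have i1 := (D0.integrable c0)
  have i2 := ((D1.pow 2 two_ne_zero).integrable (by fun_prop))
  have ip1 := ((D0.const_mul A).p1 P b0).integrable
    (P.continuous_p1.comp (by fun_prop : Continuous fun η => (A * w η, P.β * (A * deriv w η))))
  have iq2 := ((D0.const_mul A).q2 P b0).integrable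
    (P.continuous_q2.comp (by fun_prop : Continuous fun η => (A * w η, P.β * (A * deriv w η))))
  have ipp2 := ((D0.const_mul A).pp2 P b0).integrable
    (P.continuous_pp2.comp (by fun_prop : Continuous fun η => (A * w η, P.β * (A * deriv w η))))
  have ik2 := (b0.k2 (f := fun η => A * w η) P).integrable_mul
    (P.continuous_k2.comp (by fun_prop : Continuous fun η => (A * w η, P.β * (A * deriv w η))))
  refine ⟨hw.smooth, hw.even, D0, D1, D2, ?_, ?_⟩
  -- The profile equation is the conservation law of a travelling wave integrated once: P₁ − VAw is
  -- an exact derivative.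
  · have hF : ∀ η, HasDerivAt (fun η => -A * ((Γ - P.c3 * A * w η) * P.β ^ 2 * deriv w η))
        (P.p1 (A * w η) (P.β * (A * deriv w η)) - V * A * w η) η := by
      intro η
      refine ((((((d0 η).const_mul (P.c3 * A)).const_sub Γ).mul_const (P.β ^ 2)).mul
        (d1 η)).const_mul (-A)).congr_deriv ?_
      simp only [Params.p1]
      linear_combination (-A) * ode η
    have := integral_eq_zero_of_hasDerivAt_of_integrable hF (ip1.sub (i1.const_mul _)) (by
      have h : Decays (fun η => -A * ((Γ * P.β ^ 2) * deriv w η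
          - (P.c3 * A * P.β ^ 2) * (w η * deriv w η))) :=
        ((D1.const_mul _).sub ((D0.mul D1).const_mul _)).const_mul _
      refine (h.integrable (by fun_prop)).congr (ae_of_all _ fun η => ?_)
      ring)
    rw [integral_sub ip1 (i1.const_mul _), integral_const_mul] at this
    linarith
  -- A virial identity: the profile equation is used with a multiplier proportional to w + ηw' =
  -- (ηw)'. The multiplier w produces the first part of the primitive, the dilation multiplier ηw'
  -- the second.
  · have hF : ∀ η, HasDerivAt (fun η => A ^ 2 * (2 * ((Γ - P.c3 * A * w η) * P.β ^ 2 * w η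
          * deriv w η) + η * ((Γ - P.c3 * A * w η) * P.β ^ 2 * deriv w η ^ 2
          - ((V - P.c0) * w η ^ 2 - 2 / 3 * P.c1 * A * w η ^ 3))))
        (V * P.q2 (A * w η) (P.β * (A * deriv w η)) - P.pp2 (A * w η) (P.β * (A * deriv w η))
          + 2 * P.α ^ 2 * P.β ^ 2 * A ^ 2 * V * deriv w η ^ 2
          + P.β⁻¹ * (η * P.k2 (A * w η) (P.β * (A * deriv w η)))) η := by
      intro η
      have hz := (((d0 η).const_mul (P.c3 * A)).const_sub Γ).mul_const (P.β ^ 2)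
      refine (((((hz.mul (d0 η)).mul (d1 η)).const_mul 2).add ((hasDerivAt_id η).mul
        ((hz.mul ((d1 η).pow 2)).sub ((((d0 η).pow 2).const_mul (V - P.c0)).sub
          (((d0 η).pow 3).const_mul (2 / 3 * P.c1 * A)))))).const_mul (A ^ 2)).congr_deriv ?_
      simp only [Params.q2, Params.pp2, Params.k2, Pi.mul_apply, Pi.pow_apply, Pi.sub_apply, id]
      field_simp
      rw [hΓdef] at ode ⊢
      push_cast
      linear_combination (6 * w η + 6 * η * deriv w η) * ode η
    have := integral_eq_zero_of_hasDerivAt_of_integrable hF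
      ((((iq2.const_mul _).sub ipp2).add (i2.const_mul _)).add (ik2.const_mul _)) (by
      have h1 : Decays (fun η => A ^ 2 * 2 * ((Γ * P.β ^ 2) * (w η * deriv w η)
          - (P.c3 * A * P.β ^ 2) * (w η * (w η * deriv w η)))) :=
        (((D0.mul D1).const_mul _).sub ((D0.mul (D0.mul D1)).const_mul _)).const_mul _
      have h2 : Decays (fun η => A ^ 2 * (((Γ * P.β ^ 2) * deriv w η ^ 2
          - (P.c3 * A * P.β ^ 2) * (w η * deriv w η ^ 2))
          - ((V - P.c0) * w η ^ 2 - 2 / 3 * P.c1 * A * w η ^ 3))) :=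
        ((((D1.pow 2 two_ne_zero).const_mul _).sub
          ((D0.mul (D1.pow 2 two_ne_zero)).const_mul _)).sub
          (((D0.pow 2 two_ne_zero).const_mul _).sub
            ((D0.pow 3 three_ne_zero).const_mul _))).const_mul _
      refine ((h1.integrable (by fun_prop)).add (h2.integrable_mul (by fun_prop))).congr
        (ae_of_all _ fun η => ?_)
      simp only [Pi.add_apply]
      ring)
    have j1 : Integrable (fun η => V * P.q2 (A * w η) (P.β * (A * deriv w η))
        - P.pp2 (A * w η) (P.β * (A * deriv w η))) := (iq2.const_mul _).sub ipp2
    have j2 : Integrable (fun η => V * P.q2 (A * w η) (P.β * (A * deriv w η))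
        - P.pp2 (A * w η) (P.β * (A * deriv w η))
        + 2 * P.α ^ 2 * P.β ^ 2 * A ^ 2 * V * deriv w η ^ 2) := j1.add (i2.const_mul _)
    rw [integral_add j2 (ik2.const_mul _), integral_add j1 (i2.const_mul _),
      integral_sub (iq2.const_mul _) ipp2] at this
    simpa only [integral_const_mul] using this

/-! ### Pairings with test functions -/

/-- The pairing is the convolution of gψ with the constant function 1, evaluated at 0; smooth
dependence of convolutions on parameters applies because ψ has compact support. -/
lemma contDiffOn_integral_mul_test {E : Type} [NormedAddCommGroup E] [NormedSpace ℝ E]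
    {s : Set E} (hs : IsOpen s) {g : E → ℝ → ℝ}
    (hg : ContDiffOn ℝ ∞ (fun z : E × ℝ => g z.1 z.2) (s ×ˢ univ)) {ψ : ℝ → ℝ} (hψ : IsTest ψ) :
    ContDiffOn ℝ ∞ (fun p => ∫ x, g p x * ψ x) s := by
  have h1 := contDiffOn_convolution_right_with_param (𝕜 := ℝ) (μ := (volume : Measure ℝ))
    (f := fun _ : ℝ => (1 : ℝ)) (n := ⊤) (ContinuousLinearMap.mul ℝ ℝ)
    (g := fun p x => g p x * ψ x) (s := s) (k := tsupport ψ) hs hψ.2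
    (fun p x _ hx => by simp [image_eq_zero_of_notMem_tsupport hx])
    continuous_const.locallyIntegrable (by
      refine hg.mul (hψ.1.comp_contDiffOn contDiffOn_snd))
  have h2 := h1.comp (f := fun p : E => (p, (0 : ℝ)))
    ((contDiff_id.prodMk contDiff_const).contDiffOn (s := s)) (fun p hp => ⟨hp, mem_univ _⟩)
  refine h2.congr fun p _ => ?_
  simp only [Function.comp, MeasureTheory.convolution, ContinuousLinearMap.mul_apply', one_mul,
    zero_sub]
  exact (integral_neg_eq_self (fun x => g p x * ψ x) volume).symm

/-- For ε below ε₁ both values are smaller than δ/2. For ε ∈ [ε₁, 1] joint continuity on a compact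
set is uniform. -/
lemma equicontinuous_of_continuousOn {f : ℝ → ℝ → ℝ} {C T : ℝ}
    (hf : ContinuousOn (fun z : ℝ × ℝ => f z.1 z.2) (Ioi 0 ×ˢ univ))
    (hC : ∀ ε ∈ Ioc (0 : ℝ) 1, ∀ t, |f ε t| ≤ C * ε) {δ : ℝ} (hδ : 0 < δ) :
    ∃ h > 0, ∀ ε ∈ Ioc (0 : ℝ) 1, ∀ t ∈ Ioo 0 T, ∀ t' ∈ Ioo 0 T,
      |t - t'| < h → |f ε t - f ε t'| < δ := by
  have hC0 : 0 ≤ C := by simpa using (abs_nonneg _).trans (hC 1 (by simp) 0)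
  set ε₁ := δ / (2 * (C + 1)) with hε₁
  have hε₁' : 0 < ε₁ := by positivity
  have hK : IsCompact (Icc ε₁ 1 ×ˢ Icc 0 T) := isCompact_Icc.prod isCompact_Icc
  have hu := hK.uniformContinuousOn_of_continuous (hf.mono (prod_mono
    (fun x hx => hε₁'.trans_le hx.1) (subset_univ _)))
  obtain ⟨h, hh, H⟩ := Metric.uniformContinuousOn_iff.1 hu δ hδ
  refine ⟨h, hh, fun ε hε t ht t' ht' htt => ?_⟩
  rcases lt_or_ge ε ε₁ with hlt | hge
  · have h1 := hC ε hε t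
    have h2 := hC ε hε t'
    have h3 : 2 * (C * ε) < δ := by
      have : (C + 1) * ε < (C + 1) * ε₁ := by gcongr
      have h4 : (C + 1) * ε₁ = δ / 2 := by rw [hε₁]; field_simp
      have := hε.1
      nlinarith
    calc |f ε t - f ε t'| ≤ |f ε t| + |f ε t'| := abs_sub _ _
      _ < δ := by linarith
  · have := H (ε, t) ⟨⟨hge, hε.2⟩, Ioo_subset_Icc_self ht⟩ (ε, t')
      ⟨⟨hge, hε.2⟩, Ioo_subset_Icc_self ht'⟩ (by
        rw [Prod.dist_eq, dist_self, Real.dist_eq]; simpa [Real.dist_eq] using htt)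
    rwa [Real.dist_eq] at this

/-! ### Reduction to the fast variables -/

section Scaling

variable {l : ℝ → ℝ → ℝ} {a b x₀ t₀ : ℝ}

lemma contDiffOn_scaled_pairing (hl : ContDiff ℝ ∞ (fun z : ℝ × ℝ => l z.1 z.2)) {ψ : ℝ → ℝ}
    (hψ : IsTest ψ) :
    ContDiffOn ℝ ∞ (fun z : ℝ × ℝ => ∫ x, l (a / z.1 * (z.2 - t₀)) (b / z.1 * (x - x₀)) * ψ x)
      (Ioi 0 ×ˢ univ) := by
  refine contDiffOn_integral_mul_test (E := ℝ × ℝ) (isOpen_Ioi.prod isOpen_univ)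
    (g := fun z x => l (a / z.1 * (z.2 - t₀)) (b / z.1 * (x - x₀))) ?_ hψ
  refine hl.comp_contDiffOn (f := fun z : (ℝ × ℝ) × ℝ =>
    (a / z.1.1 * (z.1.2 - t₀), b / z.1.1 * (z.2 - x₀))) ?_
  have h1 : ContDiffOn ℝ ∞ (fun z : (ℝ × ℝ) × ℝ => z.1.1) ((Ioi 0 ×ˢ univ) ×ˢ univ) := by fun_prop
  have h0 : ∀ z ∈ ((Ioi (0 : ℝ) ×ˢ (univ : Set ℝ)) ×ˢ (univ : Set ℝ)), z.1.1 ≠ 0 :=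
    fun z hz => (mem_Ioi.1 hz.1.1).ne'
  exact ((contDiffOn_const.div h1 h0).mul (by fun_prop)).prodMk
    ((contDiffOn_const.div h1 h0).mul (by fun_prop))

lemma scaled_pairing_eq (hb : 0 < b) {ε : ℝ} (hε : 0 < ε) (τ : ℝ) (ψ : ℝ → ℝ) :
    ∫ x, l τ (b / ε * (x - x₀)) * ψ x
      = ε * (b⁻¹ * ∫ ζ, l τ ζ * ψ (x₀ + ε * (b⁻¹ * ζ))) := by
  have hq : 0 < b / ε := div_pos hb hε
  have h1 := Measure.integral_comp_mul_left
    (fun ζ => l τ ζ * ψ (x₀ + ε * (b⁻¹ * ζ))) (b / ε)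
  have h2 := integral_sub_right_eq_self
    (μ := (volume : Measure ℝ)) (fun y => l τ (b / ε * y) * ψ (x₀ + y)) x₀
  have h3 : ∀ y, ε * (b⁻¹ * (b / ε * y)) = y := fun y => by field_simp
  simp only [h3, add_sub_cancel] at h1 h2
  rw [h2, h1, abs_of_pos (inv_pos.2 hq), smul_eq_mul, inv_div]
  ring

/-- The Jacobian ε/b of the stretching cancels the prefactor ε⁻¹, so the bound on the stretched
pairing passes over unchanged in order. Smallness as ε → 0 together with joint continuity in (ε, t)
gives equicontinuity on the whole interval; the exceptional set is empty. -/
lemma isOD_of_scaled (T : ℝ) (hb : 0 < b) (hl : ContDiff ℝ ∞ (fun z : ℝ × ℝ => l z.1 z.2))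
    {v : ℝ → ℝ → ℝ → ℝ}
    (hv : ∀ ε > 0, ∀ t x, v ε t x = ε⁻¹ * l (a / ε * (t - t₀)) (b / ε * (x - x₀)))
    (hbound : ∀ ψ, IsTest ψ → ∃ C, ∀ ε τ : ℝ,
      |∫ ζ, l τ ζ * ψ (x₀ + ε * (b⁻¹ * ζ))| ≤ C * ε ^ 2) :
    IsOD T 2 v := by
  intro ψ hψ
  have hs := contDiffOn_scaled_pairing (a := a) (b := b) (x₀ := x₀) (t₀ := t₀) hl hψ
  have heq : ∀ ε > 0, ∀ t, ∫ x, v ε t x * ψ x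
      = ε⁻¹ * ∫ x, l (a / ε * (t - t₀)) (b / ε * (x - x₀)) * ψ x := by
    intro ε hε t
    rw [← integral_const_mul]
    exact integral_congr_ae (ae_of_all _ fun x => by simp only [hv ε hε]; ring)
  obtain ⟨C, hC⟩ := hbound ψ hψ
  have hC0 : 0 ≤ C := by simpa using (abs_nonneg _).trans (hC 1 0)
  have hb2 : ∀ ε > 0, ∀ t, |∫ x, v ε t x * ψ x| ≤ b⁻¹ * C * ε ^ 2 := by
    intro ε hε t
    rw [heq ε hε, scaled_pairing_eq hb hε, inv_mul_cancel_left₀ hε.ne', abs_mul,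
      abs_of_pos (inv_pos.2 hb), mul_assoc]
    exact mul_le_mul_of_nonneg_left (hC _ _) (inv_pos.2 hb).le
  refine ⟨fun ε hε => ?_, 1, one_pos, ⟨b⁻¹ * C, fun ε hε t _ => ?_⟩, ∅, fun δ hδ => ?_⟩
  · have h1 := hs.comp (f := fun t : ℝ => (ε, t)) (s := Ioo 0 T)
      (contDiff_const.prodMk contDiff_id).contDiffOn (fun t _ => ⟨hε, mem_univ _⟩)
    exact (contDiffOn_const.mul h1).congr fun t _ => heq ε hε t
  · rw [show (2 : ℝ) = ((2 : ℕ) : ℝ) by norm_num, Real.rpow_natCast]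
    exact hb2 ε hε.1 t
  · obtain ⟨h, hh, H⟩ := equicontinuous_of_continuousOn (T := T) (C := b⁻¹ * C)
      (f := fun ε t => ∫ x, v ε t x * ψ x) (by
        have h1 : ContinuousOn (fun z : ℝ × ℝ => z.1⁻¹) (Ioi 0 ×ˢ univ) :=
          continuousOn_fst.inv₀ fun z hz => (mem_Ioi.1 hz.1).ne'
        exact (h1.mul hs.continuousOn).congr fun z hz => heq z.1 hz.1 z.2)
      (fun ε hε t => (hb2 ε hε.1 t).trans (by
        have := hε.1
        have := hε.2
        have h3 : 0 ≤ b⁻¹ * C := by positivity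
        gcongr
        nlinarith)) hδ
    exact ⟨h, hh, fun ε hε t ht t' ht' htt _ => H ε hε t ht t' ht' htt⟩

/-- Without the prefactor ε⁻¹ the Jacobian survives, so the pairing is O(ε) and the distributional
limit is zero. -/
lemma contInDistribUnif_of_scaled (T : ℝ) (hb : 0 < b)
    (hl : ContDiff ℝ ∞ (fun z : ℝ × ℝ => l z.1 z.2)) {v : ℝ → ℝ → ℝ → ℝ}
    (hv : ∀ ε > 0, ∀ t x, v ε t x = l (a / ε * (t - t₀)) (b / ε * (x - x₀)))
    (hbound : ∀ ψ, IsTest ψ → ∃ C, ∀ ε τ : ℝ,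
      |∫ ζ, l τ ζ * ψ (x₀ + ε * (b⁻¹ * ζ))| ≤ C) :
    ContInDistribUnif T v := by
  intro ψ hψ
  have hs := contDiffOn_scaled_pairing (a := a) (b := b) (x₀ := x₀) (t₀ := t₀) hl hψ
  have heq : ∀ ε > 0, ∀ t, ∫ x, v ε t x * ψ x
      = ∫ x, l (a / ε * (t - t₀)) (b / ε * (x - x₀)) * ψ x :=
    fun ε hε t => integral_congr_ae (ae_of_all _ fun x => by simp only [hv ε hε])
  obtain ⟨C, hC⟩ := hbound ψ hψ
  have hb2 : ∀ ε > 0, ∀ t, |∫ x, v ε t x * ψ x| ≤ b⁻¹ * C * ε := by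
    intro ε hε t
    rw [heq ε hε, scaled_pairing_eq hb hε, abs_mul, abs_mul, abs_of_pos hε,
      abs_of_pos (inv_pos.2 hb), mul_comm]
    gcongr
    exact hC _ _
  refine ⟨1, one_pos, fun t ht δ hδ => ?_, 0, ?_⟩
  · obtain ⟨h, hh, H⟩ := equicontinuous_of_continuousOn (T := T) (C := b⁻¹ * C)
      (f := fun ε t => ∫ x, v ε t x * ψ x)
      (hs.continuousOn.congr fun z hz => heq z.1 hz.1 z.2) (fun ε hε t => hb2 ε hε.1 t) hδ
    exact ⟨h, hh, fun ε hε t' ht' htt => H ε hε t ht t' ht' htt⟩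
  · rw [Metric.tendstoUniformlyOn_iff]
    intro δ hδ
    have h1 : Tendsto (fun ε : ℝ => b⁻¹ * C * ε) (𝓝[>] 0) (𝓝 0) := by
      have : Tendsto (fun ε : ℝ => b⁻¹ * C * ε) (𝓝 0) (𝓝 (b⁻¹ * C * 0)) :=
        (continuous_const.mul continuous_id).tendsto 0
      rw [mul_zero] at this
      exact this.mono_left nhdsWithin_le_nhds
    filter_upwards [h1.eventually (gt_mem_nhds hδ), self_mem_nhdsWithin] with ε hε hε0 t _
    rw [dist_comm, Real.dist_eq, Pi.zero_apply, sub_zero]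
    exact (hb2 ε hε0 t).trans_lt hε

lemma dx_scaled (U : ℝ → ℝ → ℝ) (p q t₀ x₀ t x : ℝ) :
    dx (fun t x => U (p * (t - t₀)) (q * (x - x₀))) t x
      = q * dx U (p * (t - t₀)) (q * (x - x₀)) := by
  have h1 := deriv_comp_sub_const (f := fun y => U (p * (t - t₀)) (q * y)) x₀ x
  have h2 := deriv_comp_mul_left q (U (p * (t - t₀))) (x - x₀)
  exact h1.trans h2

lemma dt_scaled (U : ℝ → ℝ → ℝ) (p q t₀ x₀ t x : ℝ) :
    dt (fun t x => U (p * (t - t₀)) (q * (x - x₀))) t x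
      = p * dt U (p * (t - t₀)) (q * (x - x₀)) := by
  have h1 := deriv_comp_sub_const (f := fun y => U (p * y) (q * (x - x₀))) t₀ t
  have h2 := deriv_comp_mul_left p (fun τ => U τ (q * (x - x₀))) (t - t₀)
  exact h1.trans h2

/-- The conservation law in the fast variables. -/
def Params.fastLaw1 (P : Params) (a : ℝ) (U : ℝ → ℝ → ℝ) : ℝ → ℝ → ℝ := fun τ ζ =>
  a * dt U τ ζ + P.β * dx (fun τ ζ => P.p1 (U τ ζ) (P.β * dx U τ ζ)) τ ζ

/-- The balance law in the fast variables. -/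
def Params.fastLaw2 (P : Params) (a : ℝ) (U : ℝ → ℝ → ℝ) : ℝ → ℝ → ℝ := fun τ ζ =>
  a * dt (fun τ ζ => P.q2 (U τ ζ) (P.β * dx U τ ζ)) τ ζ
    + P.β * dx (fun τ ζ => P.pp2 (U τ ζ) (P.β * dx U τ ζ)
        + 2 * P.α ^ 2 * (P.β * dx U τ ζ) * (a * dt U τ ζ)) τ ζ
    + P.k2 (U τ ζ) (P.β * dx U τ ζ)

/-- The density and the flux depend on u and εuₓ only, which are free of ε in the fast variables;
the outer derivative contributes the single factor ε⁻¹. -/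
lemma Params.law1_scaled (P : Params) (U : ℝ → ℝ → ℝ) {ε : ℝ} (hε : 0 < ε) (a t₀ x₀ t x : ℝ) :
    P.law1 ε (fun t x => U (a / ε * (t - t₀)) (P.β / ε * (x - x₀))) t x
      = ε⁻¹ * P.fastLaw1 a U (a / ε * (t - t₀)) (P.β / ε * (x - x₀)) := by
  have e : ∀ y, ε * (P.β / ε * y) = P.β * y := fun y => by field_simp
  simp only [Params.law1, Params.fastLaw1, dx_scaled, dt_scaled, e]
  rw [dx_scaled (fun τ ζ => P.p1 (U τ ζ) (P.β * dx U τ ζ))]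
  field_simp

lemma Params.law2_scaled (P : Params) (U : ℝ → ℝ → ℝ) {ε : ℝ} (hε : 0 < ε) (a t₀ x₀ t x : ℝ) :
    P.law2 ε (fun t x => U (a / ε * (t - t₀)) (P.β / ε * (x - x₀))) t x
      = ε⁻¹ * P.fastLaw2 a U (a / ε * (t - t₀)) (P.β / ε * (x - x₀)) := by
  have e : ∀ y, ε * (P.β / ε * y) = P.β * y := fun y => by field_simp
  have e2 : ∀ y z, 2 * P.α ^ 2 * ε ^ 2 * (P.β / ε * y) * (a / ε * z)
      = 2 * P.α ^ 2 * (P.β * y) * (a * z) := fun y z => by field_simp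
  simp only [Params.law2, Params.fastLaw2, dx_scaled, dt_scaled, e, e2]
  rw [dt_scaled (fun τ ζ => P.q2 (U τ ζ) (P.β * dx U τ ζ)),
    dx_scaled (fun τ ζ => P.pp2 (U τ ζ) (P.β * dx U τ ζ)
        + 2 * P.α ^ 2 * (P.β * dx U τ ζ) * (a * dt U τ ζ))]
  ring

end Scaling

/-! ### Sums of two localized waves up to an interaction -/

/-- Functions of the fast variables localized near the trajectory `c`. -/
def Localized (c : ℝ → ℝ) (f : ℝ → ℝ → ℝ) : Prop :=
  ∃ C, ∀ τ ζ, |f τ ζ| * (1 + |ζ - c τ|) ^ 8 ≤ C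

/-- Functions of the fast variables localized near the origin, uniformly in time. -/
def Interaction (f : ℝ → ℝ → ℝ) : Prop := ∃ C, ∀ τ ζ, |f τ ζ| * (1 + |ζ|) ^ 4 ≤ C

/-- Boundedness in the fast variables. -/
def Bdd (f : ℝ → ℝ → ℝ) : Prop := ∃ C, ∀ τ ζ, |f τ ζ| ≤ C

/-- Convergence to `A` at both infinities at the rate `|τ|⁻⁴`. -/
def TendsRapidly (g : ℝ → ℝ) (A : ℝ) : Prop := ∃ C, ∀ τ, |g τ - A| * (1 + |τ|) ^ 4 ≤ C

/-- Two trajectories that grow at most linearly and separate linearly. -/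
structure Separating (c₁ c₂ : ℝ → ℝ) (K : ℝ) : Prop where
  nonneg : 0 ≤ K
  left : ∀ τ, 1 + |c₁ τ| ≤ K * (1 + |τ|)
  right : ∀ τ, 1 + |c₂ τ| ≤ K * (1 + |τ|)
  sep : ∀ τ, 1 + |τ| ≤ K * (1 + |c₁ τ - c₂ τ|)

section Classes

variable {c c₁ c₂ : ℝ → ℝ} {K : ℝ} {f g a b a' b' : ℝ → ℝ → ℝ}

lemma Bdd.add (hf : Bdd f) (hg : Bdd g) : Bdd (fun τ ζ => f τ ζ + g τ ζ) := by
  obtain ⟨C, hC⟩ := hf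
  obtain ⟨D, hD⟩ := hg
  exact ⟨C + D, fun τ ζ => (abs_add_le _ _).trans (add_le_add (hC τ ζ) (hD τ ζ))⟩

lemma Localized.bdd (hf : Localized c f) : Bdd f := by
  obtain ⟨C, hC⟩ := hf
  exact ⟨C, fun τ ζ => (le_mul_of_one_le_right (abs_nonneg _)
    (one_le_pow₀ (by linarith [abs_nonneg (ζ - c τ)]))).trans (hC τ ζ)⟩

lemma Interaction.bdd (hf : Interaction f) : Bdd f := by
  obtain ⟨C, hC⟩ := hf
  exact ⟨C, fun τ ζ => (le_mul_of_one_le_right (abs_nonneg _)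
    (one_le_pow₀ (by linarith [abs_nonneg ζ]))).trans (hC τ ζ)⟩

lemma Localized.add (hf : Localized c f) (hg : Localized c g) :
    Localized c (fun τ ζ => f τ ζ + g τ ζ) := by
  obtain ⟨C, hC⟩ := hf
  obtain ⟨D, hD⟩ := hg
  refine ⟨C + D, fun τ ζ => le_trans ?_ (add_le_add (hC τ ζ) (hD τ ζ))⟩
  rw [← add_mul]
  gcongr
  exact abs_add_le _ _

lemma Interaction.add (hf : Interaction f) (hg : Interaction g) :
    Interaction (fun τ ζ => f τ ζ + g τ ζ) := by
  obtain ⟨C, hC⟩ := hf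
  obtain ⟨D, hD⟩ := hg
  refine ⟨C + D, fun τ ζ => le_trans ?_ (add_le_add (hC τ ζ) (hD τ ζ))⟩
  rw [← add_mul]
  gcongr
  exact abs_add_le _ _

lemma Localized.bdd_mul (hf : Bdd f) (hg : Localized c g) :
    Localized c (fun τ ζ => f τ ζ * g τ ζ) := by
  obtain ⟨C, hC⟩ := hf
  obtain ⟨D, hD⟩ := hg
  refine ⟨C * D, fun τ ζ => ?_⟩
  rw [abs_mul, mul_assoc]
  exact mul_le_mul (hC τ ζ) (hD τ ζ) (by positivity) (le_trans (abs_nonneg _) (hC τ ζ))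

lemma Interaction.bdd_mul (hf : Bdd f) (hg : Interaction g) :
    Interaction (fun τ ζ => f τ ζ * g τ ζ) := by
  obtain ⟨C, hC⟩ := hf
  obtain ⟨D, hD⟩ := hg
  refine ⟨C * D, fun τ ζ => ?_⟩
  rw [abs_mul, mul_assoc]
  exact mul_le_mul (hC τ ζ) (hD τ ζ) (by positivity) (le_trans (abs_nonneg _) (hC τ ζ))

lemma one_add_abs_le_mul (x y : ℝ) : 1 + |x| ≤ (1 + |y|) * (1 + |x - y|) := by
  have h1 : |x| ≤ |y| + |x - y| := by simpa using abs_add_le y (x - y)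
  nlinarith [mul_nonneg (abs_nonneg y) (abs_nonneg (x - y))]

/-- The wave may be as far as K(1 + |τ|) from the origin; the decay of g − A in τ pays for this
displacement. -/
lemma Interaction.of_tendsRapidly {g : ℝ → ℝ} {A : ℝ} (_ : 0 ≤ K)
    (hc : ∀ τ, 1 + |c τ| ≤ K * (1 + |τ|)) (hg : TendsRapidly g A) (hf : Localized c f) :
    Interaction (fun τ ζ => (g τ - A) * f τ ζ) := by
  obtain ⟨C, hC⟩ := hg
  obtain ⟨D, hD⟩ := hf
  refine ⟨K ^ 4 * (C * D), fun τ ζ => ?_⟩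
  have h1 : 1 + |ζ| ≤ K * (1 + |τ|) * (1 + |ζ - c τ|) :=
    (one_add_abs_le_mul ζ (c τ)).trans (by gcongr; exact hc τ)
  have h2 : 1 ≤ 1 + |ζ - c τ| := by linarith [abs_nonneg (ζ - c τ)]
  calc |(g τ - A) * f τ ζ| * (1 + |ζ|) ^ 4
      ≤ |g τ - A| * |f τ ζ| * (K * (1 + |τ|) * (1 + |ζ - c τ|)) ^ 4 := by
        rw [abs_mul]; gcongr
    _ = K ^ 4 * (|g τ - A| * (1 + |τ|) ^ 4 * (|f τ ζ| * (1 + |ζ - c τ|) ^ 4)) := by ring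
    _ ≤ K ^ 4 * (C * D) := by
        refine mul_le_mul_of_nonneg_left (mul_le_mul (hC τ) ?_ (by positivity)
          (le_trans (by positivity) (hC τ))) (by positivity)
        refine le_trans ?_ (hD τ ζ)
        exact mul_le_mul_of_nonneg_left (pow_le_pow_right₀ h2 (by norm_num)) (abs_nonneg _)

/-- Put x = 1 + |ζ − c₁| and y = 1 + |ζ − c₂|. Linear separation gives 1 + |τ| ≤ Kxy, so 1 + |ζ| ≤
(1 + |c₁|)x ≤ K²x²y. The fourth power costs x⁸y⁴, which is why single waves are required to decay at
rate 8 when interactions are measured at rate 4. -/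
lemma Interaction.of_mul (h : Separating c₁ c₂ K) (hf : Localized c₁ f) (hg : Localized c₂ g) :
    Interaction (fun τ ζ => f τ ζ * g τ ζ) := by
  obtain ⟨C, hC⟩ := hf
  obtain ⟨D, hD⟩ := hg
  refine ⟨(K * K) ^ 4 * (C * D), fun τ ζ => ?_⟩
  set x := 1 + |ζ - c₁ τ| with hx
  set y := 1 + |ζ - c₂ τ| with hy
  have hx1 : 1 ≤ x := by rw [hx]; linarith [abs_nonneg (ζ - c₁ τ)]
  have hy1 : 1 ≤ y := by rw [hy]; linarith [abs_nonneg (ζ - c₂ τ)]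
  have hK := h.nonneg
  have h3 : 1 + |c₁ τ - c₂ τ| ≤ x * y := by
    have := abs_sub_le (c₁ τ) ζ (c₂ τ)
    rw [abs_sub_comm (c₁ τ) ζ] at this
    nlinarith [mul_nonneg (abs_nonneg (ζ - c₁ τ)) (abs_nonneg (ζ - c₂ τ))]
  have h1 : 1 + |ζ| ≤ K * K * (x ^ 2 * y) :=
    calc 1 + |ζ| ≤ (1 + |c₁ τ|) * x := one_add_abs_le_mul ζ (c₁ τ)
      _ ≤ K * (K * (x * y)) * x := by
        gcongr
        exact (h.left τ).trans (by gcongr; exact (h.sep τ).trans (by gcongr))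
      _ = _ := by ring
  calc |f τ ζ * g τ ζ| * (1 + |ζ|) ^ 4
      ≤ |f τ ζ| * |g τ ζ| * (K * K * (x ^ 2 * y)) ^ 4 := by rw [abs_mul]; gcongr
    _ = (K * K) ^ 4 * (|f τ ζ| * x ^ 8 * (|g τ ζ| * y ^ 4)) := by ring
    _ ≤ (K * K) ^ 4 * (C * D) := by
        refine mul_le_mul_of_nonneg_left (mul_le_mul (hC τ ζ) ?_ (by positivity)
          (le_trans (by positivity) (hC τ ζ))) (by positivity)
        exact (mul_le_mul_of_nonneg_left (pow_le_pow_right₀ hy1 (by norm_num))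
          (abs_nonneg _)).trans (hD τ ζ)

lemma Localized.of_decays {w : ℝ → ℝ} (hw : Decays w) (c : ℝ → ℝ) :
    Localized c (fun τ ζ => w (ζ - c τ)) := by
  obtain ⟨C, hC⟩ := hw
  exact ⟨C, fun τ ζ => hC (ζ - c τ)⟩

/-- Rate 4 is two powers for the moment and two for integrability. -/
lemma Interaction.integral_le (hf : Interaction f) (hc : ∀ τ, Continuous (f τ)) :
    (∀ τ, ∀ n ≤ 2, Integrable fun ζ => ζ ^ n * f τ ζ) ∧
      ∃ C, ∀ τ, ∀ n ≤ 2, ∫ ζ, |ζ ^ n * f τ ζ| ≤ C := by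
  obtain ⟨C, hC⟩ := hf
  have key : ∀ τ ζ, ∀ n ≤ 2, |ζ ^ n * f τ ζ| ≤ C * (1 + ζ ^ 2)⁻¹ := by
    intro τ ζ n hn
    rw [← div_eq_mul_inv, le_div_iff₀ (by positivity), abs_mul, abs_pow]
    refine le_trans ?_ (hC τ ζ)
    have h0 := abs_nonneg ζ
    have h1 : |ζ| ^ n ≤ (1 + |ζ|) ^ 2 :=
      (pow_le_pow_left₀ h0 (by linarith) n).trans (pow_le_pow_right₀ (by linarith) hn)
    have h2 : 1 + ζ ^ 2 ≤ (1 + |ζ|) ^ 2 := by rw [← sq_abs]; nlinarith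
    calc |ζ| ^ n * |f τ ζ| * (1 + ζ ^ 2) ≤ (1 + |ζ|) ^ 2 * |f τ ζ| * (1 + |ζ|) ^ 2 := by gcongr
      _ = |f τ ζ| * (1 + |ζ|) ^ 4 := by ring
  have hint : ∀ τ, ∀ n ≤ 2, Integrable fun ζ => ζ ^ n * f τ ζ := fun τ n hn => by
    have := hc τ
    exact (integrable_inv_one_add_sq.const_mul C).mono' (by fun_prop)
      (ae_of_all _ fun ζ => key τ ζ n hn)
  refine ⟨hint, ∫ ζ : ℝ, C * (1 + ζ ^ 2)⁻¹, fun τ n hn => ?_⟩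
  exact integral_mono (hint τ n hn).abs (integrable_inv_one_add_sq.const_mul C)
    (fun ζ => key τ ζ n hn)

/-- `f` is the sum of the waves `a` and `b`, localized near `c₁` and `c₂`, and of an
interaction. -/
structure Split (c₁ c₂ : ℝ → ℝ) (f a b : ℝ → ℝ → ℝ) : Prop where
  left : Localized c₁ a
  right : Localized c₂ b
  rest : Interaction (fun τ ζ => f τ ζ - a τ ζ - b τ ζ)

lemma Split.bdd (hf : Split c₁ c₂ f a b) : Bdd f := by
  have := (hf.left.bdd.add hf.right.bdd).add hf.rest.bdd
  simpa using this

lemma Split.add (hf : Split c₁ c₂ f a b) (hg : Split c₁ c₂ g a' b') :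
    Split c₁ c₂ (fun τ ζ => f τ ζ + g τ ζ) (fun τ ζ => a τ ζ + a' τ ζ)
      (fun τ ζ => b τ ζ + b' τ ζ) := by
  refine ⟨hf.left.add hg.left, hf.right.add hg.right, ?_⟩
  convert hf.rest.add hg.rest using 3
  ring

lemma Split.const_mul (hf : Split c₁ c₂ f a b) (k : ℝ) :
    Split c₁ c₂ (fun τ ζ => k * f τ ζ) (fun τ ζ => k * a τ ζ) (fun τ ζ => k * b τ ζ) := by
  have hk : Bdd (fun _ _ => k) := ⟨|k|, fun _ _ => le_rfl⟩
  refine ⟨hf.left.bdd_mul hk, hf.right.bdd_mul hk, ?_⟩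
  convert hf.rest.bdd_mul hk using 3
  ring

/-- The remainder is fg − aa' − bb' = ab' + a'b + (f − a − b)g + (g − a' − b')(a + b): cross terms
of separated waves and old remainders times bounded factors. Splittings are thus stable under
polynomial operations. -/
lemma Split.mul (h : Separating c₁ c₂ K) (hf : Split c₁ c₂ f a b) (hg : Split c₁ c₂ g a' b') :
    Split c₁ c₂ (fun τ ζ => f τ ζ * g τ ζ) (fun τ ζ => a τ ζ * a' τ ζ)
      (fun τ ζ => b τ ζ * b' τ ζ) := by
  refine ⟨hg.left.bdd_mul hf.left.bdd, hg.right.bdd_mul hf.right.bdd, ?_⟩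
  have h1 := (((Interaction.of_mul h hf.left hg.right).add
    (Interaction.of_mul h hg.left hf.right)).add (hf.rest.bdd_mul hg.bdd)).add
    (hg.rest.bdd_mul (hf.left.bdd.add hf.right.bdd))
  convert h1 using 3
  ring

lemma Split.of_waves (h : Separating c₁ c₂ K) {g₁ g₂ w₁ w₂ : ℝ → ℝ} {A₁ A₂ : ℝ}
    (hw₁ : Decays w₁) (hw₂ : Decays w₂) (hg₁ : TendsRapidly g₁ A₁) (hg₂ : TendsRapidly g₂ A₂) :
    Split c₁ c₂ (fun τ ζ => g₁ τ * w₁ (ζ - c₁ τ) + g₂ τ * w₂ (ζ - c₂ τ))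
      (fun τ ζ => A₁ * w₁ (ζ - c₁ τ)) (fun τ ζ => A₂ * w₂ (ζ - c₂ τ)) := by
  refine ⟨Localized.of_decays (hw₁.const_mul A₁) c₁, Localized.of_decays (hw₂.const_mul A₂) c₂, ?_⟩
  have h1 := (Interaction.of_tendsRapidly h.nonneg h.left hg₁ (Localized.of_decays hw₁ c₁)).add
    (Interaction.of_tendsRapidly h.nonneg h.right hg₂ (Localized.of_decays hw₂ c₂))
  convert h1 using 3
  ring

/-- A crude bound that is not uniform in τ, but sufficient for integrability at fixed τ and for
differentiation under the integral. -/
lemma Localized.growth (hf : Localized c f) (_ : 0 ≤ K) (hc : ∀ τ, 1 + |c τ| ≤ K * (1 + |τ|)) :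
    ∃ C, ∀ τ ζ, |f τ ζ| * (1 + |ζ|) ^ 4 ≤ C * (1 + |τ|) ^ 4 := by
  obtain ⟨C, hC⟩ := hf
  refine ⟨K ^ 4 * C, fun τ ζ => ?_⟩
  have h1 : 1 + |ζ| ≤ K * (1 + |τ|) * (1 + |ζ - c τ|) :=
    (one_add_abs_le_mul ζ (c τ)).trans (by gcongr; exact hc τ)
  have h2 : 1 ≤ 1 + |ζ - c τ| := by linarith [abs_nonneg (ζ - c τ)]
  calc |f τ ζ| * (1 + |ζ|) ^ 4 ≤ |f τ ζ| * (K * (1 + |τ|) * (1 + |ζ - c τ|)) ^ 4 := by gcongr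
    _ = K ^ 4 * (1 + |τ|) ^ 4 * (|f τ ζ| * (1 + |ζ - c τ|) ^ 4) := by ring
    _ ≤ K ^ 4 * (1 + |τ|) ^ 4 * C := by
        refine mul_le_mul_of_nonneg_left (le_trans ?_ (hC τ ζ)) (by positivity)
        exact mul_le_mul_of_nonneg_left (pow_le_pow_right₀ h2 (by norm_num)) (abs_nonneg _)
    _ = _ := by ring

lemma Split.growth (h : Separating c₁ c₂ K) (hf : Split c₁ c₂ f a b) :
    ∃ C, ∀ τ ζ, |f τ ζ| * (1 + |ζ|) ^ 4 ≤ C * (1 + |τ|) ^ 4 := by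
  obtain ⟨C₁, h₁⟩ := hf.left.growth h.nonneg h.left
  obtain ⟨C₂, h₂⟩ := hf.right.growth h.nonneg h.right
  obtain ⟨C₃, h₃⟩ := hf.rest
  have h3 : 0 ≤ C₃ := (by positivity : (0 : ℝ) ≤ _).trans (h₃ 0 0)
  refine ⟨C₁ + C₂ + C₃, fun τ ζ => ?_⟩
  have h4 : |f τ ζ| ≤ |a τ ζ| + |b τ ζ| + |f τ ζ - a τ ζ - b τ ζ| := by
    have := abs_add_three (a τ ζ) (b τ ζ) (f τ ζ - a τ ζ - b τ ζ)
    simpa using this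
  have h5 : C₃ ≤ C₃ * (1 + |τ|) ^ 4 :=
    le_mul_of_one_le_right h3 (one_le_pow₀ (by linarith [abs_nonneg τ]))
  have h6 := mul_le_mul_of_nonneg_right h4 (by positivity : 0 ≤ (1 + |ζ|) ^ 4)
  linarith [h₁ τ ζ, h₂ τ ζ, h₃ τ ζ]

end Classes

/-! ### Pairing with slowly varying functions -/

lemma integrable_mul_test {g : ℝ → ℝ} (hg : Integrable g) {ψ : ℝ → ℝ} (hψ : IsTest ψ) (x₀ s : ℝ) :
    Integrable fun ζ => g ζ * ψ (x₀ + s * ζ) := by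
  obtain ⟨B, hB⟩ := hψ.2.exists_bound_of_continuous hψ.1.continuous
  have := hψ.1.continuous
  exact hg.mul_bdd (c := B) (by fun_prop) (ae_of_all _ fun ζ => hB _)

lemma IsTest.taylor {ψ : ℝ → ℝ} (hψ : IsTest ψ) :
    ∃ B, 0 ≤ B ∧ ∀ x h, |ψ (x + h) - ψ x - h * deriv ψ x| ≤ B * h ^ 2 := by
  have d0 := hasDerivAt_of_smooth hψ.1
  have d1 := hasDerivAt_of_smooth (contDiff_deriv hψ.1)
  obtain ⟨B, hB⟩ := (hψ.2.deriv.deriv).exists_bound_of_continuous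
    (contDiff_deriv (contDiff_deriv hψ.1)).continuous
  have hB0 : 0 ≤ B := (norm_nonneg _).trans (hB 0)
  refine ⟨B, hB0, fun x h => ?_⟩
  have h1 : ∀ y z, |deriv ψ z - deriv ψ y| ≤ B * |z - y| := fun y z => by
    simpa [Real.norm_eq_abs] using convex_univ.norm_image_sub_le_of_norm_deriv_le
      (fun x _ => (d1 x).differentiableAt) (fun x _ => hB x) (mem_univ y) (mem_univ z)
  have h2 := (convex_uIcc x (x + h)).norm_image_sub_le_of_norm_hasDerivWithin_le
    (f := fun y => ψ y - y * deriv ψ x) (f' := fun y => deriv ψ y - deriv ψ x) (C := B * |h|)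
    (fun y _ => (((d0 y).sub ((hasDerivAt_id y).mul_const _)).congr_deriv
      (by ring)).hasDerivWithinAt) (fun y hy => by
      refine (h1 x y).trans ?_
      refine mul_le_mul_of_nonneg_left ?_ hB0
      have := abs_sub_left_of_mem_uIcc hy
      rwa [add_sub_cancel_left] at this)
    left_mem_uIcc right_mem_uIcc
  rw [Real.norm_eq_abs, Real.norm_eq_abs, add_sub_cancel_left] at h2
  calc |ψ (x + h) - ψ x - h * deriv ψ x|
      = |ψ (x + h) - (x + h) * deriv ψ x - (ψ x - x * deriv ψ x)| := by ring_nf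
    _ ≤ B * |h| * |h| := h2
    _ = B * h ^ 2 := by rw [← sq_abs]; ring

/-- The vanishing moments allow the affine Taylor polynomial of ψ at x₀ to be subtracted under the
integral. -/
lemma abs_pairing_le {g : ℝ → ℝ} (i : ∀ n ≤ 2, Integrable fun ζ => ζ ^ n * g ζ)
    (m0 : ∫ ζ, g ζ = 0) (m1 : ∫ ζ, ζ * g ζ = 0) {ψ : ℝ → ℝ} (hψ : IsTest ψ) {B : ℝ}
    (hB : ∀ x h, |ψ (x + h) - ψ x - h * deriv ψ x| ≤ B * h ^ 2) (x₀ s : ℝ) :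
    |∫ ζ, g ζ * ψ (x₀ + s * ζ)| ≤ B * s ^ 2 * ∫ ζ, |ζ ^ 2 * g ζ| := by
  have i0 : Integrable g := by simpa using i 0 (by norm_num)
  have i1 : Integrable (fun ζ => ζ * g ζ) := by simpa using i 1 (by norm_num)
  have e : ∫ ζ, g ζ * ψ (x₀ + s * ζ)
      = ∫ ζ, g ζ * (ψ (x₀ + s * ζ) - ψ x₀ - s * ζ * deriv ψ x₀) := by
    have h1 : ∫ ζ, (ψ x₀ * g ζ + s * deriv ψ x₀ * (ζ * g ζ)) = 0 := by
      rw [integral_add (i0.const_mul _) (i1.const_mul _), integral_const_mul, integral_const_mul,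
        m0, m1]
      ring
    have h2 : Integrable (fun ζ => ψ x₀ * g ζ + s * deriv ψ x₀ * (ζ * g ζ)) :=
      (i0.const_mul _).add (i1.const_mul _)
    rw [← sub_zero (∫ ζ, g ζ * ψ (x₀ + s * ζ)), ← h1,
      ← integral_sub (integrable_mul_test i0 hψ x₀ s) h2]
    congr 1 with ζ
    ring
  rw [e, ← integral_const_mul]
  refine (norm_integral_le_integral_norm _).trans (integral_mono_of_nonneg
    (ae_of_all _ fun ζ => norm_nonneg (g ζ * _)) ((i 2 le_rfl).abs.const_mul _) (ae_of_all _ fun ζ => ?_))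
  simp only [Real.norm_eq_abs, abs_mul, abs_pow, sq_abs]
  have := mul_le_mul_of_nonneg_left (hB x₀ (s * ζ)) (abs_nonneg (g ζ))
  rw [mul_pow] at this
  linarith

/-! ### Pairings of split functions with test functions -/

section Main

variable {c₁ c₂ : ℝ → ℝ} {K : ℝ} {f : ℝ → ℝ → ℝ} {l₁ l₂ : ℝ → ℝ}

lemma integral_moment_shift {l : ℝ → ℝ} (hl : Decays l) (hc : Continuous l) (c : ℝ) :
    ∫ ζ, ζ * l (ζ - c) = (∫ ζ, ζ * l ζ) + c * ∫ ζ, l ζ := by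
  have h := integral_sub_right_eq_self (μ := (volume : Measure ℝ)) (fun ζ => (ζ + c) * l ζ) c
  simp only [sub_add_cancel] at h
  rw [h, ← integral_const_mul, ← integral_add (hl.integrable_mul hc) ((hl.integrable hc).const_mul c)]
  congr 1 with ζ
  ring

lemma Decays.comp_sub {l : ℝ → ℝ} (hl : Decays l) (c : ℝ) : Decays (fun ζ => l (ζ - c)) := by
  obtain ⟨C, hC⟩ := hl
  refine ⟨(1 + |c|) ^ 8 * C, fun ζ => ?_⟩
  calc |l (ζ - c)| * (1 + |ζ|) ^ 8 ≤ |l (ζ - c)| * ((1 + |c|) * (1 + |ζ - c|)) ^ 8 := by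
        gcongr; exact one_add_abs_le_mul ζ c
    _ = (1 + |c|) ^ 8 * (|l (ζ - c)| * (1 + |ζ - c|) ^ 8) := by ring
    _ ≤ _ := by gcongr; exact hC _

lemma Split.pairing_bounded (hf : Split c₁ c₂ f (fun τ ζ => l₁ (ζ - c₁ τ)) (fun τ ζ => l₂ (ζ - c₂ τ)))
    (hc : ∀ τ, Continuous (f τ)) (d₁ : Decays l₁) (d₂ : Decays l₂) (k₁ : Continuous l₁)
    (k₂ : Continuous l₂) (x₀ b : ℝ) (ψ : ℝ → ℝ) (hψ : IsTest ψ) :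
    ∃ C, ∀ ε τ : ℝ, |∫ ζ, f τ ζ * ψ (x₀ + ε * (b⁻¹ * ζ))| ≤ C := by
  obtain ⟨B, hB⟩ := hψ.2.exists_bound_of_continuous hψ.1.continuous
  have hB0 : 0 ≤ B := (norm_nonneg _).trans (hB 0)
  obtain ⟨hi, C, hC⟩ := hf.rest.integral_le fun τ => by
    have := hc τ; fun_prop
  refine ⟨B * (C + (∫ ζ, |l₁ ζ|) + ∫ ζ, |l₂ ζ|), fun ε τ => ?_⟩
  have j1 : Integrable (fun ζ => l₁ (ζ - c₁ τ)) := (d₁.comp_sub _).integrable (by fun_prop)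
  have j2 : Integrable (fun ζ => l₂ (ζ - c₂ τ)) := (d₂.comp_sub _).integrable (by fun_prop)
  have j3 : Integrable (fun ζ => f τ ζ - l₁ (ζ - c₁ τ) - l₂ (ζ - c₂ τ)) := by
    simpa using hi τ 0 (by norm_num)
  have h3 := hC τ 0 (by norm_num)
  simp only [pow_zero, one_mul] at h3
  have j4 : Integrable (fun ζ => |f τ ζ - l₁ (ζ - c₁ τ) - l₂ (ζ - c₂ τ)| + |l₁ (ζ - c₁ τ)|) :=
    j3.abs.add j1.abs
  have e1 := integral_sub_right_eq_self (μ := (volume : Measure ℝ)) (fun ζ => |l₁ ζ|) (c₁ τ)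
  have e2 := integral_sub_right_eq_self (μ := (volume : Measure ℝ)) (fun ζ => |l₂ ζ|) (c₂ τ)
  calc |∫ ζ, f τ ζ * ψ (x₀ + ε * (b⁻¹ * ζ))|
      ≤ ∫ ζ, B * (|f τ ζ - l₁ (ζ - c₁ τ) - l₂ (ζ - c₂ τ)| + |l₁ (ζ - c₁ τ)|
          + |l₂ (ζ - c₂ τ)|) := by
        refine (norm_integral_le_integral_norm _).trans (integral_mono_of_nonneg
          (ae_of_all _ fun ζ => norm_nonneg (f τ ζ * _)) ((j4.add j2.abs).const_mul B)
          (ae_of_all _ fun ζ => ?_))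
        have h4 := abs_add_three (f τ ζ - l₁ (ζ - c₁ τ) - l₂ (ζ - c₂ τ)) (l₁ (ζ - c₁ τ))
          (l₂ (ζ - c₂ τ))
        rw [show f τ ζ - l₁ (ζ - c₁ τ) - l₂ (ζ - c₂ τ) + l₁ (ζ - c₁ τ) + l₂ (ζ - c₂ τ) = f τ ζ by
          ring] at h4
        simp only [norm_mul]
        rw [mul_comm]
        exact mul_le_mul (hB _) h4 (norm_nonneg _) hB0
    _ ≤ _ := by
        rw [integral_const_mul, integral_add j4 j2.abs, integral_add j3.abs j1.abs, e1, e2]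
        gcongr

/-- Each of the three parts has zero integral and zero first moment: the waves by assumption, even
after translation, and the remainder by subtraction. Their second moments about the respective
expansion points are bounded uniformly in τ, which fails for f about a fixed point. -/
lemma Split.pairing_quadratic
    (hf : Split c₁ c₂ f (fun τ ζ => l₁ (ζ - c₁ τ)) (fun τ ζ => l₂ (ζ - c₂ τ)))
    (hc : ∀ τ, Continuous (f τ)) (d₁ : Decays l₁) (d₂ : Decays l₂) (k₁ : Continuous l₁)
    (k₂ : Continuous l₂) (p₁ : ∫ ζ, l₁ ζ = 0) (q₁ : ∫ ζ, ζ * l₁ ζ = 0) (p₂ : ∫ ζ, l₂ ζ = 0)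
    (q₂ : ∫ ζ, ζ * l₂ ζ = 0) (m0 : ∀ τ, ∫ ζ, f τ ζ = 0) (m1 : ∀ τ, ∫ ζ, ζ * f τ ζ = 0)
    (x₀ b : ℝ) (ψ : ℝ → ℝ) (hψ : IsTest ψ) :
    ∃ C, ∀ ε τ : ℝ, |∫ ζ, f τ ζ * ψ (x₀ + ε * (b⁻¹ * ζ))| ≤ C * ε ^ 2 := by
  obtain ⟨B, hB0, hB⟩ := hψ.taylor
  obtain ⟨hi, C, hC⟩ := hf.rest.integral_le fun τ => by
    have := hc τ; fun_prop
  refine ⟨B * b⁻¹ ^ 2 * (C + (∫ ζ, |ζ ^ 2 * l₁ ζ|) + ∫ ζ, |ζ ^ 2 * l₂ ζ|), fun ε τ => ?_⟩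
  have j1 : Integrable (fun ζ => l₁ (ζ - c₁ τ)) := (d₁.comp_sub _).integrable (by fun_prop)
  have j2 : Integrable (fun ζ => l₂ (ζ - c₂ τ)) := (d₂.comp_sub _).integrable (by fun_prop)
  have j3 : Integrable (fun ζ => f τ ζ - l₁ (ζ - c₁ τ) - l₂ (ζ - c₂ τ)) := by
    simpa using hi τ 0 (by norm_num)
  have j1' : Integrable (fun ζ => ζ * l₁ (ζ - c₁ τ)) :=
    (d₁.comp_sub _).integrable_mul (by fun_prop)
  have j2' : Integrable (fun ζ => ζ * l₂ (ζ - c₂ τ)) :=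
    (d₂.comp_sub _).integrable_mul (by fun_prop)
  have j3' : Integrable (fun ζ => ζ * (f τ ζ - l₁ (ζ - c₁ τ) - l₂ (ζ - c₂ τ))) := by
    simpa using hi τ 1 (by norm_num)
  have j0 : Integrable (f τ) := by
    refine ((j3.add j1).add j2).congr (ae_of_all _ fun ζ => ?_)
    simp only [Pi.add_apply]
    ring
  have j0' : Integrable (fun ζ => ζ * f τ ζ) := by
    refine ((j3'.add j1').add j2').congr (ae_of_all _ fun ζ => ?_)
    simp only [Pi.add_apply]
    ring
  have e1 := integral_sub_right_eq_self (μ := (volume : Measure ℝ)) l₁ (c₁ τ)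
  have e2 := integral_sub_right_eq_self (μ := (volume : Measure ℝ)) l₂ (c₂ τ)
  have n0 : ∫ ζ, (f τ ζ - l₁ (ζ - c₁ τ) - l₂ (ζ - c₂ τ)) = 0 := by
    have j5 : Integrable (fun ζ => f τ ζ - l₁ (ζ - c₁ τ)) := j0.sub j1
    rw [integral_sub j5 j2, integral_sub j0 j1, e1, e2, m0, p₁, p₂]
    simp
  have n1 : ∫ ζ, ζ * (f τ ζ - l₁ (ζ - c₁ τ) - l₂ (ζ - c₂ τ)) = 0 := by
    have j5 : Integrable (fun ζ => ζ * f τ ζ - ζ * l₁ (ζ - c₁ τ)) := j0'.sub j1'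
    simp only [mul_sub] at j5 ⊢
    rw [integral_sub j5 j2', integral_sub j0' j1', m1, integral_moment_shift d₁ k₁,
      integral_moment_shift d₂ k₂, p₁, p₂, q₁, q₂]
    simp
  set s := ε * b⁻¹ with hs
  have es : ∀ ζ, ε * (b⁻¹ * ζ) = s * ζ := fun ζ => by rw [hs]; ring
  simp only [es]
  have b3 := abs_pairing_le (hi τ) n0 n1 hψ hB x₀ s
  -- The translation moves the Taylor expansion of ψ to the centre of the wave; the bound on ψ''
  -- does not depend on that point.
  have shift : ∀ (l : ℝ → ℝ) (c : ℝ), ∫ ζ, l (ζ - c) * ψ (x₀ + s * ζ)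
      = ∫ ζ, l ζ * ψ (x₀ + s * c + s * ζ) := by
    intro l c
    have := integral_sub_right_eq_self (μ := (volume : Measure ℝ))
      (fun ζ => l ζ * ψ (x₀ + s * c + s * ζ)) c
    rw [← this]
    congr 1 with ζ
    ring_nf
  have b1 := abs_pairing_le (fun n hn => d₁.integrable_pow_mul k₁ (hn.trans (by norm_num)))
    p₁ q₁ hψ hB (x₀ + s * c₁ τ) s
  have b2 := abs_pairing_le (fun n hn => d₂.integrable_pow_mul k₂ (hn.trans (by norm_num)))
    p₂ q₂ hψ hB (x₀ + s * c₂ τ) s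
  rw [← shift] at b1 b2
  have h3 := hC τ 2 le_rfl
  have t1 := integrable_mul_test j1 hψ x₀ s
  have t2 := integrable_mul_test j2 hψ x₀ s
  have t3 := integrable_mul_test j3 hψ x₀ s
  have e : ∫ ζ, f τ ζ * ψ (x₀ + s * ζ)
      = (∫ ζ, (f τ ζ - l₁ (ζ - c₁ τ) - l₂ (ζ - c₂ τ)) * ψ (x₀ + s * ζ))
        + (∫ ζ, l₁ (ζ - c₁ τ) * ψ (x₀ + s * ζ)) + ∫ ζ, l₂ (ζ - c₂ τ) * ψ (x₀ + s * ζ) := by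
    have t4 : Integrable (fun ζ => (f τ ζ - l₁ (ζ - c₁ τ) - l₂ (ζ - c₂ τ)) * ψ (x₀ + s * ζ)
        + l₁ (ζ - c₁ τ) * ψ (x₀ + s * ζ)) := t3.add t1
    rw [← integral_add t3 t1, ← integral_add t4 t2]
    congr 1 with ζ
    ring
  rw [e]
  refine (abs_add_three _ _ _).trans ((add_le_add (add_le_add b3 b1) b2).trans ?_)
  have hs2 : s ^ 2 = b⁻¹ ^ 2 * ε ^ 2 := by rw [hs]; ring
  have h4 : B * s ^ 2 * (∫ ζ, |ζ ^ 2 * (f τ ζ - l₁ (ζ - c₁ τ) - l₂ (ζ - c₂ τ))|)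
      ≤ B * s ^ 2 * C := by gcongr
  rw [hs2] at *
  linarith

end Main

/-! ### Rapidly attained limits -/

lemma RapidDecay.one_add {f : ℝ → ℝ} (hf : RapidDecay f) (n : ℕ) :
    ∃ C, ∀ τ, |f τ| * (1 + |τ|) ^ n ≤ C := by
  obtain ⟨C, hC⟩ := hf n
  obtain ⟨D, hD⟩ := hf 0
  refine ⟨2 ^ (n - 1) * (D + C), fun τ => ?_⟩
  have h1 := add_pow_le zero_le_one (abs_nonneg τ) n
  have h2 := hC τ
  have h3 := hD τ
  rw [pow_zero, one_mul] at h3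
  rw [one_pow] at h1
  calc |f τ| * (1 + |τ|) ^ n ≤ |f τ| * (2 ^ (n - 1) * (1 + |τ| ^ n)) := by gcongr
    _ = 2 ^ (n - 1) * (|f τ| + |τ| ^ n * |f τ|) := by ring
    _ ≤ _ := by gcongr

/-- With the barrier B = (C/n)(1 + τ)⁻ⁿ one has |f'| ≤ −B', so f − B increases to L and f + B
decreases to L. -/
lemma abs_sub_limit_le {f : ℝ → ℝ} (hf : ContDiff ℝ ∞ f) {L C : ℝ} {n : ℕ} (hn : n ≠ 0)
    (hlim : Tendsto f atTop (𝓝 L)) (hC : ∀ τ ≥ 0, |deriv f τ| * (1 + τ) ^ (n + 1) ≤ C) :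
    ∀ τ ≥ 0, |f τ - L| * (1 + τ) ^ n ≤ C / n := by
  have hn' : (0 : ℝ) < n := by exact_mod_cast Nat.pos_of_ne_zero hn
  have hd := hasDerivAt_of_smooth hf
  set B : ℝ → ℝ := fun t => C / n * ((1 + t) ^ n)⁻¹ with hB
  have hBd : ∀ t, 0 ≤ t → HasDerivAt B (-(C * ((1 + t) ^ (n + 1))⁻¹)) t := by
    intro t ht
    have h1 : HasDerivAt (fun t : ℝ => (1 + t) ^ n) (n * (1 + t) ^ (n - 1) * 1) t :=
      ((hasDerivAt_id t).const_add 1).pow n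
    have h0 : (1 + t) ≠ 0 := by positivity
    refine ((h1.inv (pow_ne_zero n h0)).const_mul (C / n)).congr_deriv ?_
    obtain ⟨m, rfl⟩ := Nat.exists_eq_succ_of_ne_zero hn
    simp only [Nat.succ_eq_add_one, Nat.add_sub_cancel]
    field_simp
    ring
  have hBlim : Tendsto B atTop (𝓝 0) := by
    have h1 : Tendsto (fun t : ℝ => (1 + t) ^ n) atTop atTop :=
      (tendsto_pow_atTop hn).comp (tendsto_atTop_add_const_left _ 1 tendsto_id)
    simpa using h1.inv_tendsto_atTop.const_mul (C / n)
  have hder : ∀ t, 0 ≤ t → |deriv f t| ≤ C * ((1 + t) ^ (n + 1))⁻¹ := by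
    intro t ht
    rw [← div_eq_mul_inv, le_div_iff₀ (by positivity)]
    exact hC t ht
  have key : ∀ g : ℝ → ℝ, (∀ t, 0 ≤ t → ∃ g', HasDerivAt g g' t ∧ 0 ≤ g') → MonotoneOn g (Ici 0) := by
    intro g hg
    refine monotoneOn_of_deriv_nonneg (convex_Ici 0)
      (fun x hx => (hg x hx).choose_spec.1.continuousAt.continuousWithinAt) (fun x hx => ?_)
      fun x hx => ?_
    · rw [interior_Ici] at hx
      exact (hg x hx.le).choose_spec.1.differentiableAt.differentiableWithinAt
    · rw [interior_Ici] at hx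
      rw [(hg x hx.le).choose_spec.1.deriv]
      exact (hg x hx.le).choose_spec.2
  have mono1 : MonotoneOn (fun t => f t - B t) (Ici 0) := key _ fun t ht =>
    ⟨_, (hd t).sub (hBd t ht), by have := (abs_le.1 (hder t ht)).1; linarith⟩
  have mono2 : MonotoneOn (fun t => -(f t + B t)) (Ici 0) := key _ fun t ht =>
    ⟨_, ((hd t).add (hBd t ht)).neg, by have := (abs_le.1 (hder t ht)).2; linarith⟩
  intro τ hτ
  have u1 : f τ - B τ ≤ L := by
    refine ge_of_tendsto (by simpa using hlim.sub hBlim) ?_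
    filter_upwards [eventually_ge_atTop τ] with t ht
    exact mono1 (mem_Ici.2 hτ) (mem_Ici.2 (le_trans hτ ht)) ht
  have u2 : -(f τ + B τ) ≤ -L := by
    refine ge_of_tendsto (f := fun t => -(f t + B t)) (by simpa using (hlim.add hBlim).neg) ?_
    filter_upwards [eventually_ge_atTop τ] with t ht
    exact mono2 (mem_Ici.2 hτ) (mem_Ici.2 (le_trans hτ ht)) ht
  have h1 : |f τ - L| ≤ C / n * ((1 + τ) ^ n)⁻¹ := abs_le.2 ⟨by linarith, by linarith⟩
  rwa [← div_eq_mul_inv, le_div_iff₀ (by positivity)] at h1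

lemma rapid_limit_top {f : ℝ → ℝ} (hf : ContDiff ℝ ∞ f) (hd : RapidDecay (deriv f)) {L : ℝ}
    (hlim : Tendsto f atTop (𝓝 L)) {n : ℕ} (hn : n ≠ 0) :
    ∃ C, ∀ τ ≥ 0, |f τ - L| * (1 + |τ|) ^ n ≤ C := by
  obtain ⟨C, hC⟩ := hd.one_add (n + 1)
  refine ⟨C / n, fun τ hτ => ?_⟩
  rw [abs_of_nonneg hτ]
  exact abs_sub_limit_le hf hn hlim (fun t ht => by simpa [abs_of_nonneg ht] using hC t) τ hτ

lemma rapid_limit_bot {f : ℝ → ℝ} (hf : ContDiff ℝ ∞ f) (hd : RapidDecay (deriv f)) {L : ℝ}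
    (hlim : Tendsto f atBot (𝓝 L)) {n : ℕ} (hn : n ≠ 0) :
    ∃ C, ∀ τ ≤ 0, |f τ - L| * (1 + |τ|) ^ n ≤ C := by
  obtain ⟨C, hC⟩ := rapid_limit_top (f := fun t => f (-t)) (hf.comp contDiff_neg)
    (fun n => by
      obtain ⟨C, hC⟩ := hd n
      refine ⟨C, fun τ => ?_⟩
      have := hC (-τ)
      rwa [abs_neg, ← abs_neg (deriv f (-τ)), ← deriv_comp_neg] at this) (hlim.comp tendsto_neg_atTop_atBot) hn
  refine ⟨C, fun τ hτ => ?_⟩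
  simpa using hC (-τ) (by linarith)

/-- Both limits must agree, which holds for the amplitudes. The phases may have distinct limits;
they stay inside the trajectories, and only their derivatives are compared with a constant. -/
lemma TendsRapidly.of_limits {f : ℝ → ℝ} (hf : ContDiff ℝ ∞ f) (hd : RapidDecay (deriv f)) {L : ℝ}
    (h₁ : Tendsto f atBot (𝓝 L)) (h₂ : Tendsto f atTop (𝓝 L)) : TendsRapidly f L := by
  obtain ⟨C, hC⟩ := rapid_limit_bot hf hd h₁ four_ne_zero
  obtain ⟨D, hD⟩ := rapid_limit_top hf hd h₂ four_ne_zero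
  refine ⟨max C D, fun τ => ?_⟩
  rcases le_total τ 0 with h | h
  · exact (hC τ h).trans (le_max_left _ _)
  · exact (hD τ h).trans (le_max_right _ _)

lemma RapidDecay.tendsRapidly {f : ℝ → ℝ} (hf : RapidDecay f) : TendsRapidly f 0 := by
  obtain ⟨C, hC⟩ := hf.one_add 4
  exact ⟨C, fun τ => by simpa using hC τ⟩

lemma TendsRapidly.const (A : ℝ) : TendsRapidly (fun _ => A) A := ⟨0, fun τ => by simp⟩

lemma TendsRapidly.add {f g : ℝ → ℝ} {A B : ℝ} (hf : TendsRapidly f A) (hg : TendsRapidly g B) :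
    TendsRapidly (fun τ => f τ + g τ) (A + B) := by
  obtain ⟨C, hC⟩ := hf
  obtain ⟨D, hD⟩ := hg
  refine ⟨C + D, fun τ => le_trans ?_ (add_le_add (hC τ) (hD τ))⟩
  rw [← add_mul]
  gcongr
  refine le_trans (le_of_eq ?_) (abs_add_le _ _)
  congr 1
  ring

lemma TendsRapidly.mul {f g : ℝ → ℝ} {A B : ℝ} (hf : TendsRapidly f A) (hg : TendsRapidly g B) :
    TendsRapidly (fun τ => f τ * g τ) (A * B) := by
  obtain ⟨C, hC⟩ := hf
  obtain ⟨D, hD⟩ := hg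
  have hD0 : 0 ≤ D := (by positivity : (0 : ℝ) ≤ _).trans (hD 0)
  have hg : ∀ τ, |g τ| ≤ D + |B| := by
    intro τ
    have h1 : |g τ - B| ≤ D := (le_mul_of_one_le_right (abs_nonneg _)
      (one_le_pow₀ (by linarith [abs_nonneg τ]))).trans (hD τ)
    have h2 := abs_add_le (g τ - B) B
    rw [sub_add_cancel] at h2
    linarith
  refine ⟨C * (D + |B|) + |A| * D, fun τ => ?_⟩
  have h3 : |f τ * g τ - A * B| ≤ |f τ - A| * |g τ| + |A| * |g τ - B| := by
    rw [← abs_mul, ← abs_mul]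
    refine le_trans (le_of_eq ?_) (abs_add_le _ _)
    congr 1
    ring
  calc |f τ * g τ - A * B| * (1 + |τ|) ^ 4
      ≤ (|f τ - A| * |g τ| + |A| * |g τ - B|) * (1 + |τ|) ^ 4 := by gcongr
    _ = (|f τ - A| * (1 + |τ|) ^ 4) * |g τ| + |A| * (|g τ - B| * (1 + |τ|) ^ 4) := by ring
    _ ≤ _ := by
        refine add_le_add (mul_le_mul (hC τ) (hg τ) (abs_nonneg _)
          ((by positivity : (0 : ℝ) ≤ _).trans (hC 0))) ?_
        gcongr
        exact hD τ

lemma TendsRapidly.const_mul {f : ℝ → ℝ} {A : ℝ} (hf : TendsRapidly f A) (k : ℝ) :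
    TendsRapidly (fun τ => k * f τ) (k * A) :=
  (TendsRapidly.const k).mul hf

/-! ### Superpositions of two waves -/

/-- `g₁ w₁(ζ - c₁) + g₂ w₂(ζ - c₂)` -/
def waves (c g w : Fin 2 → ℝ → ℝ) (τ ζ : ℝ) : ℝ :=
  g 0 τ * w 0 (ζ - c 0 τ) + g 1 τ * w 1 (ζ - c 1 τ)

section Waves

variable {c g w : Fin 2 → ℝ → ℝ}

lemma waves_dx (hw : ∀ i, ContDiff ℝ ∞ (w i)) (τ ζ : ℝ) :
    HasDerivAt (fun ζ => waves c g w τ ζ) (waves c g (fun i => deriv (w i)) τ ζ) ζ := by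
  have h : ∀ i, HasDerivAt (fun ζ => g i τ * w i (ζ - c i τ))
      (g i τ * deriv (w i) (ζ - c i τ)) ζ := fun i =>
    (((hasDerivAt_of_smooth (hw i) _).comp ζ ((hasDerivAt_id ζ).sub_const (c i τ))).const_mul
      (g i τ)).congr_deriv (by simp)
  exact (h 0).add (h 1)

lemma waves_dt (hw : ∀ i, ContDiff ℝ ∞ (w i)) (hc : ∀ i, ContDiff ℝ ∞ (c i))
    (hg : ∀ i, ContDiff ℝ ∞ (g i)) (τ ζ : ℝ) :
    HasDerivAt (fun τ => waves c g w τ ζ) (waves c (fun i => deriv (g i)) w τ ζ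
      + waves c (fun i τ => -(g i τ * deriv (c i) τ)) (fun i => deriv (w i)) τ ζ) τ := by
  have h : ∀ i, HasDerivAt (fun τ => g i τ * w i (ζ - c i τ))
      (deriv (g i) τ * w i (ζ - c i τ)
        + -(g i τ * deriv (c i) τ) * deriv (w i) (ζ - c i τ)) τ := fun i =>
    ((hasDerivAt_of_smooth (hg i) τ).mul ((hasDerivAt_of_smooth (hw i) _).comp τ
      ((hasDerivAt_of_smooth (hc i) τ).const_sub ζ))).congr_deriv (by
        simp only [Function.comp]; ring)
  refine ((h 0).add (h 1)).congr_deriv ?_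
  simp only [waves]
  ring

lemma waves_contDiff (hw : ∀ i, ContDiff ℝ ∞ (w i)) (hc : ∀ i, ContDiff ℝ ∞ (c i))
    (hg : ∀ i, ContDiff ℝ ∞ (g i)) : ContDiff ℝ ∞ (fun z : ℝ × ℝ => waves c g w z.1 z.2) := by
  have h : ∀ i, ContDiff ℝ ∞ (fun z : ℝ × ℝ => g i z.1 * w i (z.2 - c i z.1)) := fun i =>
    ((hg i).comp contDiff_fst).mul ((hw i).comp (contDiff_snd.sub ((hc i).comp contDiff_fst)))
  exact (h 0).add (h 1)

end Waves

/-! ### The laws as polynomials in the derivatives -/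

/-- The conservation law in terms of `u`, `p = εuₓ`, `q = ε²uₓₓ`, `s = εuₜ`. -/
def Params.poly1 (P : Params) (u p q s : ℝ) : ℝ :=
  s + P.c0 * p + 2 * P.c1 * (u * p) + -2 * (P.c2 - P.c3) * (p * q)

/-- The time derivative `2us + 2α²pz` of the density `u² + α²p²`. -/
def Params.rate2 (P : Params) (u p s z : ℝ) : ℝ := 2 * (u * s) + 2 * P.α ^ 2 * (p * z)

/-- The balance law in terms of `u`, `p = εuₓ`, `q = ε²uₓₓ`, `s = εuₜ`, `z = ε²uₓₜ`. -/
def Params.poly2 (P : Params) (u p q s z : ℝ) : ℝ :=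
  P.rate2 u p s z + (2 * P.c0 * (u * p) + 4 * P.c1 * (u * (u * p))
    + -(2 * P.c2 - 5 * P.c3) * (p * (p * p)) + -6 * P.γ * (p * q)
    + -2 * (2 * P.c2 - 5 * P.c3) * (u * (p * q)) + 2 * P.α ^ 2 * (q * s + p * z))
    + (2 * P.c2 - P.c3) * (p * (p * p))

lemma Params.hasDerivAt_p1 (P : Params) {u p : ℝ → ℝ} {u' p' x : ℝ} (hu : HasDerivAt u u' x)
    (hp : HasDerivAt p p' x) : HasDerivAt (fun x => P.p1 (u x) (p x))
      (P.c0 * u' + 2 * P.c1 * (u x * u') + -2 * (P.c2 - P.c3) * (p x * p')) x := by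
  refine (((hu.const_mul P.c0).add ((hu.pow 2).const_mul P.c1)).sub
    ((hp.pow 2).const_mul (P.c2 - P.c3))).congr_deriv ?_
  push_cast; ring

lemma Params.hasDerivAt_q2 (P : Params) {u p : ℝ → ℝ} {u' p' x : ℝ} (hu : HasDerivAt u u' x)
    (hp : HasDerivAt p p' x) : HasDerivAt (fun x => P.q2 (u x) (p x))
      (P.rate2 (u x) (p x) u' p') x := by
  refine ((hu.pow 2).add ((hp.pow 2).const_mul (P.α ^ 2))).congr_deriv ?_
  simp only [Params.rate2]
  push_cast; ring

lemma Params.hasDerivAt_pp2 (P : Params) {u p : ℝ → ℝ} {u' p' x : ℝ} (hu : HasDerivAt u u' x)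
    (hp : HasDerivAt p p' x) : HasDerivAt (fun x => P.pp2 (u x) (p x))
      (2 * P.c0 * (u x * u') + 4 * P.c1 * (u x * (u x * u'))
        + -(2 * P.c2 - 5 * P.c3) * (u' * (p x * p x)) + -6 * P.γ * (p x * p')
        + -2 * (2 * P.c2 - 5 * P.c3) * (u x * (p x * p'))) x := by
  refine ((((hu.pow 2).const_mul P.c0).add ((hu.pow 3).const_mul (4 / 3 * P.c1))).sub
    (((hu.const_mul (2 * P.c2 - 5 * P.c3)).const_add (3 * P.γ)).mul (hp.pow 2))).congr_deriv ?_
  simp only [Pi.pow_apply]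
  push_cast; ring

section FastLaws

variable {P : Params} {a : ℝ} {U Ux Uxx Us Usx : ℝ → ℝ → ℝ}

lemma Params.fastLaw1_eq (hβ : P.β ≠ 0) (ha : a ≠ 0)
    (hx : ∀ τ ζ, HasDerivAt (fun ζ => U τ ζ) (P.β⁻¹ * Ux τ ζ) ζ)
    (hxx : ∀ τ ζ, HasDerivAt (fun ζ => Ux τ ζ) (P.β⁻¹ * Uxx τ ζ) ζ)
    (ht : ∀ τ ζ, HasDerivAt (fun τ => U τ ζ) (a⁻¹ * Us τ ζ) τ) (τ ζ : ℝ) :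
    P.fastLaw1 a U τ ζ = P.poly1 (U τ ζ) (Ux τ ζ) (Uxx τ ζ) (Us τ ζ) := by
  have e1 : ∀ τ ζ, P.β * dx U τ ζ = Ux τ ζ := fun τ ζ => by
    rw [dx, (hx τ ζ).deriv, mul_inv_cancel_left₀ hβ]
  simp only [Params.fastLaw1, e1]
  rw [dt, (ht τ ζ).deriv, dx, (P.hasDerivAt_p1 (hx τ ζ) (hxx τ ζ)).deriv]
  simp only [Params.poly1]
  field_simp
  ring

/-- The same `Usx` serves for both mixed derivatives. Once the law is a polynomial in split
functions, it is itself split. -/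
lemma Params.fastLaw2_eq (hβ : P.β ≠ 0) (ha : a ≠ 0)
    (hx : ∀ τ ζ, HasDerivAt (fun ζ => U τ ζ) (P.β⁻¹ * Ux τ ζ) ζ)
    (hxx : ∀ τ ζ, HasDerivAt (fun ζ => Ux τ ζ) (P.β⁻¹ * Uxx τ ζ) ζ)
    (ht : ∀ τ ζ, HasDerivAt (fun τ => U τ ζ) (a⁻¹ * Us τ ζ) τ)
    (hxt : ∀ τ ζ, HasDerivAt (fun τ => Ux τ ζ) (a⁻¹ * Usx τ ζ) τ)
    (htx : ∀ τ ζ, HasDerivAt (fun ζ => Us τ ζ) (P.β⁻¹ * Usx τ ζ) ζ) (τ ζ : ℝ) :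
    P.fastLaw2 a U τ ζ
      = P.poly2 (U τ ζ) (Ux τ ζ) (Uxx τ ζ) (Us τ ζ) (Usx τ ζ) := by
  have e1 : ∀ τ ζ, P.β * dx U τ ζ = Ux τ ζ := fun τ ζ => by
    rw [dx, (hx τ ζ).deriv, mul_inv_cancel_left₀ hβ]
  have e2 : ∀ τ ζ, a * dt U τ ζ = Us τ ζ := fun τ ζ => by
    rw [dt, (ht τ ζ).deriv, mul_inv_cancel_left₀ ha]
  simp only [Params.fastLaw2, e1, e2]
  rw [dt, (P.hasDerivAt_q2 (ht τ ζ) (hxt τ ζ)).deriv, dx]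
  have h1 := (P.hasDerivAt_pp2 (hx τ ζ) (hxx τ ζ)).add
    (((hxx τ ζ).const_mul (2 * P.α ^ 2)).mul (htx τ ζ))
  have h2 : HasDerivAt (fun ζ => P.pp2 (U τ ζ) (Ux τ ζ) + 2 * P.α ^ 2 * Ux τ ζ * Us τ ζ) _ ζ := h1
  rw [h2.deriv]
  simp only [Params.poly2, Params.rate2, Params.k2]
  field_simp

end FastLaws

section SplitPoly

variable {P : Params} {c₁ c₂ : ℝ → ℝ} {K : ℝ} {U Ux Uxx Us Usx a₀ a₁ a₂ a₃ a₄ b₀ b₁ b₂ b₃ b₄ :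
  ℝ → ℝ → ℝ}

lemma Split.congr {f f' a a' b b' : ℝ → ℝ → ℝ} (h : Split c₁ c₂ f a b) (hf : ∀ τ ζ, f' τ ζ = f τ ζ)
    (ha : ∀ τ ζ, a' τ ζ = a τ ζ) (hb : ∀ τ ζ, b' τ ζ = b τ ζ) : Split c₁ c₂ f' a' b' := by
  have e1 : f' = f := funext fun τ => funext fun ζ => hf τ ζ
  have e2 : a' = a := funext fun τ => funext fun ζ => ha τ ζ
  have e3 : b' = b := funext fun τ => funext fun ζ => hb τ ζ
  rwa [e1, e2, e3]

lemma Split.p1 (h : Separating c₁ c₂ K) (h0 : Split c₁ c₂ U a₀ b₀)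
    (h1 : Split c₁ c₂ Ux a₁ b₁) :
    Split c₁ c₂ (fun τ ζ => P.p1 (U τ ζ) (Ux τ ζ))
      (fun τ ζ => P.p1 (a₀ τ ζ) (a₁ τ ζ)) (fun τ ζ => P.p1 (b₀ τ ζ) (b₁ τ ζ)) :=
  (((h0.const_mul P.c0).add ((h0.mul h h0).const_mul P.c1)).add
    ((h1.mul h h1).const_mul (-(P.c2 - P.c3)))).congr
    (fun τ ζ => by unfold Params.p1; ring) (fun τ ζ => by unfold Params.p1; ring)
    (fun τ ζ => by unfold Params.p1; ring)

lemma Split.q2 (h : Separating c₁ c₂ K) (h0 : Split c₁ c₂ U a₀ b₀)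
    (h1 : Split c₁ c₂ Ux a₁ b₁) :
    Split c₁ c₂ (fun τ ζ => P.q2 (U τ ζ) (Ux τ ζ))
      (fun τ ζ => P.q2 (a₀ τ ζ) (a₁ τ ζ)) (fun τ ζ => P.q2 (b₀ τ ζ) (b₁ τ ζ)) :=
  ((h0.mul h h0).add ((h1.mul h h1).const_mul (P.α ^ 2))).congr
    (fun τ ζ => by unfold Params.q2; ring) (fun τ ζ => by unfold Params.q2; ring)
    (fun τ ζ => by unfold Params.q2; ring)

lemma Split.pp2 (h : Separating c₁ c₂ K) (h0 : Split c₁ c₂ U a₀ b₀)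
    (h1 : Split c₁ c₂ Ux a₁ b₁) :
    Split c₁ c₂ (fun τ ζ => P.pp2 (U τ ζ) (Ux τ ζ))
      (fun τ ζ => P.pp2 (a₀ τ ζ) (a₁ τ ζ)) (fun τ ζ => P.pp2 (b₀ τ ζ) (b₁ τ ζ)) :=
  (((((h0.mul h h0).const_mul P.c0).add ((h0.mul h (h0.mul h h0)).const_mul (4 / 3 * P.c1))).add
    ((h1.mul h h1).const_mul (-3 * P.γ))).add
    ((h0.mul h (h1.mul h h1)).const_mul (-(2 * P.c2 - 5 * P.c3)))).congr
    (fun τ ζ => by unfold Params.pp2; ring) (fun τ ζ => by unfold Params.pp2; ring)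
    (fun τ ζ => by unfold Params.pp2; ring)

lemma Split.k2 (h : Separating c₁ c₂ K) (h1 : Split c₁ c₂ Ux a₁ b₁) :
    Split c₁ c₂ (fun τ ζ => P.k2 (U τ ζ) (Ux τ ζ))
      (fun τ ζ => P.k2 (a₀ τ ζ) (a₁ τ ζ)) (fun τ ζ => P.k2 (b₀ τ ζ) (b₁ τ ζ)) :=
  ((h1.mul h (h1.mul h h1)).const_mul (2 * P.c2 - P.c3)).congr
    (fun τ ζ => by unfold Params.k2; ring) (fun τ ζ => by unfold Params.k2; ring)
    (fun τ ζ => by unfold Params.k2; ring)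

lemma Split.poly1 (h : Separating c₁ c₂ K) (h0 : Split c₁ c₂ U a₀ b₀)
    (h1 : Split c₁ c₂ Ux a₁ b₁)
    (h2 : Split c₁ c₂ Uxx a₂ b₂)
    (h3 : Split c₁ c₂ Us a₃ b₃) :
    Split c₁ c₂ (fun τ ζ => P.poly1 (U τ ζ) (Ux τ ζ) (Uxx τ ζ) (Us τ ζ))
      (fun τ ζ => P.poly1 (a₀ τ ζ) (a₁ τ ζ) (a₂ τ ζ) (a₃ τ ζ)) (fun τ ζ => P.poly1 (b₀ τ ζ) (b₁ τ ζ) (b₂ τ ζ) (b₃ τ ζ)) :=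
  (((h3.add (h1.const_mul P.c0)).add ((h0.mul h h1).const_mul (2 * P.c1))).add
    ((h1.mul h h2).const_mul (-2 * (P.c2 - P.c3)))).congr
    (fun τ ζ => by unfold Params.poly1; ring) (fun τ ζ => by unfold Params.poly1; ring)
    (fun τ ζ => by unfold Params.poly1; ring)

lemma Split.rate2 (h : Separating c₁ c₂ K) (h0 : Split c₁ c₂ U a₀ b₀)
    (h1 : Split c₁ c₂ Ux a₁ b₁)
    (h3 : Split c₁ c₂ Us a₃ b₃)
    (h4 : Split c₁ c₂ Usx a₄ b₄) :
    Split c₁ c₂ (fun τ ζ => P.rate2 (U τ ζ) (Ux τ ζ) (Us τ ζ) (Usx τ ζ))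
      (fun τ ζ => P.rate2 (a₀ τ ζ) (a₁ τ ζ) (a₃ τ ζ) (a₄ τ ζ)) (fun τ ζ => P.rate2 (b₀ τ ζ) (b₁ τ ζ) (b₃ τ ζ) (b₄ τ ζ)) :=
  (((h0.mul h h3).const_mul 2).add ((h1.mul h h4).const_mul (2 * P.α ^ 2))).congr
    (fun τ ζ => by unfold Params.rate2; ring) (fun τ ζ => by unfold Params.rate2; ring)
    (fun τ ζ => by unfold Params.rate2; ring)

lemma Split.poly2 (h : Separating c₁ c₂ K) (h0 : Split c₁ c₂ U a₀ b₀)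
    (h1 : Split c₁ c₂ Ux a₁ b₁)
    (h2 : Split c₁ c₂ Uxx a₂ b₂)
    (h3 : Split c₁ c₂ Us a₃ b₃)
    (h4 : Split c₁ c₂ Usx a₄ b₄) :
    Split c₁ c₂ (fun τ ζ => P.poly2 (U τ ζ) (Ux τ ζ) (Uxx τ ζ) (Us τ ζ) (Usx τ ζ))
      (fun τ ζ => P.poly2 (a₀ τ ζ) (a₁ τ ζ) (a₂ τ ζ) (a₃ τ ζ) (a₄ τ ζ)) (fun τ ζ => P.poly2 (b₀ τ ζ) (b₁ τ ζ) (b₂ τ ζ) (b₃ τ ζ) (b₄ τ ζ)) :=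
  (((h0.rate2 (P := P) h h1 h3 h4).add
    (((((((h0.mul h h1).const_mul (2 * P.c0)).add
    ((h0.mul h (h0.mul h h1)).const_mul (4 * P.c1))).add
    ((h1.mul h (h1.mul h h1)).const_mul (-(2 * P.c2 - 5 * P.c3)))).add
    ((h1.mul h h2).const_mul (-6 * P.γ))).add
    ((h0.mul h (h1.mul h h2)).const_mul (-2 * (2 * P.c2 - 5 * P.c3)))).add
    (((h2.mul h h3).add (h1.mul h h4)).const_mul (2 * P.α ^ 2)))).add
    ((h1.mul h (h1.mul h h1)).const_mul (2 * P.c2 - P.c3))).congr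
    (fun τ ζ => by unfold Params.poly2 Params.rate2; ring) (fun τ ζ => by unfold Params.poly2 Params.rate2; ring)
    (fun τ ζ => by unfold Params.poly2 Params.rate2; ring)

end SplitPoly

/-! ### The ansatz in the fast variables -/

/-- The standing assumptions on the two solitons and on the corrections. -/
structure Pair.Regular (D : Pair) (P : Params) (c : Corr) (φlim : Fin 2 → ℝ) : Prop where
  adm : P.Admissible
  sol : ∀ i, P.IsSoliton (D.A i) (D.V i) (D.w i)
  psi : 0 < D.psiDot P
  lim : c.HasLimits φlim

/-- The trajectory of the `i`-th wave in the fast variables. -/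
def Pair.center (D : Pair) (P : Params) (c : Corr) (i : Fin 2) (τ : ℝ) : ℝ := P.β * D.χ P c i τ

/-- `dGᵢ/dt`, up to the factor `ε`. -/
def Pair.ampRate (D : Pair) (P : Params) (c : Corr) (i : Fin 2) (τ : ℝ) : ℝ :=
  D.psiDot P * deriv (c.S i) τ

/-- `Gᵢ φ̇ᵢ` -/
def Pair.flow (D : Pair) (P : Params) (c : Corr) (i : Fin 2) (τ : ℝ) : ℝ :=
  D.G c i τ * D.phiDot P c i τ

/-- The ansatz `u` in the fast variables. -/
def Pair.fast (D : Pair) (P : Params) (c : Corr) (τ ζ : ℝ) : ℝ :=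
  waves (D.center P c) (D.G c) D.w τ ζ

/-- `εuₓ` in the fast variables. -/
def Pair.fastX (D : Pair) (P : Params) (c : Corr) (τ ζ : ℝ) : ℝ :=
  P.β * waves (D.center P c) (D.G c) (fun i => deriv (D.w i)) τ ζ

/-- `ε²uₓₓ` in the fast variables. -/
def Pair.fastXX (D : Pair) (P : Params) (c : Corr) (τ ζ : ℝ) : ℝ :=
  P.β ^ 2 * waves (D.center P c) (D.G c) (fun i => deriv (deriv (D.w i))) τ ζ

/-- `εuₜ` in the fast variables. -/
def Pair.fastT (D : Pair) (P : Params) (c : Corr) (τ ζ : ℝ) : ℝ :=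
  waves (D.center P c) (D.ampRate P c) D.w τ ζ
    - P.β * waves (D.center P c) (D.flow P c) (fun i => deriv (D.w i)) τ ζ

/-- `ε²uₓₜ` in the fast variables. -/
def Pair.fastXT (D : Pair) (P : Params) (c : Corr) (τ ζ : ℝ) : ℝ :=
  P.β * waves (D.center P c) (D.ampRate P c) (fun i => deriv (D.w i)) τ ζ
    - P.β ^ 2 * waves (D.center P c) (D.flow P c) (fun i => deriv (deriv (D.w i))) τ ζ

namespace Pair.Regular

variable {D : Pair} {P : Params} {c : Corr} {φlim : Fin 2 → ℝ}

lemma β_pos (h : D.Regular P c φlim) : 0 < P.β := P.β_pos h.adm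

lemma smooth_w (h : D.Regular P c φlim) (i : Fin 2) : ContDiff ℝ ∞ (D.w i) := (h.sol i).smooth

lemma smooth_w1 (h : D.Regular P c φlim) (i : Fin 2) : ContDiff ℝ ∞ (deriv (D.w i)) :=
  contDiff_deriv (h.smooth_w i)

lemma smooth_w2 (h : D.Regular P c φlim) (i : Fin 2) : ContDiff ℝ ∞ (deriv (deriv (D.w i))) :=
  contDiff_deriv (h.smooth_w1 i)

lemma smooth_G (h : D.Regular P c φlim) (i : Fin 2) : ContDiff ℝ ∞ (D.G c i) :=
  contDiff_const.add (h.lim.smooth_S i)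

lemma smooth_χ (h : D.Regular P c φlim) (i : Fin 2) : ContDiff ℝ ∞ (D.χ P c i) :=
  ((contDiff_const.mul contDiff_id).div_const _).add (h.lim.smooth_φ i)

lemma smooth_center (h : D.Regular P c φlim) (i : Fin 2) : ContDiff ℝ ∞ (D.center P c i) :=
  contDiff_const.mul (h.smooth_χ i)

lemma smooth_ampRate (h : D.Regular P c φlim) (i : Fin 2) : ContDiff ℝ ∞ (D.ampRate P c i) :=
  contDiff_const.mul (contDiff_deriv (h.lim.smooth_S i))

lemma smooth_flow (h : D.Regular P c φlim) (i : Fin 2) : ContDiff ℝ ∞ (D.flow P c i) :=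
  (h.smooth_G i).mul (contDiff_const.add (contDiff_const.mul (contDiff_deriv (h.lim.smooth_φ i))))

lemma hasDerivAt_G (h : D.Regular P c φlim) (i : Fin 2) (τ : ℝ) :
    HasDerivAt (D.G c i) ((D.psiDot P)⁻¹ * D.ampRate P c i τ) τ := by
  refine ((hasDerivAt_of_smooth (h.lim.smooth_S i) τ).const_add (D.A i)).congr_deriv ?_
  rw [Pair.ampRate, inv_mul_cancel_left₀ h.psi.ne']

lemma hasDerivAt_χ (h : D.Regular P c φlim) (i : Fin 2) (τ : ℝ) :
    HasDerivAt (D.χ P c i) ((D.psiDot P)⁻¹ * D.phiDot P c i τ) τ := by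
  refine ((((hasDerivAt_id τ).const_mul (D.V i)).div_const (D.psiDot P)).add
    (hasDerivAt_of_smooth (h.lim.smooth_φ i) τ)).congr_deriv ?_
  have := h.psi.ne'
  rw [Pair.phiDot]
  field_simp

lemma hasDerivAt_center (h : D.Regular P c φlim) (i : Fin 2) (τ : ℝ) :
    HasDerivAt (D.center P c i) (P.β * ((D.psiDot P)⁻¹ * D.phiDot P c i τ)) τ :=
  (h.hasDerivAt_χ i τ).const_mul P.β

lemma hasDerivAt_fast_x (h : D.Regular P c φlim) (τ ζ : ℝ) :
    HasDerivAt (fun ζ => D.fast P c τ ζ) (P.β⁻¹ * D.fastX P c τ ζ) ζ :=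
  (waves_dx h.smooth_w τ ζ).congr_deriv (by
    rw [Pair.fastX, inv_mul_cancel_left₀ h.β_pos.ne'])

lemma hasDerivAt_fastX_x (h : D.Regular P c φlim) (τ ζ : ℝ) :
    HasDerivAt (fun ζ => D.fastX P c τ ζ) (P.β⁻¹ * D.fastXX P c τ ζ) ζ :=
  ((waves_dx h.smooth_w1 τ ζ).const_mul P.β).congr_deriv (by
    rw [Pair.fastXX, pow_two, mul_assoc, inv_mul_cancel_left₀ h.β_pos.ne'])

lemma hasDerivAt_fastT_x (h : D.Regular P c φlim) (τ ζ : ℝ) :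
    HasDerivAt (fun ζ => D.fastT P c τ ζ) (P.β⁻¹ * D.fastXT P c τ ζ) ζ :=
  ((waves_dx h.smooth_w τ ζ).sub ((waves_dx h.smooth_w1 τ ζ).const_mul P.β)).congr_deriv (by
    have := h.β_pos.ne'
    rw [Pair.fastXT]
    field_simp)

lemma waves_dt' {w : Fin 2 → ℝ → ℝ} (h : D.Regular P c φlim) (hw : ∀ i, ContDiff ℝ ∞ (w i))
    (τ ζ : ℝ) :
    HasDerivAt (fun τ => waves (D.center P c) (D.G c) w τ ζ)
      ((D.psiDot P)⁻¹ * (waves (D.center P c) (D.ampRate P c) w τ ζ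
        - P.β * waves (D.center P c) (D.flow P c) (fun i => deriv (w i)) τ ζ)) τ := by
  refine (waves_dt hw h.smooth_center h.smooth_G τ ζ).congr_deriv ?_
  simp only [waves, (h.hasDerivAt_G _ τ).deriv, (h.hasDerivAt_center _ τ).deriv, Pair.flow]
  ring

lemma hasDerivAt_fast_t (h : D.Regular P c φlim) (τ ζ : ℝ) :
    HasDerivAt (fun τ => D.fast P c τ ζ) ((D.psiDot P)⁻¹ * D.fastT P c τ ζ) τ :=
  h.waves_dt' h.smooth_w τ ζ

lemma hasDerivAt_fastX_t (h : D.Regular P c φlim) (τ ζ : ℝ) :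
    HasDerivAt (fun τ => D.fastX P c τ ζ) ((D.psiDot P)⁻¹ * D.fastXT P c τ ζ) τ :=
  ((h.waves_dt' h.smooth_w1 τ ζ).const_mul P.β).congr_deriv (by rw [Pair.fastXT]; ring)

lemma fastLaw1_eq (h : D.Regular P c φlim) (τ ζ : ℝ) :
    P.fastLaw1 (D.psiDot P) (D.fast P c) τ ζ
      = P.poly1 (D.fast P c τ ζ) (D.fastX P c τ ζ) (D.fastXX P c τ ζ) (D.fastT P c τ ζ) :=
  Params.fastLaw1_eq h.β_pos.ne' h.psi.ne' h.hasDerivAt_fast_x h.hasDerivAt_fastX_x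
    h.hasDerivAt_fast_t τ ζ

lemma fastLaw2_eq (h : D.Regular P c φlim) (τ ζ : ℝ) :
    P.fastLaw2 (D.psiDot P) (D.fast P c) τ ζ
      = P.poly2 (D.fast P c τ ζ) (D.fastX P c τ ζ) (D.fastXX P c τ ζ) (D.fastT P c τ ζ)
          (D.fastXT P c τ ζ) :=
  Params.fastLaw2_eq h.β_pos.ne' h.psi.ne' h.hasDerivAt_fast_x h.hasDerivAt_fastX_x
    h.hasDerivAt_fast_t h.hasDerivAt_fastX_t h.hasDerivAt_fastT_x τ ζ

lemma contDiff_fast (h : D.Regular P c φlim) :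
    ContDiff ℝ ∞ (fun z : ℝ × ℝ => D.fast P c z.1 z.2) :=
  waves_contDiff h.smooth_w h.smooth_center h.smooth_G

lemma contDiff_fastX (h : D.Regular P c φlim) :
    ContDiff ℝ ∞ (fun z : ℝ × ℝ => D.fastX P c z.1 z.2) :=
  contDiff_const.mul (waves_contDiff h.smooth_w1 h.smooth_center h.smooth_G)

lemma contDiff_fastXX (h : D.Regular P c φlim) :
    ContDiff ℝ ∞ (fun z : ℝ × ℝ => D.fastXX P c z.1 z.2) :=
  contDiff_const.mul (waves_contDiff h.smooth_w2 h.smooth_center h.smooth_G)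

lemma contDiff_fastT (h : D.Regular P c φlim) :
    ContDiff ℝ ∞ (fun z : ℝ × ℝ => D.fastT P c z.1 z.2) :=
  (waves_contDiff h.smooth_w h.smooth_center h.smooth_ampRate).sub
    (contDiff_const.mul (waves_contDiff h.smooth_w1 h.smooth_center h.smooth_flow))

lemma contDiff_fastXT (h : D.Regular P c φlim) :
    ContDiff ℝ ∞ (fun z : ℝ × ℝ => D.fastXT P c z.1 z.2) :=
  (contDiff_const.mul (waves_contDiff h.smooth_w1 h.smooth_center h.smooth_ampRate)).sub
    (contDiff_const.mul (waves_contDiff h.smooth_w2 h.smooth_center h.smooth_flow))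

lemma contDiff_fastLaw1 (h : D.Regular P c φlim) :
    ContDiff ℝ ∞ (fun z : ℝ × ℝ => P.fastLaw1 (D.psiDot P) (D.fast P c) z.1 z.2) := by
  simp only [h.fastLaw1_eq, Params.poly1]
  have := h.contDiff_fast
  have := h.contDiff_fastX
  have := h.contDiff_fastXX
  have := h.contDiff_fastT
  fun_prop

lemma contDiff_fastLaw2 (h : D.Regular P c φlim) :
    ContDiff ℝ ∞ (fun z : ℝ × ℝ => P.fastLaw2 (D.psiDot P) (D.fast P c) z.1 z.2) := by
  simp only [h.fastLaw2_eq, Params.poly2, Params.rate2]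
  have := h.contDiff_fast
  have := h.contDiff_fastX
  have := h.contDiff_fastXX
  have := h.contDiff_fastT
  have := h.contDiff_fastXT
  fun_prop

/-! ### Separation of the trajectories -/

lemma bounded_φ (h : D.Regular P c φlim) (i : Fin 2) : ∃ B, 0 ≤ B ∧ ∀ τ, |c.φ i τ| ≤ B := by
  obtain ⟨C, hC⟩ := rapid_limit_bot (h.lim.smooth_φ i) (h.lim.rapid_φ i) (h.lim.φ_bot i) one_ne_zero
  obtain ⟨E, hE⟩ := rapid_limit_top (h.lim.smooth_φ i) (h.lim.rapid_φ i) (h.lim.φ_top i) one_ne_zero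
  have key : ∀ {x C τ : ℝ}, |x| * (1 + |τ|) ^ 1 ≤ C → |x| ≤ C := fun {x C τ} hx =>
    (le_mul_of_one_le_right (abs_nonneg _) (one_le_pow₀ (by linarith [abs_nonneg τ]))).trans hx
  have hC0 : 0 ≤ C := (by positivity : (0 : ℝ) ≤ _).trans (hC 0 le_rfl)
  have hE0 : 0 ≤ E := (by positivity : (0 : ℝ) ≤ _).trans (hE 0 le_rfl)
  have hL := abs_nonneg (φlim i)
  refine ⟨C + E + |φlim i|, by positivity, fun τ => ?_⟩
  rcases le_total τ 0 with hτ | hτ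
  · have := key (hC τ hτ)
    rw [sub_zero] at this
    linarith
  · have h1 := key (hE τ hτ)
    have h2 := abs_add_le (c.φ i τ - φlim i) (φlim i)
    rw [sub_add_cancel] at h2
    linarith

/-- The factor ψ̇₀ in the fast time normalizes the relative speed to one. -/
lemma center_sub (h : D.Regular P c φlim) (τ : ℝ) :
    D.center P c 0 τ - D.center P c 1 τ = -τ + P.β * (c.φ 0 τ - c.φ 1 τ) := by
  have h1 := h.psi.ne'
  have h2 : D.center P c 0 τ - D.center P c 1 τ
      = -(D.psiDot P * τ / D.psiDot P) + P.β * (c.φ 0 τ - c.φ 1 τ) := by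
    simp only [Pair.center, Pair.χ, Pair.psiDot]; ring
  rw [h2, mul_div_assoc, mul_div_cancel₀ τ h1]

lemma separating (h : D.Regular P c φlim) :
    ∃ K, Separating (D.center P c 0) (D.center P c 1) K := by
  obtain ⟨B, hB0, hB⟩ := h.bounded_φ 0
  obtain ⟨E, hE0, hE⟩ := h.bounded_φ 1
  have hβ := h.β_pos
  have hc : ∀ i F, 0 ≤ F → (∀ τ, |c.φ i τ| ≤ F) → ∀ τ, 1 + |D.center P c i τ|
      ≤ (1 + P.β * (|D.V i / D.psiDot P| + F)) * (1 + |τ|) := by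
    intro i F hF0 hF τ
    have h1 : |D.center P c i τ| ≤ P.β * (|D.V i / D.psiDot P| * |τ| + F) := by
      rw [Pair.center, abs_mul, abs_of_pos hβ, Pair.χ, ← abs_mul]
      gcongr
      refine (abs_add_le _ _).trans (add_le_add (le_of_eq ?_) (hF τ))
      rw [div_mul_eq_mul_div]
    have h2 : 0 ≤ P.β * F * |τ| := by positivity
    have h3 : 0 ≤ P.β * |D.V i / D.psiDot P| := by positivity
    nlinarith [abs_nonneg τ]
  refine ⟨(1 + P.β * (|D.V 0 / D.psiDot P| + B)) + (1 + P.β * (|D.V 1 / D.psiDot P| + E))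
    + (1 + P.β * (B + E)), by positivity, fun τ => ?_, fun τ => ?_, fun τ => ?_⟩
  · refine (hc 0 B hB0 hB τ).trans (mul_le_mul_of_nonneg_right ?_ (by positivity))
    have : 0 ≤ (1 + P.β * (|D.V 1 / D.psiDot P| + E)) + (1 + P.β * (B + E)) := by positivity
    linarith
  · refine (hc 1 E hE0 hE τ).trans (mul_le_mul_of_nonneg_right ?_ (by positivity))
    have : 0 ≤ (1 + P.β * (|D.V 0 / D.psiDot P| + B)) + (1 + P.β * (B + E)) := by positivity
    linarith
  · have h1 : |τ| ≤ |D.center P c 0 τ - D.center P c 1 τ| + P.β * (B + E) := by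
      have h2 : τ = -(D.center P c 0 τ - D.center P c 1 τ) + P.β * (c.φ 0 τ - c.φ 1 τ) := by
        rw [h.center_sub]; ring
      have h3 : |τ| ≤ |-(D.center P c 0 τ - D.center P c 1 τ)| + |P.β * (c.φ 0 τ - c.φ 1 τ)| := by
        conv_lhs => rw [h2]
        exact abs_add_le _ _
      rw [abs_neg, abs_mul, abs_of_pos hβ] at h3
      have h4 : |c.φ 0 τ - c.φ 1 τ| ≤ B + E := (abs_sub _ _).trans (add_le_add (hB τ) (hE τ))
      have := mul_le_mul_of_nonneg_left h4 hβ.le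
      linarith
    have h5 : 1 + |τ| ≤ (1 + P.β * (B + E)) * (1 + |D.center P c 0 τ - D.center P c 1 τ|) := by
      have := mul_nonneg (by positivity : 0 ≤ P.β * (B + E))
        (abs_nonneg (D.center P c 0 τ - D.center P c 1 τ))
      nlinarith
    refine h5.trans (mul_le_mul_of_nonneg_right ?_ (by positivity))
    have : 0 ≤ (1 + P.β * (|D.V 0 / D.psiDot P| + B)) + (1 + P.β * (|D.V 1 / D.psiDot P| + E)) := by
      positivity
    linarith

/-! ### Splitting of the ansatz -/

lemma tends_G (h : D.Regular P c φlim) (i : Fin 2) : TendsRapidly (D.G c i) (D.A i) := by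
  have := (TendsRapidly.const (D.A i)).add (TendsRapidly.of_limits (h.lim.smooth_S i)
    (h.lim.rapid_S i) (h.lim.S_bot i) (h.lim.S_top i))
  rwa [add_zero] at this

lemma tends_ampRate (h : D.Regular P c φlim) (i : Fin 2) : TendsRapidly (D.ampRate P c i) 0 := by
  have := (h.lim.rapid_S i).tendsRapidly.const_mul (D.psiDot P)
  rwa [mul_zero] at this

lemma tends_flow (h : D.Regular P c φlim) (i : Fin 2) :
    TendsRapidly (D.flow P c i) (D.A i * D.V i) := by
  have := (h.tends_G i).mul ((TendsRapidly.const (D.V i)).add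
    ((h.lim.rapid_φ i).tendsRapidly.const_mul (D.psiDot P)))
  rwa [mul_zero, add_zero] at this

lemma split_fast (h : D.Regular P c φlim) :
    Split (D.center P c 0) (D.center P c 1) (D.fast P c)
      (fun τ ζ => D.A 0 * D.w 0 (ζ - D.center P c 0 τ))
      (fun τ ζ => D.A 1 * D.w 1 (ζ - D.center P c 1 τ)) := by
  obtain ⟨K, hK⟩ := h.separating
  exact Split.of_waves hK (h.sol 0).decays (h.sol 1).decays (h.tends_G 0) (h.tends_G 1)

lemma split_fastX (h : D.Regular P c φlim) :
    Split (D.center P c 0) (D.center P c 1) (D.fastX P c)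
      (fun τ ζ => P.β * (D.A 0 * deriv (D.w 0) (ζ - D.center P c 0 τ)))
      (fun τ ζ => P.β * (D.A 1 * deriv (D.w 1) (ζ - D.center P c 1 τ))) := by
  obtain ⟨K, hK⟩ := h.separating
  exact (Split.of_waves hK (h.sol 0).decays_deriv (h.sol 1).decays_deriv (h.tends_G 0)
    (h.tends_G 1)).const_mul P.β

lemma split_fastXX (h : D.Regular P c φlim) :
    Split (D.center P c 0) (D.center P c 1) (D.fastXX P c)
      (fun τ ζ => P.β ^ 2 * (D.A 0 * deriv (deriv (D.w 0)) (ζ - D.center P c 0 τ)))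
      (fun τ ζ => P.β ^ 2 * (D.A 1 * deriv (deriv (D.w 1)) (ζ - D.center P c 1 τ))) := by
  obtain ⟨K, hK⟩ := h.separating
  exact (Split.of_waves hK (h.sol 0).decays_deriv2 (h.sol 1).decays_deriv2 (h.tends_G 0)
    (h.tends_G 1)).const_mul (P.β ^ 2)

/-- The amplitude rates die out and Gφ̇ tends to AV, so only steady transport remains in the free
parts. -/
lemma split_fastT (h : D.Regular P c φlim) :
    Split (D.center P c 0) (D.center P c 1) (D.fastT P c)
      (fun τ ζ => -D.V 0 * (P.β * (D.A 0 * deriv (D.w 0) (ζ - D.center P c 0 τ))))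
      (fun τ ζ => -D.V 1 * (P.β * (D.A 1 * deriv (D.w 1) (ζ - D.center P c 1 τ)))) := by
  obtain ⟨K, hK⟩ := h.separating
  exact ((Split.of_waves hK (h.sol 0).decays (h.sol 1).decays (h.tends_ampRate 0)
    (h.tends_ampRate 1)).add ((Split.of_waves hK (h.sol 0).decays_deriv (h.sol 1).decays_deriv
    (h.tends_flow 0) (h.tends_flow 1)).const_mul (-P.β))).congr
    (fun τ ζ => by simp only [Pair.fastT, waves]; ring) (fun τ ζ => by ring) (fun τ ζ => by ring)

lemma split_fastXT (h : D.Regular P c φlim) :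
    Split (D.center P c 0) (D.center P c 1) (D.fastXT P c)
      (fun τ ζ => -D.V 0 * (P.β ^ 2 * (D.A 0 * deriv (deriv (D.w 0)) (ζ - D.center P c 0 τ))))
      (fun τ ζ => -D.V 1 * (P.β ^ 2 * (D.A 1 * deriv (deriv (D.w 1)) (ζ - D.center P c 1 τ)))) := by
  obtain ⟨K, hK⟩ := h.separating
  exact (((Split.of_waves hK (h.sol 0).decays_deriv (h.sol 1).decays_deriv (h.tends_ampRate 0)
    (h.tends_ampRate 1)).const_mul P.β).add ((Split.of_waves hK (h.sol 0).decays_deriv2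
    (h.sol 1).decays_deriv2 (h.tends_flow 0) (h.tends_flow 1)).const_mul (-P.β ^ 2))).congr
    (fun τ ζ => by simp only [Pair.fastXT, waves]; ring) (fun τ ζ => by ring) (fun τ ζ => by ring)

end Pair.Regular

/-! ### Moments of a single soliton -/

lemma moments_of_hasDerivAt {F F' : ℝ → ℝ} (hd : ∀ x, HasDerivAt F (F' x) x) (h0 : Integrable F)
    (h1 : Integrable fun x => x * F x) (h0' : Integrable F') (h1' : Integrable fun x => x * F' x) :
    ∫ x, F' x = 0 ∧ ∫ x, x * F' x = -∫ x, F x := by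
  refine ⟨integral_eq_zero_of_hasDerivAt_of_integrable hd h0' h0, ?_⟩
  have h := integral_eq_zero_of_hasDerivAt_of_integrable
    (fun x => ((hasDerivAt_id x).mul (hd x)).congr_deriv (by simp only [id, one_mul]; rfl))
    (h0.add h1') h1
  rw [integral_add' h0 h1'] at h
  linarith

lemma Localized.decays {c : ℝ → ℝ} {l : ℝ → ℝ} (h : Localized c (fun τ ζ => l (ζ - c τ))) :
    Decays l := by
  obtain ⟨C, hC⟩ := h
  exact ⟨C, fun y => by simpa using hC 0 (y + c 0)⟩

/-- The conservation law on a single soliton. -/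
def Params.single1 (P : Params) (A V : ℝ) (w : ℝ → ℝ) (y : ℝ) : ℝ :=
  P.poly1 (A * w y) (P.β * (A * deriv w y)) (P.β ^ 2 * (A * deriv (deriv w) y))
    (-V * (P.β * (A * deriv w y)))

/-- The balance law on a single soliton. -/
def Params.single2 (P : Params) (A V : ℝ) (w : ℝ → ℝ) (y : ℝ) : ℝ :=
  P.poly2 (A * w y) (P.β * (A * deriv w y)) (P.β ^ 2 * (A * deriv (deriv w) y))
    (-V * (P.β * (A * deriv w y))) (-V * (P.β ^ 2 * (A * deriv (deriv w) y)))

section Single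

variable {P : Params} {A V : ℝ} {w : ℝ → ℝ}

lemma Params.IsSoliton.continuous1 (h : P.IsSoliton A V w) : Continuous (P.single1 A V w) := by
  have := h.smooth.continuous
  have := (contDiff_deriv h.smooth).continuous
  have := (contDiff_deriv (contDiff_deriv h.smooth)).continuous
  unfold Params.single1 Params.poly1
  fun_prop

lemma Params.IsSoliton.continuous2 (h : P.IsSoliton A V w) : Continuous (P.single2 A V w) := by
  have := h.smooth.continuous
  have := (contDiff_deriv h.smooth).continuous
  have := (contDiff_deriv (contDiff_deriv h.smooth)).continuous
  unfold Params.single2 Params.poly2 Params.rate2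
  fun_prop

lemma Params.IsSoliton.odd_deriv (h : P.IsSoliton A V w) (η : ℝ) : deriv w (-η) = -deriv w η :=
  deriv_odd_of_even h.even η

lemma Params.IsSoliton.k2_integral (h : P.IsSoliton A V w) :
    ∫ η, P.k2 (A * w η) (P.β * (A * deriv w η)) = 0 :=
  integral_eq_zero_of_odd fun η => by
    rw [h.odd_deriv]; unfold Params.k2; ring

lemma Params.IsSoliton.q2_first_moment (h : P.IsSoliton A V w) :
    ∫ η, η * P.q2 (A * w η) (P.β * (A * deriv w η)) = 0 :=
  integral_eq_zero_of_odd fun η => by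
    rw [h.odd_deriv, h.even]; unfold Params.q2; ring

lemma Params.IsSoliton.first_moment (h : P.IsSoliton A V w) : ∫ η, η * w η = 0 :=
  integral_eq_zero_of_odd fun η => by rw [h.even]; ring

lemma Params.IsSoliton.deriv_moments (h : P.IsSoliton A V w) :
    ∫ η, deriv w η = 0 ∧ ∫ η, η * deriv w η = -∫ η, w η := by
  have c0 := h.smooth.continuous
  have c1 := (contDiff_deriv h.smooth).continuous
  exact moments_of_hasDerivAt (hasDerivAt_of_smooth h.smooth) (h.decays.integrable c0)
    (h.decays.integrable_mul c0) (h.decays_deriv.integrable c1) (h.decays_deriv.integrable_mul c1)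

/-- The law on a soliton is the derivative of β(P₁ − VAw). Its first moment is minus the integral of
this primitive, zero by `p1_moment`. -/
lemma Params.IsSoliton.moments1 (h : P.IsSoliton A V w) (hd : Decays (P.single1 A V w)) :
    ∫ η, P.single1 A V w η = 0 ∧ ∫ η, η * P.single1 A V w η = 0 := by
  have c0 := h.smooth.continuous
  have c1 := (contDiff_deriv h.smooth).continuous
  have d0 := h.decays.const_mul A
  have d1 := (h.decays_deriv.const_mul A).const_mul P.β
  have hF : ∀ x, HasDerivAt (fun η => P.β * (P.p1 (A * w η) (P.β * (A * deriv w η)) - V * A * w η))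
      (P.single1 A V w x) x := fun x => by
    refine (((P.hasDerivAt_p1 ((hasDerivAt_of_smooth h.smooth x).const_mul A)
      (((hasDerivAt_of_smooth (contDiff_deriv h.smooth) x).const_mul A).const_mul P.β)).sub
      ((hasDerivAt_of_smooth h.smooth x).const_mul (V * A))).const_mul P.β).congr_deriv ?_
    unfold Params.single1 Params.poly1
    ring
  have kF : Continuous (fun η => P.β * (P.p1 (A * w η) (P.β * (A * deriv w η)) - V * A * w η)) :=
    continuous_iff_continuousAt.2 fun x => (hF x).continuousAt
  have dF := ((d0.p1 P d1).sub (h.decays.const_mul (V * A))).const_mul P.β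
  have i1 : Integrable (fun η => P.p1 (A * w η) (P.β * (A * deriv w η))) :=
    (d0.p1 P d1).integrable (P.continuous_p1.comp (by fun_prop :
      Continuous fun η => (A * w η, P.β * (A * deriv w η))))
  have := moments_of_hasDerivAt hF (dF.integrable kF) (dF.integrable_mul kF)
    (hd.integrable h.continuous1) (hd.integrable_mul h.continuous1)
  refine ⟨this.1, this.2.trans ?_⟩
  rw [integral_const_mul, integral_sub i1 ((h.decays.integrable c0).const_mul _),
    integral_const_mul, h.p1_moment]
  ring

/-- Only the law minus K₂ is an exact derivative. The integral of K₂ vanishes by oddness; its first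
moment does not cancel alone and is the last term of `p2_moment`. -/
lemma Params.IsSoliton.moments2 (h : P.IsSoliton A V w) (hβ : P.β ≠ 0)
    (hd : Decays (P.single2 A V w)) :
    ∫ η, P.single2 A V w η = 0 ∧ ∫ η, η * P.single2 A V w η = 0 := by
  have c0 := h.smooth.continuous
  have c1 := (contDiff_deriv h.smooth).continuous
  have d0 := h.decays.const_mul A
  have d1 := (h.decays_deriv.const_mul A).const_mul P.β
  have cz : Continuous fun η => (A * w η, P.β * (A * deriv w η)) := by fun_prop
  have kk : Continuous (fun η => P.k2 (A * w η) (P.β * (A * deriv w η))) := P.continuous_k2.comp cz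
  have dk : Decays (fun η => P.k2 (A * w η) (P.β * (A * deriv w η))) := d1.k2 P
  have dd := hd.sub dk
  have kd := h.continuous2.sub kk
  have hF : ∀ x, HasDerivAt (fun η => P.β * (P.pp2 (A * w η) (P.β * (A * deriv w η))
        - V * P.q2 (A * w η) (P.β * (A * deriv w η))
        - 2 * P.α ^ 2 * P.β ^ 2 * A ^ 2 * V * deriv w η ^ 2))
      (P.single2 A V w x - P.k2 (A * w x) (P.β * (A * deriv w x))) x := fun x => by
    have e0 := (hasDerivAt_of_smooth h.smooth x).const_mul A
    have e1 := hasDerivAt_of_smooth (contDiff_deriv h.smooth) x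
    have e2 := (e1.const_mul A).const_mul P.β
    refine ((((P.hasDerivAt_pp2 e0 e2).sub ((P.hasDerivAt_q2 e0 e2).const_mul V)).sub
      ((e1.pow 2).const_mul (2 * P.α ^ 2 * P.β ^ 2 * A ^ 2 * V))).const_mul P.β).congr_deriv ?_
    unfold Params.single2 Params.poly2 Params.rate2 Params.k2
    push_cast
    ring
  have kF := continuous_iff_continuousAt.2 fun x => (hF x).continuousAt
  have dF := (((d0.pp2 P d1).sub ((d0.q2 P d1).const_mul V)).sub
    ((h.decays_deriv.pow 2 two_ne_zero).const_mul (2 * P.α ^ 2 * P.β ^ 2 * A ^ 2 * V))).const_mul P.β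
  have m := moments_of_hasDerivAt hF (dF.integrable kF) (dF.integrable_mul kF)
    (dd.integrable kd) (dd.integrable_mul kd)
  have is := hd.integrable h.continuous2
  have is1 := hd.integrable_mul h.continuous2
  have ik := dk.integrable kk
  have ik1 := dk.integrable_mul kk
  have ip : Integrable (fun η => P.pp2 (A * w η) (P.β * (A * deriv w η))) :=
    (d0.pp2 P d1).integrable (P.continuous_pp2.comp cz)
  have iq : Integrable (fun η => V * P.q2 (A * w η) (P.β * (A * deriv w η))) :=
    ((d0.q2 P d1).integrable (P.continuous_q2.comp cz)).const_mul V
  have iw : Integrable (fun η => 2 * P.α ^ 2 * P.β ^ 2 * A ^ 2 * V * deriv w η ^ 2) :=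
    ((h.decays_deriv.pow 2 two_ne_zero).integrable (by fun_prop)).const_mul _
  have ipq : Integrable (fun η => P.pp2 (A * w η) (P.β * (A * deriv w η))
      - V * P.q2 (A * w η) (P.β * (A * deriv w η))) := ip.sub iq
  obtain ⟨m0, m1⟩ := m
  rw [integral_sub is ik, h.k2_integral, sub_zero] at m0
  refine ⟨m0, ?_⟩
  simp only [mul_sub _ (P.single2 A V w _)] at m1
  rw [integral_sub is1 ik1, integral_const_mul, integral_sub ipq iw, integral_sub ip iq,
    integral_const_mul, integral_const_mul] at m1
  have e := h.p2_moment
  have e3 : P.β * (P.β⁻¹ * ∫ η, η * P.k2 (A * w η) (P.β * (A * deriv w η)))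
      = ∫ η, η * P.k2 (A * w η) (P.β * (A * deriv w η)) := mul_inv_cancel_left₀ hβ _
  linear_combination m1 + P.β * e - e3

end Single

/-! ### Differentiation of moments -/

lemma hasDerivAt_moment {f f' : ℝ → ℝ → ℝ} (hd : ∀ τ ζ, HasDerivAt (fun τ => f τ ζ) (f' τ ζ) τ)
    (hc : ∀ τ, Continuous (f τ)) (hc' : ∀ τ, Continuous (f' τ))
    (hf : ∃ C, ∀ τ ζ, |f τ ζ| * (1 + |ζ|) ^ 4 ≤ C * (1 + |τ|) ^ 4)
    (hf' : ∃ C, ∀ τ ζ, |f' τ ζ| * (1 + |ζ|) ^ 4 ≤ C * (1 + |τ|) ^ 4) {n : ℕ} (hn : n ≤ 2) (τ : ℝ) :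
    HasDerivAt (fun τ => ∫ ζ, ζ ^ n * f τ ζ) (∫ ζ, ζ ^ n * f' τ ζ) τ := by
  obtain ⟨C, hC⟩ := hf
  obtain ⟨C', hC'⟩ := hf'
  have hC0 : 0 ≤ C' := by simpa using (by positivity : (0 : ℝ) ≤ _).trans (hC' 0 0)
  refine (hasDerivAt_integral_of_dominated_loc_of_deriv_le
    (F := fun τ ζ => ζ ^ n * f τ ζ) (F' := fun τ ζ => ζ ^ n * f' τ ζ)
    -- On the unit ball about τ one has 1 + |t| ≤ 2 + |τ|.
    (bound := fun ζ => C' * (2 + |τ|) ^ 4 * (1 + ζ ^ 2)⁻¹)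
    (Metric.ball_mem_nhds τ one_pos) (Eventually.of_forall fun τ => ?_) ?_ ?_
    (ae_of_all _ fun ζ t ht => ?_) (integrable_inv_one_add_sq.const_mul _)
    (ae_of_all _ fun ζ t _ => (hd t ζ).const_mul _)).2
  · have := hc τ
    exact Continuous.aestronglyMeasurable (by fun_prop)
  · exact (Interaction.integral_le (f := fun _ => f τ) ⟨_, fun _ ζ => hC τ ζ⟩ fun _ => hc τ).1 0 n hn
  · have := hc' τ
    exact Continuous.aestronglyMeasurable (by fun_prop)
  · have h1 : |t| ≤ 1 + |τ| := by
      rw [Metric.mem_ball, Real.dist_eq] at ht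
      have := abs_add_le (t - τ) τ
      rw [sub_add_cancel] at this
      linarith
    rw [← div_eq_mul_inv, le_div_iff₀ (by positivity), Real.norm_eq_abs, abs_mul, abs_pow]
    have h0 := abs_nonneg ζ
    have h2 : |ζ| ^ n ≤ (1 + |ζ|) ^ 2 :=
      (pow_le_pow_left₀ h0 (by linarith) n).trans (pow_le_pow_right₀ (by linarith) hn)
    have h3 : 1 + ζ ^ 2 ≤ (1 + |ζ|) ^ 2 := by rw [← sq_abs]; nlinarith
    calc |ζ| ^ n * |f' t ζ| * (1 + ζ ^ 2) ≤ (1 + |ζ|) ^ 2 * |f' t ζ| * (1 + |ζ|) ^ 2 := by gcongr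
      _ = |f' t ζ| * (1 + |ζ|) ^ 4 := by ring
      _ ≤ C' * (1 + |t|) ^ 4 := hC' t ζ
      _ ≤ C' * (2 + |τ|) ^ 4 :=
        mul_le_mul_of_nonneg_left (pow_le_pow_left₀ (by positivity) (by linarith) 4) hC0

/-! ### Moments of the ansatz -/

/-- First moment of a density on the `i`-th free soliton. -/
def Pair.firstMoment (D : Pair) (P : Params) (F : ℝ → ℝ → ℝ) (i : Fin 2) : ℝ :=
  ∫ η, η * F (D.A i * D.w i η) (P.β * (D.A i * deriv (D.w i) η))

namespace Pair.Regular

variable {D : Pair} {P : Params} {c : Corr} {φlim : Fin 2 → ℝ}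

lemma continuous_fast (h : D.Regular P c φlim) (τ : ℝ) : Continuous (D.fast P c τ) :=
  h.contDiff_fast.continuous.comp (by fun_prop : Continuous fun ζ : ℝ => (τ, ζ))

lemma continuous_fastX (h : D.Regular P c φlim) (τ : ℝ) : Continuous (D.fastX P c τ) :=
  h.contDiff_fastX.continuous.comp (by fun_prop : Continuous fun ζ : ℝ => (τ, ζ))

lemma continuous_fastT (h : D.Regular P c φlim) (τ : ℝ) : Continuous (D.fastT P c τ) :=
  h.contDiff_fastT.continuous.comp (by fun_prop : Continuous fun ζ : ℝ => (τ, ζ))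

lemma continuous_fastXT (h : D.Regular P c φlim) (τ : ℝ) : Continuous (D.fastXT P c τ) :=
  h.contDiff_fastXT.continuous.comp (by fun_prop : Continuous fun ζ : ℝ => (τ, ζ))

lemma integrable_split (h : D.Regular P c φlim) {f a b : ℝ → ℝ → ℝ}
    (hf : Split (D.center P c 0) (D.center P c 1) f a b) {τ : ℝ} (hc : Continuous (f τ)) :
    Integrable (f τ) ∧ Integrable fun ζ => ζ * f τ ζ := by
  obtain ⟨K, hK⟩ := h.separating
  obtain ⟨C, hC⟩ := hf.growth hK
  have := fun n hn => (Interaction.integral_le (f := fun _ => f τ) ⟨_, fun _ ζ => hC τ ζ⟩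
    fun _ => hc).1 0 n hn
  exact ⟨by simpa using this 0 (by norm_num), by simpa using this 1 (by norm_num)⟩

lemma integral_waves {ctr g w : Fin 2 → ℝ → ℝ} (hd : ∀ i, Decays (w i))
    (hc : ∀ i, Continuous (w i)) (τ : ℝ) :
    ∫ ζ, waves ctr g w τ ζ = ∑ i, g i τ * ∫ η, w i η := by
  have e : ∀ i, ∫ ζ, w i (ζ - ctr i τ) = ∫ η, w i η := fun i =>
    integral_sub_right_eq_self (μ := (volume : Measure ℝ)) (w i) (ctr i τ)
  have i0 : ∀ i, Integrable (fun ζ => g i τ * w i (ζ - ctr i τ)) := fun i =>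
    (((hd i).comp_sub _).integrable (by have := hc i; fun_prop)).const_mul _
  simp only [waves]
  rw [integral_add (i0 0) (i0 1), integral_const_mul, integral_const_mul, e, e,
    Fin.sum_univ_two]

lemma integral_mul_waves {ctr g w : Fin 2 → ℝ → ℝ} (hd : ∀ i, Decays (w i))
    (hc : ∀ i, Continuous (w i)) (τ : ℝ) :
    ∫ ζ, ζ * waves ctr g w τ ζ
      = ∑ i, g i τ * ((∫ η, η * w i η) + ctr i τ * ∫ η, w i η) := by
  have i0 : ∀ i, Integrable (fun ζ => g i τ * (ζ * w i (ζ - ctr i τ))) := fun i =>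
    (((hd i).comp_sub _).integrable_mul (by have := hc i; fun_prop)).const_mul _
  have e : ∀ ζ, ζ * waves ctr g w τ ζ
      = g 0 τ * (ζ * w 0 (ζ - ctr 0 τ)) + g 1 τ * (ζ * w 1 (ζ - ctr 1 τ)) := fun ζ => by
    simp only [waves]; ring
  simp only [e]
  rw [integral_add (i0 0) (i0 1), integral_const_mul, integral_const_mul,
    integral_moment_shift (hd 0) (hc 0), integral_moment_shift (hd 1) (hc 1), Fin.sum_univ_two]

lemma integral_fastT (h : D.Regular P c φlim) (τ : ℝ) :
    ∫ ζ, D.fastT P c τ ζ = ∑ i, D.ampRate P c i τ * D.a1 i := by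
  have k0 := fun i => (h.smooth_w i).continuous
  have k1 := fun i => (h.smooth_w1 i).continuous
  have c0 : Continuous (waves (D.center P c) (D.ampRate P c) D.w τ) := by
    have := k0 0; have := k0 1
    unfold waves; fun_prop
  have c1 : Continuous (waves (D.center P c) (D.flow P c) (fun i => deriv (D.w i)) τ) := by
    have := k1 0; have := k1 1
    unfold waves; fun_prop
  obtain ⟨K, hK⟩ := h.separating
  have i0 : Integrable (fun ζ => waves (D.center P c) (D.ampRate P c) D.w τ ζ) :=
    (h.integrable_split (Split.of_waves hK (h.sol 0).decays (h.sol 1).decays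
      (h.tends_ampRate 0) (h.tends_ampRate 1)) c0).1
  have i1 : Integrable
      (fun ζ => waves (D.center P c) (D.flow P c) (fun i => deriv (D.w i)) τ ζ) :=
    (h.integrable_split (Split.of_waves hK (h.sol 0).decays_deriv (h.sol 1).decays_deriv
      (h.tends_flow 0) (h.tends_flow 1)) c1).1
  have e0 := integral_waves (ctr := D.center P c) (g := D.ampRate P c)
    (fun i => (h.sol i).decays) k0 τ
  have e1 := integral_waves (ctr := D.center P c) (g := D.flow P c)
    (fun i => (h.sol i).decays_deriv) k1 τ
  simp only [Pair.fastT]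
  rw [integral_sub i0 (i1.const_mul _), integral_const_mul, e0, e1]
  simp [(h.sol _).deriv_moments.1, Pair.a1]

lemma integral_mul_fastT (h : D.Regular P c φlim) (τ : ℝ) :
    ∫ ζ, ζ * D.fastT P c τ ζ
      = ∑ i, (D.ampRate P c i τ * D.center P c i τ + P.β * D.flow P c i τ) * D.a1 i := by
  have k0 := fun i => (h.smooth_w i).continuous
  have k1 := fun i => (h.smooth_w1 i).continuous
  have c0 : Continuous (waves (D.center P c) (D.ampRate P c) D.w τ) := by
    have := k0 0; have := k0 1
    unfold waves; fun_prop
  have c1 : Continuous (waves (D.center P c) (D.flow P c) (fun i => deriv (D.w i)) τ) := by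
    have := k1 0; have := k1 1
    unfold waves; fun_prop
  obtain ⟨K, hK⟩ := h.separating
  have i0 : Integrable (fun ζ => ζ * waves (D.center P c) (D.ampRate P c) D.w τ ζ) :=
    (h.integrable_split (Split.of_waves hK (h.sol 0).decays (h.sol 1).decays
      (h.tends_ampRate 0) (h.tends_ampRate 1)) c0).2
  have i1 : Integrable
      (fun ζ => ζ * waves (D.center P c) (D.flow P c) (fun i => deriv (D.w i)) τ ζ) :=
    (h.integrable_split (Split.of_waves hK (h.sol 0).decays_deriv (h.sol 1).decays_deriv
      (h.tends_flow 0) (h.tends_flow 1)) c1).2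
  have e0 := integral_mul_waves (ctr := D.center P c) (g := D.ampRate P c)
    (fun i => (h.sol i).decays) k0 τ
  have e1 := integral_mul_waves (ctr := D.center P c) (g := D.flow P c)
    (fun i => (h.sol i).decays_deriv) k1 τ
  have e : ∀ ζ, ζ * D.fastT P c τ ζ = ζ * waves (D.center P c) (D.ampRate P c) D.w τ ζ
      - P.β * (ζ * waves (D.center P c) (D.flow P c) (fun i => deriv (D.w i)) τ ζ) := fun ζ => by
    simp only [Pair.fastT]; ring
  simp only [e]
  rw [integral_sub i0 (i1.const_mul _), integral_const_mul, e0, e1]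
  simp only [(h.sol _).deriv_moments.1, (h.sol _).deriv_moments.2, (h.sol _).first_moment,
    Pair.a1, Fin.sum_univ_two]
  ring

/-- The quantities R⁽ⁿ⁾ are moments of the interaction part about the centre of the second wave,
since η = ζ − βχ₂. Returning to moments about ζ = 0 adds βχ₂R⁽⁰⁾, the source of the χ₂ terms in the
system. -/
lemma integral_density (h : D.Regular P c φlim) {F : ℝ → ℝ → ℝ}
    (hF : Continuous fun z : ℝ × ℝ => F z.1 z.2)
    (hs : Split (D.center P c 0) (D.center P c 1) (fun τ ζ => F (D.fast P c τ ζ) (D.fastX P c τ ζ))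
      (fun τ ζ => F (D.A 0 * D.w 0 (ζ - D.center P c 0 τ))
        (P.β * (D.A 0 * deriv (D.w 0) (ζ - D.center P c 0 τ))))
      (fun τ ζ => F (D.A 1 * D.w 1 (ζ - D.center P c 1 τ))
        (P.β * (D.A 1 * deriv (D.w 1) (ζ - D.center P c 1 τ))))) (τ : ℝ) :
    ∫ ζ, F (D.fast P c τ ζ) (D.fastX P c τ ζ) = D.R P c F 0 τ + ∑ i, D.a P F i ∧
    ∫ ζ, ζ * F (D.fast P c τ ζ) (D.fastX P c τ ζ)
      = D.R P c F 1 τ + D.center P c 1 τ * D.R P c F 0 τ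
        + ∑ i, (D.firstMoment P F i + D.center P c i τ * D.a P F i) := by
  have k : ∀ i, Continuous (fun η => F (D.A i * D.w i η) (P.β * (D.A i * deriv (D.w i) η))) := by
    intro i
    have := (h.smooth_w i).continuous
    have := (h.smooth_w1 i).continuous
    exact hF.comp (by fun_prop : Continuous fun η =>
      (D.A i * D.w i η, P.β * (D.A i * deriv (D.w i) η)))
  have kU : Continuous (fun ζ => F (D.fast P c τ ζ) (D.fastX P c τ ζ)) :=
    hF.comp ((h.continuous_fast τ).prodMk (h.continuous_fastX τ))
  obtain ⟨iU, iU'⟩ := h.integrable_split hs kU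
  set E : Fin 2 → ℝ → ℝ := fun i η => F (D.A i * D.w i η) (P.β * (D.A i * deriv (D.w i) η)) with hE
  have d0 : Decays (E 0) := Localized.decays hs.left
  have d1 : Decays (E 1) := Localized.decays hs.right
  have i0 : Integrable (fun ζ => E 0 (ζ - D.center P c 0 τ)) :=
    (d0.comp_sub _).integrable ((k 0).comp (continuous_id.sub continuous_const))
  have i1 : Integrable (fun ζ => E 1 (ζ - D.center P c 1 τ)) :=
    (d1.comp_sub _).integrable ((k 1).comp (continuous_id.sub continuous_const))
  have i0' : Integrable (fun ζ => ζ * E 0 (ζ - D.center P c 0 τ)) :=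
    (d0.comp_sub _).integrable_mul ((k 0).comp (continuous_id.sub continuous_const))
  have i1' : Integrable (fun ζ => ζ * E 1 (ζ - D.center P c 1 τ)) :=
    (d1.comp_sub _).integrable_mul ((k 1).comp (continuous_id.sub continuous_const))
  have s0 : ∫ ζ, E 0 (ζ - D.center P c 0 τ) = D.a P F 0 :=
    integral_sub_right_eq_self (μ := (volume : Measure ℝ)) (E 0) (D.center P c 0 τ)
  have s1 : ∫ ζ, E 1 (ζ - D.center P c 1 τ) = D.a P F 1 :=
    integral_sub_right_eq_self (μ := (volume : Measure ℝ)) (E 1) (D.center P c 1 τ)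
  have s0' : ∫ ζ, ζ * E 0 (ζ - D.center P c 0 τ)
      = D.firstMoment P F 0 + D.center P c 0 τ * D.a P F 0 :=
    integral_moment_shift d0 (k 0) _
  have s1' : ∫ ζ, ζ * E 1 (ζ - D.center P c 1 τ)
      = D.firstMoment P F 1 + D.center P c 1 τ * D.a P F 1 :=
    integral_moment_shift d1 (k 1) _
  have hR : ∀ n, D.R P c F n τ = ∫ ζ, (ζ - D.center P c 1 τ) ^ n
      * (F (D.fast P c τ ζ) (D.fastX P c τ ζ) - E 0 (ζ - D.center P c 0 τ)
        - E 1 (ζ - D.center P c 1 τ)) := by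
    intro n
    rw [← integral_add_right_eq_self (μ := (volume : Measure ℝ)) _ (D.center P c 1 τ)]
    rw [Pair.R]
    congr 1 with η
    have e0 : η + D.center P c 1 τ - D.center P c 0 τ = η - D.σ P c τ := by
      simp only [Pair.center, Pair.σ]; ring
    simp only [Fin.sum_univ_two, Pair.arg, Pair.fast, Pair.fastX, waves, hE, e0,
      add_sub_cancel_right, if_true, one_ne_zero, if_false]
    ring
  have iD : Integrable (fun ζ => F (D.fast P c τ ζ) (D.fastX P c τ ζ)
      - E 0 (ζ - D.center P c 0 τ)) := iU.sub i0
  have iD' : Integrable (fun ζ => ζ * F (D.fast P c τ ζ) (D.fastX P c τ ζ)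
      - ζ * E 0 (ζ - D.center P c 0 τ)) := iU'.sub i0'
  have r0 : D.R P c F 0 τ
      = (∫ ζ, F (D.fast P c τ ζ) (D.fastX P c τ ζ)) - D.a P F 0 - D.a P F 1 := by
    rw [hR 0, ← s0, ← s1, ← integral_sub iU i0, ← integral_sub iD i1]
    congr 1 with ζ
    ring
  have r1 : D.R P c F 1 τ
      = (∫ ζ, ζ * F (D.fast P c τ ζ) (D.fastX P c τ ζ))
        - (D.firstMoment P F 0 + D.center P c 0 τ * D.a P F 0)
        - (D.firstMoment P F 1 + D.center P c 1 τ * D.a P F 1)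
        - D.center P c 1 τ * D.R P c F 0 τ := by
    rw [hR 0, hR 1, ← s0', ← s1', ← integral_sub iU' i0', ← integral_sub iD' i1',
      ← integral_const_mul, ← integral_sub]
    · congr 1 with ζ
      ring
    · exact iD'.sub i1'
    · simpa using (iD.sub i1).const_mul (D.center P c 1 τ)
  rw [Fin.sum_univ_two, Fin.sum_univ_two]
  exact ⟨by linarith, by linarith⟩

/-- The product expands into pair integrals of the profiles and their derivatives. Those of w'w for
one wave vanish, and integration by parts makes the two mixed ones opposite; this antisymmetry gives
G₁S₂' − G₂S₁' in L. -/
lemma integral_fastX_mul_fastT (h : D.Regular P c φlim) (τ : ℝ) :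
    ∫ ζ, D.fastX P c τ ζ * D.fastT P c τ ζ
      = -(P.β * (D.L P c τ + P.β * ∑ i, D.a2' i * (D.A i ^ 2 * D.V i))) := by
  have d0 := (h.sol 0).decays.comp_sub (D.σ P c τ)
  have d0' := (h.sol 0).decays_deriv.comp_sub (D.σ P c τ)
  have d1 := (h.sol 1).decays
  have d1' := (h.sol 1).decays_deriv
  have k0 := (h.smooth_w 0).continuous
  have k0' := (h.smooth_w1 0).continuous
  have k1 := (h.smooth_w 1).continuous
  have k1' := (h.smooth_w1 1).continuous
  set x : ℝ → ℝ := fun η => D.w 0 (η - D.σ P c τ) with hx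
  set x' : ℝ → ℝ := fun η => deriv (D.w 0) (η - D.σ P c τ) with hx'
  set y : ℝ → ℝ := D.w 1 with hy
  set y' : ℝ → ℝ := deriv (D.w 1) with hy'
  have hdx : ∀ η, HasDerivAt x (x' η) η := fun η =>
    (hasDerivAt_of_smooth (h.smooth_w 0) (η - D.σ P c τ)).comp_sub_const η _
  have hdy : ∀ η, HasDerivAt y (y' η) η := hasDerivAt_of_smooth (h.smooth_w 1)
  have kx : Continuous x := by fun_prop
  have kx' : Continuous x' := by fun_prop
  have ixx := (d0'.mul d0).integrable (by fun_prop)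
  have ixy := (d0'.mul d1).integrable (by fun_prop)
  have iyx := (d1'.mul d0).integrable (by fun_prop)
  have iyy := (d1'.mul d1).integrable (by fun_prop)
  have jxx := (d0'.mul d0').integrable (by fun_prop)
  have jxy := (d0'.mul d1').integrable (by fun_prop)
  have jyy := (d1'.mul d1').integrable (by fun_prop)
  have zxx : ∫ η, x' η * x η = 0 := by
    have := integral_eq_zero_of_hasDerivAt_of_integrable
      (fun η => (((hdx η).mul (hdx η)).const_mul (1 / 2)).congr_deriv
        (show _ = x' η * x η by ring)) ixx
      (((d0.mul d0).integrable (by fun_prop)).const_mul (1 / 2))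
    exact this
  have zyy : ∫ η, y' η * y η = 0 := by
    have := integral_eq_zero_of_hasDerivAt_of_integrable
      (fun η => (((hdy η).mul (hdy η)).const_mul (1 / 2)).congr_deriv
        (show _ = y' η * y η by ring)) iyy
      (((d1.mul d1).integrable (by fun_prop)).const_mul (1 / 2))
    exact this
  have zxy : (∫ η, x' η * y η) + ∫ η, y' η * x η = 0 := by
    have := integral_eq_zero_of_hasDerivAt_of_integrable
      (fun η => ((hdx η).mul (hdy η)).congr_deriv
        (show _ = x' η * y η + y' η * x η by ring)) (ixy.add iyx)
      ((d0.mul d1).integrable (by fun_prop))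
    rwa [integral_add ixy iyx] at this
  have s0 : ∫ η, x' η * x' η = D.a2' 0 := by
    have := integral_sub_right_eq_self (μ := (volume : Measure ℝ))
      (fun η => deriv (D.w 0) η ^ 2) (D.σ P c τ)
    rw [Pair.a2', ← this]
    simp only [hx', pow_two]
  have s1 : ∫ η, y' η * y' η = D.a2' 1 := by
    simp only [Pair.a2', hy', pow_two]
  have e : ∫ ζ, D.fastX P c τ ζ * D.fastT P c τ ζ
      = ∫ η, P.β * (D.G c 0 τ * D.ampRate P c 0 τ * (x' η * x η)
        + D.G c 0 τ * D.ampRate P c 1 τ * (x' η * y η)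
        + D.G c 1 τ * D.ampRate P c 0 τ * (y' η * x η)
        + D.G c 1 τ * D.ampRate P c 1 τ * (y' η * y η)
        + -(P.β * (D.G c 0 τ * D.flow P c 0 τ)) * (x' η * x' η)
        + -(P.β * (D.G c 0 τ * D.flow P c 1 τ + D.G c 1 τ * D.flow P c 0 τ)) * (x' η * y' η)
        + -(P.β * (D.G c 1 τ * D.flow P c 1 τ)) * (y' η * y' η)) := by
    rw [← integral_add_right_eq_self (μ := (volume : Measure ℝ)) _ (D.center P c 1 τ)]
    congr 1 with η
    have e0 : η + D.center P c 1 τ - D.center P c 0 τ = η - D.σ P c τ := by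
      simp only [Pair.center, Pair.σ]; ring
    simp only [Pair.fastX, Pair.fastT, waves, e0, add_sub_cancel_right, hx, hx', hy, hy']
    ring
  have t1 := ixx.const_mul (D.G c 0 τ * D.ampRate P c 0 τ)
  have t2 := t1.add (ixy.const_mul (D.G c 0 τ * D.ampRate P c 1 τ))
  have t3 := t2.add (iyx.const_mul (D.G c 1 τ * D.ampRate P c 0 τ))
  have t4 := t3.add (iyy.const_mul (D.G c 1 τ * D.ampRate P c 1 τ))
  have t5 := t4.add (jxx.const_mul (-(P.β * (D.G c 0 τ * D.flow P c 0 τ))))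
  have t6 := t5.add (jxy.const_mul
    (-(P.β * (D.G c 0 τ * D.flow P c 1 τ + D.G c 1 τ * D.flow P c 0 τ))))
  have m := integral_add' t6 (jyy.const_mul (-(P.β * (D.G c 1 τ * D.flow P c 1 τ))))
  rw [integral_add' t5 (jxy.const_mul _), integral_add' t4 (jxx.const_mul _),
    integral_add' t3 (iyy.const_mul _), integral_add' t2 (iyx.const_mul _),
    integral_add' t1 (ixy.const_mul _)] at m
  simp only [Pi.add_apply, integral_const_mul, zxx, zyy, s0, s1] at m
  rw [e, integral_const_mul, m]
  have l0 : ∫ η, x' η * y η = D.Λ10 P c τ := rfl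
  have l1 : ∫ η, x' η * y' η = D.Λ11 P c τ := rfl
  have l2 : ∫ η, y' η * x η = -D.Λ10 P c τ := by linarith
  rw [l0, l1, l2]
  simp only [Pair.L, Fin.sum_univ_two, Pair.ampRate, Pair.flow]
  ring

end Pair.Regular

namespace Pair.Regular

variable {D : Pair} {P : Params} {c : Corr} {φlim : Fin 2 → ℝ}

/-! ### The system annihilates the moments of the laws -/

lemma split_law1 (h : D.Regular P c φlim) :
    Split (D.center P c 0) (D.center P c 1) (P.fastLaw1 (D.psiDot P) (D.fast P c))
      (fun τ ζ => P.single1 (D.A 0) (D.V 0) (D.w 0) (ζ - D.center P c 0 τ))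
      (fun τ ζ => P.single1 (D.A 1) (D.V 1) (D.w 1) (ζ - D.center P c 1 τ)) := by
  obtain ⟨K, hK⟩ := h.separating
  exact (Split.poly1 (P := P) hK h.split_fast h.split_fastX h.split_fastXX h.split_fastT).congr
    h.fastLaw1_eq (fun _ _ => rfl) (fun _ _ => rfl)

lemma split_law2 (h : D.Regular P c φlim) :
    Split (D.center P c 0) (D.center P c 1) (P.fastLaw2 (D.psiDot P) (D.fast P c))
      (fun τ ζ => P.single2 (D.A 0) (D.V 0) (D.w 0) (ζ - D.center P c 0 τ))
      (fun τ ζ => P.single2 (D.A 1) (D.V 1) (D.w 1) (ζ - D.center P c 1 τ)) := by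
  obtain ⟨K, hK⟩ := h.separating
  exact (Split.poly2 (P := P) hK h.split_fast h.split_fastX h.split_fastXX h.split_fastT
    h.split_fastXT).congr h.fastLaw2_eq (fun _ _ => rfl) (fun _ _ => rfl)

lemma continuous_law1 (h : D.Regular P c φlim) (τ : ℝ) :
    Continuous (P.fastLaw1 (D.psiDot P) (D.fast P c) τ) := by
  have e : P.fastLaw1 (D.psiDot P) (D.fast P c) τ
      = (fun z : ℝ × ℝ => P.fastLaw1 (D.psiDot P) (D.fast P c) z.1 z.2) ∘ fun ζ => (τ, ζ) := rfl
  rw [e]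
  exact h.contDiff_fastLaw1.continuous.comp (by fun_prop)

lemma continuous_law2 (h : D.Regular P c φlim) (τ : ℝ) :
    Continuous (P.fastLaw2 (D.psiDot P) (D.fast P c) τ) := by
  have e : P.fastLaw2 (D.psiDot P) (D.fast P c) τ
      = (fun z : ℝ × ℝ => P.fastLaw2 (D.psiDot P) (D.fast P c) z.1 z.2) ∘ fun ζ => (τ, ζ) := rfl
  rw [e]
  exact h.contDiff_fastLaw2.continuous.comp (by fun_prop)

lemma density_p1 (h : D.Regular P c φlim) (τ : ℝ) :
    Integrable (fun ζ => P.p1 (D.fast P c τ ζ) (D.fastX P c τ ζ)) ∧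
    Integrable (fun ζ => ζ * P.p1 (D.fast P c τ ζ) (D.fastX P c τ ζ)) ∧
    ∫ ζ, P.p1 (D.fast P c τ ζ) (D.fastX P c τ ζ) = D.R P c P.p1 0 τ + ∑ i, D.a P P.p1 i := by
  obtain ⟨K, hK⟩ := h.separating
  have hs := Split.p1 (P := P) hK h.split_fast h.split_fastX
  have hi := h.integrable_split (τ := τ) hs
    (P.continuous_p1.comp ((h.continuous_fast τ).prodMk (h.continuous_fastX τ)))
  exact ⟨hi.1, hi.2, (h.integral_density P.continuous_p1 hs τ).1⟩

/-- Apart from the time derivative, the law is a derivative in ζ. Thus the integral is the rate of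
change of the mass, and the first moment is that of the centre of mass minus β∫P₁. -/
lemma moment_zero_law1 (h : D.Regular P c φlim) (hsys : D.SolvesSystem P c) (τ : ℝ) :
    ∫ ζ, P.fastLaw1 (D.psiDot P) (D.fast P c) τ ζ = 0 ∧
    ∫ ζ, ζ * P.fastLaw1 (D.psiDot P) (D.fast P c) τ ζ = 0 := by
  have hβ := h.β_pos.ne'
  obtain ⟨ip, ip', ep⟩ := h.density_p1 τ
  obtain ⟨iL, iL'⟩ := h.integrable_split h.split_law1 (h.continuous_law1 τ)
  obtain ⟨iT, iT'⟩ := h.integrable_split h.split_fastT (h.continuous_fastT τ)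
  have hF : ∀ ζ, HasDerivAt (fun ζ => P.β * P.p1 (D.fast P c τ ζ) (D.fastX P c τ ζ))
      (P.fastLaw1 (D.psiDot P) (D.fast P c) τ ζ - D.fastT P c τ ζ) ζ := fun ζ => by
    refine ((P.hasDerivAt_p1 (h.hasDerivAt_fast_x τ ζ)
      (h.hasDerivAt_fastX_x τ ζ)).const_mul P.β).congr_deriv ?_
    rw [h.fastLaw1_eq, Params.poly1]
    field_simp
    ring
  have i1 : Integrable (fun ζ => ζ * (P.β * P.p1 (D.fast P c τ ζ) (D.fastX P c τ ζ))) :=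
    (ip'.const_mul P.β).congr (ae_of_all _ fun ζ => by ring)
  have i2 : Integrable (fun ζ =>
      ζ * (P.fastLaw1 (D.psiDot P) (D.fast P c) τ ζ - D.fastT P c τ ζ)) :=
    (iL'.sub iT').congr (ae_of_all _ fun ζ => by simp only [Pi.sub_apply]; ring)
  obtain ⟨m0, m1⟩ := moments_of_hasDerivAt hF (ip.const_mul _) i1 (iL.sub iT) i2
  rw [integral_sub iL iT, h.integral_fastT] at m0
  simp only [mul_sub] at m1
  rw [integral_sub iL' iT', h.integral_mul_fastT, integral_const_mul, ep] at m1
  have hS : ∀ i, HasDerivAt (c.S i) (deriv (c.S i) τ) τ := fun i =>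
    hasDerivAt_of_smooth (h.lim.smooth_S i) τ
  have hφ : ∀ i, HasDerivAt (c.φ i) (deriv (c.φ i) τ) τ := fun i =>
    hasDerivAt_of_smooth (h.lim.smooth_φ i) τ
  have mass : ∑ i, D.a1 i * deriv (c.S i) τ = 0 := by
    have h1 := HasDerivAt.fun_sum (u := Finset.univ) fun i _ => (hS i).const_mul (D.a1 i)
    have h2 : (fun s => ∑ i, D.a1 i * c.S i s) = fun _ => 0 := funext hsys.mass
    rw [h2] at h1
    exact h1.unique (hasDerivAt_const τ 0)
  have phase := hsys.phase1 τ
  have hp : HasDerivAt (fun s => ∑ i, D.a1 i * (D.A i * c.φ i s + D.χ P c i s * c.S i s)) _ τ :=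
    HasDerivAt.fun_sum (u := Finset.univ) fun i _ => (((hφ i).const_mul (D.A i)).add
      ((h.hasDerivAt_χ i τ).mul (hS i))).const_mul (D.a1 i)
  rw [hp.deriv] at phase
  have ea : ∀ i, D.a P P.p1 i = D.V i * D.A i * D.a1 i := fun i => (h.sol i).p1_moment
  have hψ := h.psi.ne'
  constructor
  · have : ∑ i, D.ampRate P c i τ * D.a1 i = D.psiDot P * ∑ i, D.a1 i * deriv (c.S i) τ := by
      rw [Finset.mul_sum]
      exact Finset.sum_congr rfl fun i _ => by rw [Pair.ampRate]; ring
    rw [this, mass] at m0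
    linarith
  -- Besides the derivative in `phase1`, the centre of mass moves at the free rate ∑ a₁ᵢAᵢVᵢ;
  -- `p1_moment` identifies it with the free part of ∫P₁.
  · simp only [Fin.sum_univ_two, ea] at m1 phase
    rw [← phase] at m1
    simp only [Pair.ampRate, Pair.flow, Pair.center, Pair.G, Pair.phiDot] at m1 ⊢
    field_simp at m1
    linear_combination m1

lemma hasDerivAt_moment_q2 (h : D.Regular P c φlim) {n : ℕ} (hn : n ≤ 2) (τ : ℝ) :
    HasDerivAt (fun τ => ∫ ζ, ζ ^ n * P.q2 (D.fast P c τ ζ) (D.fastX P c τ ζ))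
      ((D.psiDot P)⁻¹ * ∫ ζ, ζ ^ n * P.rate2 (D.fast P c τ ζ) (D.fastX P c τ ζ) (D.fastT P c τ ζ)
        (D.fastXT P c τ ζ)) τ := by
  obtain ⟨K, hK⟩ := h.separating
  have hs := Split.q2 (P := P) hK h.split_fast h.split_fastX
  have hr := (Split.rate2 (P := P) hK h.split_fast h.split_fastX h.split_fastT
    h.split_fastXT).const_mul (D.psiDot P)⁻¹
  refine (hasDerivAt_moment (fun τ ζ => ?_) (fun τ => P.continuous_q2.comp
    ((h.continuous_fast τ).prodMk (h.continuous_fastX τ))) (fun τ => ?_) (hs.growth hK)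
    (hr.growth hK) hn τ).congr_deriv ?_
  · refine (P.hasDerivAt_q2 (h.hasDerivAt_fast_t τ ζ) (h.hasDerivAt_fastX_t τ ζ)).congr_deriv ?_
    simp only [Params.rate2]
    ring
  · have := h.continuous_fast τ
    have := h.continuous_fastX τ
    have := h.continuous_fastT τ
    have := h.continuous_fastXT τ
    unfold Params.rate2
    fun_prop
  · rw [← integral_const_mul]
    congr 1 with ζ
    ring

/-- The rate of change of ∫Q₂ is balanced by ∫K₂, which is `energy`. The first moment needs `phase2`
for the interaction part and `p2_moment` of both solitons for the rest. -/
lemma moment_zero_law2 (h : D.Regular P c φlim) (hsys : D.SolvesSystem P c) (τ : ℝ) :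
    ∫ ζ, P.fastLaw2 (D.psiDot P) (D.fast P c) τ ζ = 0 ∧
    ∫ ζ, ζ * P.fastLaw2 (D.psiDot P) (D.fast P c) τ ζ = 0 := by
  have hβ := h.β_pos.ne'
  have hψ := h.psi.ne'
  obtain ⟨K, hK⟩ := h.separating
  have kU := (h.continuous_fast τ).prodMk (h.continuous_fastX τ)
  have spp := Split.pp2 (P := P) hK h.split_fast h.split_fastX
  have sq := Split.q2 (P := P) hK h.split_fast h.split_fastX
  -- K₂ does not depend on u, so its free parts do not determine their first argument; the
  -- amplitudes are supplied explicitly.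
  have sk : Split (D.center P c 0) (D.center P c 1)
      (fun τ ζ => P.k2 (D.fast P c τ ζ) (D.fastX P c τ ζ)) _ _ :=
    (Split.k2 (P := P) hK h.split_fastX).congr (fun _ _ => rfl)
      (a' := fun τ ζ => P.k2 (D.A 0 * D.w 0 (ζ - D.center P c 0 τ))
        (P.β * (D.A 0 * deriv (D.w 0) (ζ - D.center P c 0 τ))))
      (b' := fun τ ζ => P.k2 (D.A 1 * D.w 1 (ζ - D.center P c 1 τ))
        (P.β * (D.A 1 * deriv (D.w 1) (ζ - D.center P c 1 τ)))) (fun _ _ => rfl) (fun _ _ => rfl)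
  have sxt := h.split_fastX.mul hK h.split_fastT
  have sr := Split.rate2 (P := P) hK h.split_fast h.split_fastX h.split_fastT h.split_fastXT
  obtain ⟨ipp, ipp'⟩ := h.integrable_split (τ := τ) spp (P.continuous_pp2.comp kU)
  obtain ⟨ik, ik'⟩ := h.integrable_split (τ := τ) sk (P.continuous_k2.comp kU)
  obtain ⟨ixt, ixt'⟩ := h.integrable_split (τ := τ) sxt
    ((h.continuous_fastX τ).mul (h.continuous_fastT τ))
  obtain ⟨ir, ir'⟩ := h.integrable_split (τ := τ) sr (by
    have := h.continuous_fast τ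
    have := h.continuous_fastX τ
    have := h.continuous_fastT τ
    have := h.continuous_fastXT τ
    unfold Params.rate2
    fun_prop)
  obtain ⟨iL, iL'⟩ := h.integrable_split h.split_law2 (h.continuous_law2 τ)
  set L := P.fastLaw2 (D.psiDot P) (D.fast P c) τ with hL
  set r : ℝ → ℝ := fun ζ => P.rate2 (D.fast P c τ ζ) (D.fastX P c τ ζ) (D.fastT P c τ ζ)
    (D.fastXT P c τ ζ) with hr
  set k : ℝ → ℝ := fun ζ => P.k2 (D.fast P c τ ζ) (D.fastX P c τ ζ) with hk
  have hF : ∀ ζ, HasDerivAt (fun ζ => P.β * P.pp2 (D.fast P c τ ζ) (D.fastX P c τ ζ)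
        + 2 * P.α ^ 2 * P.β * (D.fastX P c τ ζ * D.fastT P c τ ζ)) (L ζ - r ζ - k ζ) ζ := fun ζ => by
    refine (((P.hasDerivAt_pp2 (h.hasDerivAt_fast_x τ ζ)
      (h.hasDerivAt_fastX_x τ ζ)).const_mul P.β).add (((h.hasDerivAt_fastX_x τ ζ).mul
        (h.hasDerivAt_fastT_x τ ζ)).const_mul (2 * P.α ^ 2 * P.β))).congr_deriv ?_
    rw [hL, h.fastLaw2_eq, hr, hk]
    simp only [Params.poly2, Params.k2]
    field_simp
    ring
  have jF := (ipp.const_mul P.β).add (ixt.const_mul (2 * P.α ^ 2 * P.β))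
  have jF' : Integrable (fun ζ => ζ * (P.β * P.pp2 (D.fast P c τ ζ) (D.fastX P c τ ζ)
      + 2 * P.α ^ 2 * P.β * (D.fastX P c τ ζ * D.fastT P c τ ζ))) :=
    ((ipp'.const_mul P.β).add (ixt'.const_mul (2 * P.α ^ 2 * P.β))).congr
      (ae_of_all _ fun ζ => by simp only [Pi.add_apply]; ring)
  have jL : Integrable (fun ζ => L ζ - r ζ) := iL.sub ir
  have jL' : Integrable (fun ζ => ζ * L ζ - ζ * r ζ) := iL'.sub ir'
  obtain ⟨m0, m1⟩ := moments_of_hasDerivAt hF jF jF' (jL.sub ik)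
    ((jL'.sub ik').congr (ae_of_all _ fun ζ => by simp only [Pi.sub_apply]; ring))
  rw [integral_sub jL ik, integral_sub iL ir] at m0
  simp only [mul_sub] at m1
  rw [integral_sub jL' ik', integral_sub iL' ir',
    integral_add (ipp.const_mul _) (ixt.const_mul _), integral_const_mul, integral_const_mul,
    h.integral_fastX_mul_fastT, (h.integral_density P.continuous_pp2 spp τ).1,
    (h.integral_density P.continuous_k2 sk τ).2] at m1
  rw [(h.integral_density P.continuous_k2 sk τ).1] at m0
  have ak : ∀ i, D.a P P.k2 i = 0 := fun i => (h.sol i).k2_integral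
  have bq : ∀ i, D.firstMoment P P.q2 i = 0 := fun i => (h.sol i).q2_first_moment
  have hd0 := h.hasDerivAt_moment_q2 (n := 0) (by norm_num) τ
  have hd1 := h.hasDerivAt_moment_q2 (n := 1) (by norm_num) τ
  simp only [pow_zero, one_mul, pow_one] at hd0 hd1
  have f0 : (fun τ => ∫ ζ, P.q2 (D.fast P c τ ζ) (D.fastX P c τ ζ))
      = fun τ => D.R P c P.q2 0 τ + ∑ i, D.a P P.q2 i :=
    funext fun τ => (h.integral_density P.continuous_q2 sq τ).1
  have f1 : (fun τ => ∫ ζ, ζ * P.q2 (D.fast P c τ ζ) (D.fastX P c τ ζ))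
      = fun τ => D.R P c P.q2 1 τ + D.center P c 1 τ * D.R P c P.q2 0 τ
        + ∑ i, D.center P c i τ * D.a P P.q2 i :=
    funext fun τ => by
      rw [(h.integral_density P.continuous_q2 sq τ).2]
      simp only [bq, zero_add]
  have energy := hsys.energy τ
  have e0 : deriv (D.R P c P.q2 0) τ = (D.psiDot P)⁻¹ * ∫ ζ, r ζ := by
    have h1 := hd0.sub_const (∑ i, D.a P P.q2 i)
    have h2 : (fun τ => (∫ ζ, P.q2 (D.fast P c τ ζ) (D.fastX P c τ ζ)) - ∑ i, D.a P P.q2 i)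
        = D.R P c P.q2 0 := funext fun τ => by rw [congrFun f0 τ]; ring
    rw [h2] at h1
    exact h1.deriv
  rw [e0, mul_inv_cancel_left₀ hψ] at energy
  have phase := hsys.phase2 τ
  -- The bracket in `phase2` is the first moment of Q₂ divided by β, minus the linear drift of the
  -- free solitons contained in χᵢ.
  have e1 : HasDerivAt (fun s => (∑ i, D.a P P.q2 i * c.φ i s)
        + D.χ P c 1 s * D.R P c P.q2 0 s + (P.β)⁻¹ * D.R P c P.q2 1 s)
      (P.β⁻¹ * ((D.psiDot P)⁻¹ * ∫ ζ, ζ * r ζ)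
        - ∑ i, D.a P P.q2 i * (D.V i / D.psiDot P)) τ := by
    have h1 := (hd1.const_mul P.β⁻¹).sub
      (HasDerivAt.fun_sum (u := Finset.univ) fun i _ =>
        ((((hasDerivAt_id τ).const_mul (D.V i)).div_const (D.psiDot P)).const_mul (D.a P P.q2 i)))
    simp only [mul_one] at h1
    refine h1.congr_of_eventuallyEq (Eventually.of_forall fun s => ?_)
    simp only [Pi.sub_apply, id]
    rw [congrFun f1 s]
    simp only [Fin.sum_univ_two, Pair.center, Pair.χ]
    field_simp
    ring
  rw [e1.deriv] at phase
  have id0 := (h.sol 0).p2_moment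
  have id1 := (h.sol 1).p2_moment
  have q : ∀ i, ∫ η, P.q2 (D.A i * D.w i η) (P.β * (D.A i * deriv (D.w i) η)) = D.a P P.q2 i :=
    fun _ => rfl
  have pp : ∀ i, ∫ η, P.pp2 (D.A i * D.w i η) (P.β * (D.A i * deriv (D.w i) η)) = D.a P P.pp2 i :=
    fun _ => rfl
  have kk : ∀ i, ∫ η, η * P.k2 (D.A i * D.w i η) (P.β * (D.A i * deriv (D.w i) η))
      = D.firstMoment P P.k2 i := fun _ => rfl
  have ww : ∀ i, ∫ η, deriv (D.w i) η ^ 2 = D.a2' i := fun _ => rfl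
  rw [q, pp, kk, ww] at id0 id1
  simp only [Fin.sum_univ_two, ak] at m0 m1 phase
  refine ⟨by linarith, ?_⟩
  simp only [Pair.center] at m1
  have hc : D.psiDot P * (P.β⁻¹ * ((D.psiDot P)⁻¹ * ∫ ζ, ζ * r ζ)
      - (D.a P P.q2 0 * (D.V 0 / D.psiDot P) + D.a P P.q2 1 * (D.V 1 / D.psiDot P)))
      = P.β⁻¹ * (∫ ζ, ζ * r ζ) - (D.a P P.q2 0 * D.V 0 + D.a P P.q2 1 * D.V 1) := by
    field_simp
  rw [hc] at phase
  have g1 : P.β * P.β⁻¹ = 1 := mul_inv_cancel₀ hβ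
  linear_combination m1 + P.β * phase + P.β * id0 + P.β * id1
    + (-(∫ ζ, ζ * r ζ) - D.R P c P.k2 1 τ - D.firstMoment P P.k2 0 - D.firstMoment P P.k2 1) * g1

end Pair.Regular

/-! ### Return to the original variables -/

lemma abs_le_sq_of_decay {f C κ ε τ : ℝ} (hf : |f| * (1 + |τ|) ^ 2 ≤ C) (hκ : 0 < κ) (hε : 0 < ε)
    (hτ : κ / ε ≤ |τ|) : |f| ≤ C / κ ^ 2 * ε ^ 2 := by
  have h1 : (κ / ε) ^ 2 ≤ (1 + |τ|) ^ 2 :=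
    pow_le_pow_left₀ (by positivity) (by linarith) 2
  have h2 : |f| * (κ / ε) ^ 2 ≤ C := (mul_le_mul_of_nonneg_left h1 (abs_nonneg f)).trans hf
  rw [div_pow, ← mul_div_assoc, div_le_iff₀ (by positivity)] at h2
  rw [div_mul_eq_mul_div, le_div_iff₀ (by positivity)]
  exact h2

namespace Pair

variable {D : Pair} {P : Params} {c : Corr} {φlim : Fin 2 → ℝ} {tstar xstar : ℝ}

/-- The wave that starts behind can meet the other at a positive time only if it is faster. -/
lemma V_sub_pos (hx : D.x0 1 < D.x0 0) (htstar : 0 < tstar)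
    (hmeet : ∀ i, D.traj i tstar = xstar) : 0 < D.V 1 - D.V 0 := by
  have h0 := hmeet 0
  have h1 := hmeet 1
  simp only [Pair.traj] at h0 h1
  by_contra! h
  nlinarith

lemma traj_eq (hmeet : ∀ i, D.traj i tstar = xstar) (i : Fin 2) (t : ℝ) :
    D.traj i t = xstar + D.V i * (t - tstar) := by
  have := hmeet i
  simp only [Pair.traj] at this ⊢
  linarith

lemma tau_eq (hmeet : ∀ i, D.traj i tstar = xstar) (ε t : ℝ) :
    D.tau P ε t = D.psiDot P / ε * (t - tstar) := by
  rw [Pair.tau, traj_eq hmeet, traj_eq hmeet, Pair.psiDot]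
  ring

namespace Regular

lemma ansatz_eq (h : D.Regular P c φlim) (hmeet : ∀ i, D.traj i tstar = xstar) {ε : ℝ}
    (hε : 0 < ε) : D.ansatz P c ε = fun t x =>
      D.fast P c (D.psiDot P / ε * (t - tstar)) (P.β / ε * (x - xstar)) := by
  funext t x
  have hψ := h.psi.ne'
  have e : ∀ i, P.β * (x - (D.traj i t + ε * c.φ i (D.psiDot P / ε * (t - tstar)))) / ε
      = P.β / ε * (x - xstar) - D.center P c i (D.psiDot P / ε * (t - tstar)) := by
    intro i
    rw [traj_eq hmeet]
    simp only [Pair.center, Pair.χ]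
    field_simp
    ring
  simp only [Pair.ansatz, tau_eq hmeet, e, Fin.sum_univ_two]
  rfl

lemma isWeakAsymptoticSolution (h : D.Regular P c φlim) (hsys : D.SolvesSystem P c)
    (hmeet : ∀ i, D.traj i tstar = xstar) (T : ℝ) :
    P.IsWeakAsymptoticSolution T (D.ansatz P c) := by
  have hβ := h.β_pos
  have s1 := h.sol 0
  have s2 := h.sol 1
  refine ⟨fun ε hε => ?_, ?_, ?_, ?_⟩
  · rw [h.ansatz_eq hmeet hε]
    exact (h.contDiff_fast.comp (f := fun z : ℝ × ℝ => (D.psiDot P / ε * (z.1 - tstar),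
      P.β / ε * (z.2 - xstar))) (by fun_prop)).contDiffOn
  · refine contInDistribUnif_of_scaled T hβ h.contDiff_fast (a := D.psiDot P) (t₀ := tstar)
      (x₀ := xstar) (fun ε hε t x => congrFun (congrFun (h.ansatz_eq hmeet hε) t) x) ?_
    exact Split.pairing_bounded (l₁ := fun y => D.A 0 * D.w 0 y) (l₂ := fun y => D.A 1 * D.w 1 y)
      h.split_fast h.continuous_fast (s1.decays.const_mul _) (s2.decays.const_mul _)
      (continuous_const.mul s1.smooth.continuous) (continuous_const.mul s2.smooth.continuous)
      xstar P.β
  · refine isOD_of_scaled T hβ h.contDiff_fastLaw1 (a := D.psiDot P) (t₀ := tstar) (x₀ := xstar)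
      (fun ε hε t x => ?_) ?_
    · rw [h.ansatz_eq hmeet hε, P.law1_scaled _ hε]
    · have d1 : Decays (P.single1 (D.A 0) (D.V 0) (D.w 0)) := h.split_law1.left.decays
      have d2 : Decays (P.single1 (D.A 1) (D.V 1) (D.w 1)) := h.split_law1.right.decays
      exact h.split_law1.pairing_quadratic h.continuous_law1 d1 d2 s1.continuous1 s2.continuous1
        (s1.moments1 d1).1 (s1.moments1 d1).2 (s2.moments1 d2).1 (s2.moments1 d2).2
        (fun τ => (h.moment_zero_law1 hsys τ).1) (fun τ => (h.moment_zero_law1 hsys τ).2)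
        xstar P.β
  · refine isOD_of_scaled T hβ h.contDiff_fastLaw2 (a := D.psiDot P) (t₀ := tstar) (x₀ := xstar)
      (fun ε hε t x => ?_) ?_
    · rw [h.ansatz_eq hmeet hε, P.law2_scaled _ hε]
    · have d1 : Decays (P.single2 (D.A 0) (D.V 0) (D.w 0)) := h.split_law2.left.decays
      have d2 : Decays (P.single2 (D.A 1) (D.V 1) (D.w 1)) := h.split_law2.right.decays
      exact h.split_law2.pairing_quadratic h.continuous_law2 d1 d2 s1.continuous2 s2.continuous2
        (s1.moments2 hβ.ne' d1).1 (s1.moments2 hβ.ne' d1).2 (s2.moments2 hβ.ne' d2).1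
        (s2.moments2 hβ.ne' d2).2
        (fun τ => (h.moment_zero_law2 hsys τ).1) (fun τ => (h.moment_zero_law2 hsys τ).2)
        xstar P.β

/-! ### The asymptotics away from the collision -/

/-- Phase corrections carry a factor ε, so they shift the stretched argument by β(φᵢ₁ − sᵢ) without
any ε⁻¹; boundedness of w and w' then suffices. -/
lemma abs_ansatz_sub_free_le (h : D.Regular P c φlim) : ∃ M, 0 ≤ M ∧ ∀ s : Fin 2 → ℝ, ∀ ε > 0,
    ∀ t x, |D.ansatz P c ε t x - D.free P s ε t x|
      ≤ M * ∑ i, (|c.S i (D.tau P ε t)| + |c.φ i (D.tau P ε t) - s i|) := by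
  have hβ := h.β_pos
  have key : ∀ i, ∃ M, 0 ≤ M ∧ ∀ S a b ε x y : ℝ, 0 < ε →
      |(D.A i + S) * D.w i (P.β * (x - (y + ε * a)) / ε)
        - D.A i * D.w i (P.β * (x - (y + ε * b)) / ε)| ≤ M * (|S| + |a - b|) := by
    intro i
    obtain ⟨B, hB⟩ := (h.sol i).decays.bounded
    obtain ⟨E, hE⟩ := (h.sol i).decays_deriv.bounded
    have hB0 : 0 ≤ B := (abs_nonneg _).trans (hB 0)
    have hE0 : 0 ≤ E := (abs_nonneg _).trans (hE 0)
    refine ⟨B + |D.A i| * (E * P.β), by positivity, fun S a b ε x y hε => ?_⟩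
    have hlip : ∀ u v, |D.w i u - D.w i v| ≤ E * |u - v| := fun u v => by
      simpa [Real.norm_eq_abs] using convex_univ.norm_image_sub_le_of_norm_deriv_le
        (fun z _ => (hasDerivAt_of_smooth (h.smooth_w i) z).differentiableAt)
        (fun z _ => hE z) (mem_univ v) (mem_univ u)
    set u := P.β * (x - (y + ε * a)) / ε with hu
    set v := P.β * (x - (y + ε * b)) / ε with hv
    have huv : |u - v| = P.β * |a - b| := by
      have : u - v = -(P.β * (a - b)) := by rw [hu, hv]; field_simp; ring
      rw [this, abs_neg, abs_mul, abs_of_pos hβ]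
    have h1 := hlip u v
    rw [huv] at h1
    calc |(D.A i + S) * D.w i u - D.A i * D.w i v|
        = |S * D.w i u + D.A i * (D.w i u - D.w i v)| := by ring_nf
      _ ≤ |S| * |D.w i u| + |D.A i| * |D.w i u - D.w i v| := by
          rw [← abs_mul, ← abs_mul]; exact abs_add_le _ _
      _ ≤ |S| * B + |D.A i| * (E * (P.β * |a - b|)) := by
          gcongr
          exact hB u
      _ ≤ (B + |D.A i| * (E * P.β)) * (|S| + |a - b|) := by
          have h2 : 0 ≤ B * |a - b| := by positivity
          have h3 : 0 ≤ |D.A i| * (E * P.β) * |S| := by positivity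
          nlinarith
  choose M hM0 hM using key
  refine ⟨∑ i, M i, Finset.sum_nonneg fun i _ => hM0 i, fun s ε hε t x => ?_⟩
  rw [Pair.ansatz, Pair.free, ← Finset.sum_sub_distrib, Finset.mul_sum]
  refine (Finset.abs_sum_le_sum_abs _ _).trans (Finset.sum_le_sum fun i _ => ?_)
  refine (hM i _ _ (s i) ε x (D.traj i t) hε).trans (mul_le_mul_of_nonneg_right
    (Finset.single_le_sum (fun i _ => hM0 i) (Finset.mem_univ i)) (by positivity))

lemma away_from_collision (h : D.Regular P c φlim) (hmeet : ∀ i, D.traj i tstar = xstar)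
    {s : Fin 2 → ℝ} {I : Set ℝ} (hS : ∀ i, ∃ C, ∀ τ ∈ I, |c.S i τ| * (1 + |τ|) ^ 2 ≤ C)
    (hφ : ∀ i, ∃ C, ∀ τ ∈ I, |c.φ i τ - s i| * (1 + |τ|) ^ 2 ≤ C) {δ : ℝ} (hδ : 0 < δ) :
    ∃ C, 0 ≤ C ∧ ∀ ε > 0, ∀ t, δ ≤ |t - tstar| → D.tau P ε t ∈ I → ∀ x,
      |D.ansatz P c ε t x - D.free P s ε t x| ≤ C * ε ^ 2 := by
  obtain ⟨M, hM0, hM⟩ := h.abs_ansatz_sub_free_le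
  choose C hC using hS
  choose E hE using hφ
  have hκ : 0 < D.psiDot P * δ := mul_pos h.psi hδ
  refine ⟨|M * ∑ i, (C i / (D.psiDot P * δ) ^ 2 + E i / (D.psiDot P * δ) ^ 2)|, abs_nonneg _,
    fun ε hε t ht hI x => (hM s ε hε t x).trans ?_⟩
  have hτ : D.psiDot P * δ / ε ≤ |D.tau P ε t| := by
    rw [tau_eq hmeet, abs_mul, abs_of_pos (div_pos h.psi hε), div_mul_eq_mul_div]
    have := h.psi
    gcongr
  calc M * ∑ i, (|c.S i (D.tau P ε t)| + |c.φ i (D.tau P ε t) - s i|)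
      ≤ M * ∑ i, (C i / (D.psiDot P * δ) ^ 2 * ε ^ 2 + E i / (D.psiDot P * δ) ^ 2 * ε ^ 2) := by
        gcongr with i
        · exact abs_le_sq_of_decay (hC i _ hI) hκ hε hτ
        · exact abs_le_sq_of_decay (hE i _ hI) hκ hε hτ
    _ = (M * ∑ i, (C i / (D.psiDot P * δ) ^ 2 + E i / (D.psiDot P * δ) ^ 2)) * ε ^ 2 := by
        simp only [← add_mul, ← Finset.sum_mul]; ring
    _ ≤ _ := by gcongr; exact le_abs_self _

lemma before_collision (h : D.Regular P c φlim) (hmeet : ∀ i, D.traj i tstar = xstar) {δ : ℝ}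
    (hδ : 0 < δ) : ∃ C, 0 ≤ C ∧ ∀ ε > 0, ∀ t ≤ tstar - δ, ∀ x,
      |D.ansatz P c ε t x - D.free P 0 ε t x| ≤ C * ε ^ 2 := by
  have hS : ∀ i, ∃ C, ∀ τ ∈ Iic (0 : ℝ), |c.S i τ| * (1 + |τ|) ^ 2 ≤ C := by
    intro i
    have := rapid_limit_bot (h.lim.smooth_S i) (h.lim.rapid_S i) (h.lim.S_bot i) two_ne_zero
    simp only [sub_zero] at this
    exact this
  have hφ : ∀ i, ∃ C, ∀ τ ∈ Iic (0 : ℝ), |c.φ i τ - (0 : Fin 2 → ℝ) i| * (1 + |τ|) ^ 2 ≤ C := by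
    intro i
    exact rapid_limit_bot (h.lim.smooth_φ i) (h.lim.rapid_φ i) (h.lim.φ_bot i) two_ne_zero
  obtain ⟨C, hC0, hC⟩ := h.away_from_collision hmeet hS hφ hδ
  refine ⟨C, hC0, fun ε hε t ht x => hC ε hε t ?_ ?_ x⟩
  · rw [abs_of_nonpos (by linarith)]; linarith
  · rw [tau_eq hmeet, mem_Iic]
    exact mul_nonpos_of_nonneg_of_nonpos (div_pos h.psi hε).le (by linarith)

lemma after_collision (h : D.Regular P c φlim) (hmeet : ∀ i, D.traj i tstar = xstar) {δ : ℝ}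
    (hδ : 0 < δ) : ∃ C, 0 ≤ C ∧ ∀ ε > 0, ∀ t, tstar + δ ≤ t → ∀ x,
      |D.ansatz P c ε t x - D.free P φlim ε t x| ≤ C * ε ^ 2 := by
  have hS : ∀ i, ∃ C, ∀ τ ∈ Ici (0 : ℝ), |c.S i τ| * (1 + |τ|) ^ 2 ≤ C := by
    intro i
    have := rapid_limit_top (h.lim.smooth_S i) (h.lim.rapid_S i) (h.lim.S_top i) two_ne_zero
    simp only [sub_zero] at this
    exact this
  have hφ : ∀ i, ∃ C, ∀ τ ∈ Ici (0 : ℝ), |c.φ i τ - φlim i| * (1 + |τ|) ^ 2 ≤ C := by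
    intro i
    exact rapid_limit_top (h.lim.smooth_φ i) (h.lim.rapid_φ i) (h.lim.φ_top i) two_ne_zero
  obtain ⟨C, hC0, hC⟩ := h.away_from_collision hmeet hS hφ hδ
  refine ⟨C, hC0, fun ε hε t ht x => hC ε hε t ?_ ?_ x⟩
  · rw [abs_of_nonneg (by linarith)]; linarith
  · rw [tau_eq hmeet, mem_Ici]
    exact mul_nonneg (div_pos h.psi hε).le (by linarith)

end Regular

end Pair

end DP

end

/-! ### The theorem -/

theorem theorem2 (P : DP.Params) (hP : P.Admissible)
    (D : DP.Pair) (g : Fin 2 → ℝ) (tstar xstar T : ℝ) (hT : 0 < T)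
    (hA : 0 < D.A 0 ∧ D.A 0 < D.A 1)
    (hV : ∀ i, P.IsVelocity (D.A i) (D.V i) (g i))
    (hcrit : ∀ i, P.SolitonCriterion (D.A i) (g i))
    (hw : ∀ i, P.IsProfile (D.A i) (D.V i) (D.w i))
    (hx : D.x0 1 < D.x0 0)
    (htstar : 0 < tstar) (hmeet : ∀ i, D.traj i tstar = xstar)
    (c : DP.Corr) (φlim : Fin 2 → ℝ)
    (hsys : D.SolvesSystem P c) (hlim : c.HasLimits φlim) :
    P.IsWeakAsymptoticSolution T (D.ansatz P c) ∧
    (∃ C, ∃ ε₀ > 0, ∀ ε ∈ Set.Ioc 0 ε₀, ∀ x,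
      |D.ansatz P c ε 0 x - D.initial P ε x| ≤ C * ε ^ 2) ∧
    D.Elastic P T tstar φlim (D.ansatz P c) := by
  have hA' : ∀ i, 0 < D.A i := Fin.forall_fin_two.2 ⟨hA.1, hA.1.trans hA.2⟩
  have h : D.Regular P c φlim :=
    ⟨hP, fun i => (hw i).isSoliton hP (hA' i) (hV i),
      mul_pos (P.β_pos hP) (DP.Pair.V_sub_pos hx htstar hmeet), hlim⟩
  refine ⟨h.isWeakAsymptoticSolution hsys hmeet T, ?_, fun δ hδ => ?_⟩
  -- The instant t = 0 precedes the collision by exactly δ = t*.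
  · obtain ⟨C, -, hC⟩ := h.before_collision hmeet htstar
    refine ⟨C, 1, one_pos, fun ε hε x => ?_⟩
    have := hC ε hε.1 0 (by simp) x
    simpa [DP.Pair.free, DP.Pair.initial, DP.Pair.traj] using this
  · obtain ⟨C, hC0, hC⟩ := h.before_collision hmeet hδ
    obtain ⟨E, hE0, hE⟩ := h.after_collision hmeet hδ
    refine ⟨C + E, 1, one_pos, fun ε hε t _ x => ⟨fun ht => ?_, fun ht => ?_⟩⟩
    · exact (hC ε hε.1 t ht x).trans (by gcongr; linarith)
    · exact (hE ε hε.1 t ht x).trans (by gcongr; linarith)
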